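/- **Setting.** Let $X=\{\mathbf x\in\{0,1\}^m:\mathbf H\mathbf x\le\mathbf h\}$, $Y(\mathbf x)=\{\mathbf y\in\mathbb R^n_+:\mathbf F\mathbf y+\mathbf L\mathbf x\le\mathbf f\}$ and $S=\{\mathbf c\in\mathbb R^n:\mathbf B\mathbf c\le\mathbf b\}$. Assume that $X$ and $Y(\mathbf x)$, $\mathbf x\in X$, are non-empty and bounded and that $S$ is non-empty and compact. Let $\hat{\mathbf c}_l^{(1)},\dots,\hat{\mathbf c}_l^{(k_l)}\in S$ and $\hat{\mathbf c}_f^{(1)},\dots,\hat{\mathbf c}_f^{(k_f)}\in S$ ($k_l,k_f\ge1$) be any realizations of the leader's and the follower's data sets (in particular, i.i.d. samples from a distribution on $S$, the follower's data being a subset of the leader's). Let $\alpha_l,\alpha_f\in(0,1)$, $\varepsilon_l,\varepsilon_f\ge0$, $p\in\{1,\infty\}$ and $\frac1p+\frac1q=1$. For $i\in\{l,f\}$ let $\mathcal Q_i$ be the set of all probability distributions $\mathbb Q$ on $S$ whose type-1 Wasserstein distance with respect to the $\ell_p$-norm from the empirical distribution $\frac1{k_i}\sum_k\delta(\hat{\mathbf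 c}_i^{(k)})$ is at most $\varepsilon_i$. With $a^+=\max\{a,0\}$ and $a^-=\min\{a,0\}$, put $$\rho_l(\mathbf y,\mathbb Q)=\min_{t\in\mathbb R}\Big\{t+\tfrac1{1-\alpha_l}\mathbb E_{\mathbb Q}(\mathbf c^\top\mathbf y-t)^+\Big\},\qquad \rho_f(\mathbf y,\mathbb Q)=\max_{t\in\mathbb R}\Big\{t+\tfrac1{1-\alpha_f}\mathbb E_{\mathbb Q}(\mathbf c^\top\mathbf y-t)^-\Big\}.$$ The basic distributionally robust interdiction problem is $$[\mathrm{DRI}]\quad \hat z_b^*=\min_{\mathbf x,\mathbf y}\ \max_{\mathbb Q\in\mathcal Q_l}\rho_l(\mathbf y,\mathbb Q)\quad\text{s.t. }\mathbf x\in X,\ \ \mathbf y\in\operatorname*{argmax}_{\tilde{\mathbf y}\in Y(\mathbf x)}\ \min_{\mathbb Q\in\mathcal Q_f}\rho_f(\tilde{\mathbf y},\mathbb Q).$$ Write $\boldsymbol\Delta_i^{(k)}=\mathbf b-\mathbf B\hat{\mathbf c}_i^{(k)}$, which is $\ge\mathbf 0$. **Theorem 1.** All the minima and maxima above are attained, and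 the following holds. (i) [DRI] has the single-level reformulation $$\hat z_b^*=\min\Big\{t_l+\tfrac1{1-\alpha_l}\Big(\varepsilon_l\lambda_l+\tfrac1{k_l}\sum_{k}s_l^{(k)}\Big)\Big\}$$ over $\mathbf x,\mathbf y,\boldsymbol\nu_l,\mathbf s_l,\lambda_l,t_l,\boldsymbol\nu_f,\mathbf s_f,\lambda_f,t_f,\overline{\boldsymbol\mu}_f,\underline{\boldsymbol\mu}_f,\boldsymbol\beta_f,\boldsymbol\gamma_f$ subject to $\mathbf x\in X$ and * the leader's constraints, for all $k\le k_l$: $\hat{\mathbf c}_l^{(k)\top}\mathbf y-t_l+\boldsymbol\Delta_l^{(k)\top}\boldsymbol\nu_l^{(k)}\le s_l^{(k)}$, $\|\mathbf B^\top\boldsymbol\nu_l^{(k)}-\mathbf y\|_q\le\lambda_l$, $\boldsymbol\nu_l^{(k)}\ge\mathbf 0$, $s_l^{(k)}\ge0$; * the follower's primal constraints: $\mathbf F\mathbf y\le\mathbf f-\mathbf L\mathbf x$, $\mathbf y\ge\mathbf 0$, $\lambda_f\ge0$ and, for all $k\le k_f$: $-\hat{\mathbf c}_f^{(k)\top}\mathbf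 y+t_f+\boldsymbol\Delta_f^{(k)\top}\boldsymbol\nu_f^{(k)}\le s_f^{(k)}$, $\|\mathbf B^\top\boldsymbol\nu_f^{(k)}+\mathbf y\|_q\le\lambda_f$, $\boldsymbol\nu_f^{(k)}\ge\mathbf 0$, $s_f^{(k)}\ge0$; * the follower's dual constraints: $\mathbf F^\top\boldsymbol\beta_f-\sum_k\gamma_f^{(k)}\hat{\mathbf c}_f^{(k)}+\sum_k(\overline{\boldsymbol\mu}_f^{(k)}-\underline{\boldsymbol\mu}_f^{(k)})\ge\mathbf 0$, $\sum_k\|\overline{\boldsymbol\mu}_f^{(k)}+\underline{\boldsymbol\mu}_f^{(k)}\|_p\le\frac{\varepsilon_f}{1-\alpha_f}$, $\sum_k\gamma_f^{(k)}=1$, $\boldsymbol\beta_f\ge\mathbf 0$ and, for all $k\le k_f$: $\gamma_f^{(k)}\boldsymbol\Delta_f^{(k)}+\mathbf B(\overline{\boldsymbol\mu}_f^{(k)}-\underline{\boldsymbol\mu}_f^{(k)})\ge\mathbf 0$, $0\le\gamma_f^{(k)}\le\frac1{(1-\alpha_f)k_f}$, $\overline{\boldsymbol\mu}_f^{(k)},\underline{\boldsymbol\mu}_f^{(k)}\ge\mathbf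 0$; * strong duality: $(-\mathbf L\mathbf x+\mathbf f)^\top\boldsymbol\beta_f=t_f-\frac1{1-\alpha_f}\big(\varepsilon_f\lambda_f+\frac1{k_f}\sum_ks_f^{(k)}\big)$. Here "reformulation" means: the pairs $(\mathbf x,\mathbf y)$ that extend to a feasible solution are exactly the feasible pairs of [DRI]; for each such pair the minimum of the objective over its extensions is $\max_{\mathbb Q\in\mathcal Q_l}\rho_l(\mathbf y,\mathbb Q)$; and both problems have an optimal solution, with the same value. (ii) Replace each norm constraint by linear inequalities (with auxiliary variables), and each product $x_j(\boldsymbol\beta_f)_r$ by a variable $w_{rj}$ with $0\le w_{rj}\le(\boldsymbol\beta_f)_r$ and $(\boldsymbol\beta_f)_r-M(1-x_j)\le w_{rj}\le Mx_j$. There is an $M_0$, which depends on the instance, such that for every $M\ge M_0$ the resulting mixed-integer linear program, with the binary variables $\mathbf x$ and all others continuous, is a reformulation of [DRI] in the same sense. (iii) This program has polynomial size: the numbers of its variables and constraints are bounded by a polynomial in $m$, $n$, $k_l$, $k_f$ and the numbers of rows of $\mathbf H,\mathbf F,\mathbf B$. Moreover, if all data are rational, then a rational $M_0$ as in (ii),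 valid for all rational $M\ge M_0$, can be chosen such that the encoding length of the program with $M=M_0$ is bounded by a fixed polynomial in the encoding length of the data. -/

import Mathlib

open MeasureTheory
open scoped ENNReal Matrix

/-- The two admissible exponents `p ∈ {1, ∞}` of the ground norm. -/
inductive Ell where
  | one
  | infty

namespace Ell

/-- The conjugate exponent `q`, with `1/p + 1/q = 1`. -/
def conj : Ell → Ell
  | one => infty
  | infty => one

/-- The norms `ℓ₁` and `ℓ_∞` on `ℝⁿ` (the norm of the function type `Fin n → ℝ` is the
maximum norm). -/
noncomputable def norm {n : ℕ} : Ell → (Fin n → ℝ) → ℝ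
  | one, v => ∑ i, |v i|
  | infty, v => ‖v‖

end Ell

/-- The dimensions of an instance: `x ∈ {0,1}^m`, `y, c ∈ ℝⁿ`, the number of rows of the systems
that describe `X`, `Y(x)` and `S`, and the sizes of the two data sets. -/
structure Dims where
  m : ℕ
  n : ℕ
  dX : ℕ
  dY : ℕ
  dS : ℕ
  kl : ℕ
  kf : ℕ

/-- The sum of all dimensions. -/
def Dims.total (d : Dims) : ℕ := d.m + d.n + d.dX + d.dY + d.dS + d.kl + d.kf

/-- The data of a basic distributionally robust interdiction problem, with entries in `K`. -/
structure DRIData (d : Dims) (K : Type) where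
  H : Matrix (Fin d.dX) (Fin d.m) K
  h : Fin d.dX → K
  F : Matrix (Fin d.dY) (Fin d.n) K
  L : Matrix (Fin d.dY) (Fin d.m) K
  f : Fin d.dY → K
  B : Matrix (Fin d.dS) (Fin d.n) K
  b : Fin d.dS → K
  /-- the leader's samples -/
  cl : Fin d.kl → Fin d.n → K
  /-- the follower's samples -/
  cf : Fin d.kf → Fin d.n → K
  /-- the leader's confidence level -/
  al : K
  /-- the follower's confidence level -/
  af : K
  /-- the leader's Wasserstein radius -/
  el : K
  /-- the follower's Wasserstein radius -/
  ef : K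
  /-- the exponent of the ground norm of both Wasserstein distances -/
  p : Ell

namespace DRIData

variable {d : Dims}

/-- A rational instance, read as a real one. -/
def toReal (D : DRIData d ℚ) : DRIData d ℝ where
  H := fun i j => (D.H i j : ℝ)
  h := fun i => (D.h i : ℝ)
  F := fun i j => (D.F i j : ℝ)
  L := fun i j => (D.L i j : ℝ)
  f := fun i => (D.f i : ℝ)
  B := fun i j => (D.B i j : ℝ)
  b := fun i => (D.b i : ℝ)
  cl := fun k i => (D.cl k i : ℝ)
  cf := fun k i => (D.cf k i : ℝ)
  al := (D.al : ℝ)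
  af := (D.af : ℝ)
  el := (D.el : ℝ)
  ef := (D.ef : ℝ)
  p := D.p

/-- `Δ_l^(k) = b - B ĉ_l^(k)`. -/
def deltaL {K : Type} [Field K] (D : DRIData d K) (k : Fin d.kl) : Fin d.dS → K :=
  D.b - D.B *ᵥ D.cl k

/-- `Δ_f^(k) = b - B ĉ_f^(k)`. -/
def deltaF {K : Type} [Field K] (D : DRIData d K) (k : Fin d.kf) : Fin d.dS → K :=
  D.b - D.B *ᵥ D.cf k

/-! The basic distributionally robust interdiction problem. -/

/-- The leader's feasible set `X = {x ∈ {0,1}^m : H x ≤ h}`. -/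
def X (D : DRIData d ℝ) : Set (Fin d.m → ℝ) :=
  {x | (∀ j, x j = 0 ∨ x j = 1) ∧ D.H *ᵥ x ≤ D.h}

/-- The follower's feasible set `Y(x) = {y ∈ ℝⁿ₊ : F y + L x ≤ f}`. -/
def Y (D : DRIData d ℝ) (x : Fin d.m → ℝ) : Set (Fin d.n → ℝ) :=
  {y | 0 ≤ y ∧ D.F *ᵥ y + D.L *ᵥ x ≤ D.f}

/-- The support `S = {c ∈ ℝⁿ : B c ≤ b}`. -/
def S (D : DRIData d ℝ) : Set (Fin d.n → ℝ) := {c | D.B *ᵥ c ≤ D.b}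

end DRIData

/-- The empirical distribution `(1/k) ∑ δ(ĉ^(k))` of `k` samples. -/
noncomputable def empirical {n k : ℕ} (c : Fin k → Fin n → ℝ) : Measure (Fin n → ℝ) :=
  (k : ℝ≥0∞)⁻¹ • ∑ i, Measure.dirac (c i)

/-- The type-1 Wasserstein distance with respect to the `ℓ_p` norm: the infimum of the transport
costs over all couplings. -/
noncomputable def wasserstein {n : ℕ} (p : Ell) (P Q : Measure (Fin n → ℝ)) : ℝ≥0∞ :=
  ⨅ π ∈ {π : Measure ((Fin n → ℝ) × (Fin n → ℝ)) |
      π.map Prod.fst = P ∧ π.map Prod.snd = Q},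
    ∫⁻ z, ENNReal.ofReal (p.norm (z.1 - z.2)) ∂π

/-- The Wasserstein ball of radius `ε` around `P` in the set of all probability distributions
on `S`. -/
def wassersteinBall {n : ℕ} (p : Ell) (S : Set (Fin n → ℝ)) (P : Measure (Fin n → ℝ)) (ε : ℝ) :
    Set (Measure (Fin n → ℝ)) :=
  {Q | IsProbabilityMeasure Q ∧ Q Sᶜ = 0 ∧ wasserstein p P Q ≤ ENNReal.ofReal ε}

/-- `t + (1 - α)⁻¹ E_Q (cᵀy - t)⁺`, whose minimum over `t` is the right-tail CVaR. -/
noncomputable def rightTailFun {n : ℕ} (α : ℝ) (y : Fin n → ℝ) (Q : Measure (Fin n → ℝ))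
    (t : ℝ) : ℝ :=
  t + 1 / (1 - α) * ∫ c, max (c ⬝ᵥ y - t) 0 ∂Q

/-- `t + (1 - α)⁻¹ E_Q (cᵀy - t)⁻` with `a⁻ = min {a, 0}`, whose maximum over `t` is the
left-tail CVaR. -/
noncomputable def leftTailFun {n : ℕ} (α : ℝ) (y : Fin n → ℝ) (Q : Measure (Fin n → ℝ))
    (t : ℝ) : ℝ :=
  t + 1 / (1 - α) * ∫ c, min (c ⬝ᵥ y - t) 0 ∂Q

/-- Right-tail CVaR of `cᵀy` under `Q` at level `α`. -/
noncomputable def rightCVaR {n : ℕ} (α : ℝ) (y : Fin n → ℝ) (Q : Measure (Fin n → ℝ)) : ℝ :=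
  sInf (Set.range (rightTailFun α y Q))

/-- Left-tail CVaR of `cᵀy` under `Q` at level `α`. -/
noncomputable def leftCVaR {n : ℕ} (α : ℝ) (y : Fin n → ℝ) (Q : Measure (Fin n → ℝ)) : ℝ :=
  sSup (Set.range (leftTailFun α y Q))

namespace DRIData

variable {d : Dims}

/-- The leader's ambiguity set. -/
noncomputable def ambL (D : DRIData d ℝ) : Set (Measure (Fin d.n → ℝ)) :=
  wassersteinBall D.p D.S (empirical D.cl) D.el

/-- The follower's ambiguity set. -/
noncomputable def ambF (D : DRIData d ℝ) : Set (Measure (Fin d.n → ℝ)) :=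
  wassersteinBall D.p D.S (empirical D.cf) D.ef

/-- The leader's objective: the worst-case right-tail CVaR. -/
noncomputable def worstL (D : DRIData d ℝ) (y : Fin d.n → ℝ) : ℝ :=
  sSup (rightCVaR D.al y '' D.ambL)

/-- The follower's objective: the worst-case left-tail CVaR. -/
noncomputable def worstF (D : DRIData d ℝ) (y : Fin d.n → ℝ) : ℝ :=
  sInf (leftCVaR D.af y '' D.ambF)

/-- The feasible pairs of the (optimistic) bilevel problem: `x ∈ X`, and `y` maximizes the
follower's objective over `Y(x)`. -/
def bilevelFeasible (D : DRIData d ℝ) :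
    Set ((Fin d.m → ℝ) × (Fin d.n → ℝ)) :=
  {z | z.1 ∈ D.X ∧ z.2 ∈ D.Y z.1 ∧ ∀ y ∈ D.Y z.1, D.worstF y ≤ D.worstF z.2}

/-- The standing assumptions: `X` and all `Y(x)`, `x ∈ X`, are non-empty and bounded; the support
`S` is non-empty and compact; both data sets are non-empty and lie in `S`; the confidence levels
lie in `(0,1)`, and the radii are non-negative. -/
structure Standing (D : DRIData d ℝ) : Prop where
  X_nonempty : D.X.Nonempty
  X_bounded : Bornology.IsBounded D.X
  Y_nonempty : ∀ x ∈ D.X, (D.Y x).Nonempty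
  Y_bounded : ∀ x ∈ D.X, Bornology.IsBounded (D.Y x)
  S_nonempty : D.S.Nonempty
  S_compact : IsCompact D.S
  kl_pos : 0 < d.kl
  kf_pos : 0 < d.kf
  cl_mem : ∀ k, D.cl k ∈ D.S
  cf_mem : ∀ k, D.cf k ∈ D.S
  al_pos : 0 < D.al
  al_lt : D.al < 1
  af_pos : 0 < D.af
  af_lt : D.af < 1
  el_nonneg : 0 ≤ D.el
  ef_nonneg : 0 ≤ D.ef

/-- All minima and maxima in the two objectives of the bilevel problem are attained. -/
structure Attained (D : DRIData d ℝ) : Prop where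
  rhoL : ∀ y, ∀ Q ∈ D.ambL, IsLeast (Set.range (rightTailFun D.al y Q)) (rightCVaR D.al y Q)
  rhoF : ∀ y, ∀ Q ∈ D.ambF, IsGreatest (Set.range (leftTailFun D.af y Q)) (leftCVaR D.af y Q)
  worstL : ∀ y, IsGreatest (rightCVaR D.al y '' D.ambL) (D.worstL y)
  worstF : ∀ y, IsLeast (leftCVaR D.af y '' D.ambF) (D.worstF y)

end DRIData

/-! The single-level reformulation. -/

/-- The variables of the single-level problem. -/
structure SLVars (d : Dims) where
  x : Fin d.m → ℝ
  y : Fin d.n → ℝ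
  nuL : Fin d.kl → Fin d.dS → ℝ
  sL : Fin d.kl → ℝ
  lamL : ℝ
  tL : ℝ
  nuF : Fin d.kf → Fin d.dS → ℝ
  sF : Fin d.kf → ℝ
  lamF : ℝ
  tF : ℝ
  muUp : Fin d.kf → Fin d.n → ℝ
  muLo : Fin d.kf → Fin d.n → ℝ
  beta : Fin d.dY → ℝ
  gamma : Fin d.kf → ℝ

namespace DRIData

variable {d : Dims}

/-- The leader's objective in the single-level problem. -/
noncomputable def slObjective (D : DRIData d ℝ) (v : SLVars d) : ℝ :=
  v.tL + 1 / (1 - D.al) * (D.el * v.lamL + 1 / (d.kl : ℝ) * ∑ k, v.sL k)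

/-- The objective of the follower's primal linear program. -/
noncomputable def primalObjective (D : DRIData d ℝ) (v : SLVars d) : ℝ :=
  v.tF - 1 / (1 - D.af) * (D.ef * v.lamF + 1 / (d.kf : ℝ) * ∑ k, v.sF k)

/-- The objective of the follower's dual linear program. -/
def dualObjective (D : DRIData d ℝ) (v : SLVars d) : ℝ :=
  (-(D.L *ᵥ v.x) + D.f) ⬝ᵥ v.beta

/-- The constraints of the linear program for the leader's worst-case CVaR. -/
structure LeaderFeasible (D : DRIData d ℝ) (v : SLVars d) : Prop where
  loss : ∀ k, D.cl k ⬝ᵥ v.y - v.tL + D.deltaL k ⬝ᵥ v.nuL k ≤ v.sL k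
  norm : ∀ k, D.p.conj.norm (D.Bᵀ *ᵥ v.nuL k - v.y) ≤ v.lamL
  nu_nonneg : ∀ k, 0 ≤ v.nuL k
  s_nonneg : ∀ k, 0 ≤ v.sL k

/-- The constraints of the follower's primal linear program. -/
structure PrimalFeasible (D : DRIData d ℝ) (v : SLVars d) : Prop where
  system : D.F *ᵥ v.y ≤ D.f - D.L *ᵥ v.x
  loss : ∀ k, -(D.cf k ⬝ᵥ v.y) + v.tF + D.deltaF k ⬝ᵥ v.nuF k ≤ v.sF k
  norm : ∀ k, D.p.conj.norm (D.Bᵀ *ᵥ v.nuF k + v.y) ≤ v.lamF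
  nu_nonneg : ∀ k, 0 ≤ v.nuF k
  s_nonneg : ∀ k, 0 ≤ v.sF k
  y_nonneg : 0 ≤ v.y
  lam_nonneg : 0 ≤ v.lamF

/-- The constraints of the follower's dual linear program. In `budget`, the sum over `k` stands
outside of the norm; for `p = 1` this is the same as the norm of the sum, all the summands being
non-negative vectors. -/
structure DualFeasible (D : DRIData d ℝ) (v : SLVars d) : Prop where
  y_col : 0 ≤ D.Fᵀ *ᵥ v.beta - ∑ k, v.gamma k • D.cf k + ∑ k, (v.muUp k - v.muLo k)
  nu_col : ∀ k, 0 ≤ v.gamma k • D.deltaF k + D.B *ᵥ (v.muUp k - v.muLo k)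
  gamma_nonneg : ∀ k, 0 ≤ v.gamma k
  gamma_le : ∀ k, v.gamma k ≤ 1 / ((1 - D.af) * (d.kf : ℝ))
  muUp_nonneg : ∀ k, 0 ≤ v.muUp k
  muLo_nonneg : ∀ k, 0 ≤ v.muLo k
  budget : ∑ k, D.p.norm (v.muUp k + v.muLo k) ≤ 1 / (1 - D.af) * D.ef
  gamma_sum : ∑ k, v.gamma k = 1
  beta_nonneg : 0 ≤ v.beta

/-- The feasible set of the single-level problem. -/
def slFeasible (D : DRIData d ℝ) : Set (SLVars d) :=
  {v | v.x ∈ D.X ∧ D.LeaderFeasible v ∧ D.PrimalFeasible v ∧ D.DualFeasible v ∧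
    D.dualObjective v = D.primalObjective v}

end DRIData

/-! Mixed-integer linear programs. -/

/-- A mixed-integer linear program: minimize `objᵀv` subject to `A v ≤ rhs` and `v i ∈ ℤ` for
`i ∈ int`. -/
structure MILP (V C K : Type) where
  obj : V → K
  A : Matrix C V K
  rhs : C → K
  int : Set V

/-- The number of bits of a rational number. -/
def ratSize (r : ℚ) : ℕ := r.num.natAbs.size + r.den.size + 1

namespace MILP

variable {V C : Type} [Fintype V] [Fintype C]

/-- The feasible set. -/
def feasible (P : MILP V C ℝ) : Set (V → ℝ) :=
  {v | P.A *ᵥ v ≤ P.rhs ∧ ∀ i ∈ P.int, ∃ z : ℤ, v i = z}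

/-- The objective function. -/
def objective (P : MILP V C ℝ) (v : V → ℝ) : ℝ := P.obj ⬝ᵥ v

/-- A rational program, read as a real one. -/
def toReal (P : MILP V C ℚ) : MILP V C ℝ where
  obj := fun i => (P.obj i : ℝ)
  A := fun r i => (P.A r i : ℝ)
  rhs := fun r => (P.rhs r : ℝ)
  int := P.int

/-- The encoding length of a rational program. -/
def size (P : MILP V C ℚ) : ℕ :=
  Fintype.card V + Fintype.card C + ∑ i, ratSize (P.obj i) + ∑ r, ∑ i, ratSize (P.A r i) +
    ∑ r, ratSize (P.rhs r)

end MILP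

/-- The encoding length of a rational instance. -/
def DRIData.size {d : Dims} (D : DRIData d ℚ) : ℕ :=
  d.total + (∑ i, ∑ j, ratSize (D.H i j)) + (∑ i, ratSize (D.h i)) +
    (∑ i, ∑ j, ratSize (D.F i j)) + (∑ i, ∑ j, ratSize (D.L i j)) + (∑ i, ratSize (D.f i)) +
    (∑ i, ∑ j, ratSize (D.B i j)) + (∑ i, ratSize (D.b i)) +
    (∑ k, ∑ i, ratSize (D.cl k i)) + (∑ k, ∑ i, ratSize (D.cf k i)) +
    ratSize D.al + ratSize D.af + ratSize D.el + ratSize D.ef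

/-- The variables of the linearized problem: those of the single-level problem, the variables
`uL`, `uF`, `tau` that express the `ℓ₁` and `ℓ_∞` norms by linear inequalities, and `w r j`, which
stands for the product of `beta r` and `x j`. -/
inductive MVar (d : Dims) where
  | x (j : Fin d.m)
  | y (i : Fin d.n)
  | nuL (k : Fin d.kl) (r : Fin d.dS)
  | sL (k : Fin d.kl)
  | lamL
  | tL
  | uL (k : Fin d.kl) (i : Fin d.n)
  | nuF (k : Fin d.kf) (r : Fin d.dS)
  | sF (k : Fin d.kf)
  | lamF
  | tF
  | uF (k : Fin d.kf) (i : Fin d.n)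
  | muUp (k : Fin d.kf) (i : Fin d.n)
  | muLo (k : Fin d.kf) (i : Fin d.n)
  | tau (k : Fin d.kf)
  | beta (r : Fin d.dY)
  | gamma (k : Fin d.kf)
  | w (r : Fin d.dY) (j : Fin d.m)
  deriving DecidableEq, Fintype

/-- The constraints of the linearized problem. -/
inductive MCon (d : Dims) where
  | nonneg (v : MVar d)
  | xUpper (j : Fin d.m)
  | xSystem (r : Fin d.dX)
  | lossL (k : Fin d.kl)
  | absPosL (k : Fin d.kl) (i : Fin d.n)
  | absNegL (k : Fin d.kl) (i : Fin d.n)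
  | normL (k : Fin d.kl) (i : Fin d.n)
  | ySystem (r : Fin d.dY)
  | lossF (k : Fin d.kf)
  | absPosF (k : Fin d.kf) (i : Fin d.n)
  | absNegF (k : Fin d.kf) (i : Fin d.n)
  | normF (k : Fin d.kf) (i : Fin d.n)
  | yCol (i : Fin d.n)
  | nuCol (k : Fin d.kf) (r : Fin d.dS)
  | gammaUpper (k : Fin d.kf)
  | normMu (k : Fin d.kf) (i : Fin d.n)
  | budget
  | gammaSumLe
  | gammaSumGe
  | dualityLe
  | dualityGe
  | prodBeta (r : Fin d.dY) (j : Fin d.m)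
  | prodX (r : Fin d.dY) (j : Fin d.m)
  | prodLower (r : Fin d.dY) (j : Fin d.m)
  deriving Fintype

namespace DRIData

variable {d : Dims} {K : Type} [Field K]

/-- The linear form `v ↦ v i`. -/
def coord (i : MVar d) : MVar d → K := Pi.single i 1

/-- The linear form `dualObjective - primalObjective`, with `w r j` in place of
`beta r * x j`. -/
def gapRow (D : DRIData d K) : MVar d → K :=
  ((∑ r, D.f r • coord (.beta r)) - ∑ r, ∑ j, D.L r j • coord (.w r j)) -
    (coord .tF - (1 / (1 - D.af)) • (D.ef • coord .lamF + (1 / (d.kf : K)) • ∑ k, coord (.sF k)))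

/-- The left-hand sides of the constraints, with all variables moved there. All the variables
except `tL` and `tF` are non-negative. -/
def milpRow (D : DRIData d K) (M : K) : MCon d → MVar d → K
  | .nonneg v =>
      match v with
      | .tL => 0
      | .tF => 0
      | v => -coord v
  | .xUpper j => coord (.x j)
  | .xSystem r => ∑ j, D.H r j • coord (.x j)
  | .lossL k =>
      (∑ i, D.cl k i • coord (.y i)) - coord .tL + (∑ r, D.deltaL k r • coord (.nuL k r)) -
        coord (.sL k)
  | .absPosL k i => ((∑ r, D.B r i • coord (.nuL k r)) - coord (.y i)) - coord (.uL k i)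
  | .absNegL k i => -((∑ r, D.B r i • coord (.nuL k r)) - coord (.y i)) - coord (.uL k i)
  | .normL k i =>
      (match D.p with
      | .one => coord (.uL k i)
      | .infty => ∑ i', coord (.uL k i')) - coord .lamL
  | .ySystem r => (∑ i, D.F r i • coord (.y i)) + ∑ j, D.L r j • coord (.x j)
  | .lossF k =>
      -(∑ i, D.cf k i • coord (.y i)) + coord .tF + (∑ r, D.deltaF k r • coord (.nuF k r)) -
        coord (.sF k)
  | .absPosF k i => ((∑ r, D.B r i • coord (.nuF k r)) + coord (.y i)) - coord (.uF k i)
  | .absNegF k i => -((∑ r, D.B r i • coord (.nuF k r)) + coord (.y i)) - coord (.uF k i)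
  | .normF k i =>
      (match D.p with
      | .one => coord (.uF k i)
      | .infty => ∑ i', coord (.uF k i')) - coord .lamF
  | .yCol i =>
      -((∑ r, D.F r i • coord (.beta r)) - (∑ k, D.cf k i • coord (.gamma k)) +
        ∑ k, (coord (.muUp k i) - coord (.muLo k i)))
  | .nuCol k r =>
      -(D.deltaF k r • coord (.gamma k) +
        ∑ i, D.B r i • (coord (.muUp k i) - coord (.muLo k i)))
  | .gammaUpper k => coord (.gamma k)
  | .normMu k i =>
      (match D.p with
      | .one => ∑ i', (coord (.muUp k i') + coord (.muLo k i'))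
      | .infty => coord (.muUp k i) + coord (.muLo k i)) - coord (.tau k)
  | .budget => ∑ k, coord (.tau k)
  | .gammaSumLe => ∑ k, coord (.gamma k)
  | .gammaSumGe => -∑ k, coord (.gamma k)
  | .dualityLe => D.gapRow
  | .dualityGe => -D.gapRow
  | .prodBeta r j => coord (.w r j) - coord (.beta r)
  | .prodX r j => coord (.w r j) - M • coord (.x j)
  | .prodLower r j => coord (.beta r) - coord (.w r j) + M • coord (.x j)

/-- The right-hand sides of the constraints. -/
def milpRhs (D : DRIData d K) (M : K) : MCon d → K
  | .xUpper _ => 1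
  | .xSystem r => D.h r
  | .ySystem r => D.f r
  | .gammaUpper _ => 1 / ((1 - D.af) * (d.kf : K))
  | .budget => 1 / (1 - D.af) * D.ef
  | .gammaSumLe => 1
  | .gammaSumGe => -1
  | .prodLower _ _ => M
  | _ => 0

/-- The mixed-integer linear program obtained from the single-level problem by linear
descriptions of the norms and by the Big-`M` linearization of the products `beta r * x j`. -/
def milp (D : DRIData d K) (M : K) : MILP (MVar d) (MCon d) K where
  obj := coord .tL +
    (1 / (1 - D.al)) • (D.el • coord .lamL + (1 / (d.kl : K)) • ∑ k, coord (.sL k))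
  A := D.milpRow M
  rhs := D.milpRhs M
  int := Set.range MVar.x

end DRIData

/-- The part `(x, y)` of a vector of variables of the linearized problem. -/
def MVar.pair {d : Dims} (v : MVar d → ℝ) : (Fin d.m → ℝ) × (Fin d.n → ℝ) :=
  (fun j => v (.x j), fun i => v (.y i))

/-- The problem of minimizing `Obj` over `Feas` is a reformulation of the problem of minimizing
`obj` over `feas`, with decision `proj z` for a solution `z`: the feasible decisions are the
same, the objective of each feasible decision is the minimum of `Obj` over all the feasible `z`
that give this decision, and both problems have a minimum, with the same value. -/
structure IsReformulation {E Z : Type} (feas : Set E) (obj : E → ℝ) (Feas : Set Z) (Obj : Z → ℝ)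
    (proj : Z → E) : Prop where
  feasible_eq : proj '' Feas = feas
  fibre_min : ∀ e ∈ feas, IsLeast (Obj '' {z | z ∈ Feas ∧ proj z = e}) (obj e)
  value_eq : ∃ v, IsLeast (obj '' feas) v ∧ IsLeast (Obj '' Feas) v

/-! The core fact is that the worst-case CVaR over a Wasserstein ball around an empirical
distribution is the value of a finite linear program. One inequality is direct: a feasible `(ν, s,
λ, t)` bounds the tail at each point `c'` of the support by `s j + λ ‖c j - c'‖`, and integrating
this against an arbitrary coupling bounds the tail functional of every distribution in the ball
(`CVaRPrimal.rightTailFun_le`). Conversely, a dual solution `(γ, μ)` is a recipe for a distribution: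
from the sample `c j`, move the mass `(1 - α) γ j` to `c j - μ j / γ j` and leave the rest in place
(`CVaRDual.exists_measure`). Strong duality of linear programming closes the gap, so the worst case
is attained and no minimax theorem for measures is needed. The reflection `(y, t) ↦ (-y, -t)`
transfers everything from the right tail to the left.

For fixed `x`, maximizing over `y` merges with the maximization inside the program of the left tail.
The follower thus solves one linear program, and `y` is optimal exactly if it extends to a
primal-dual pair with equal objectives. An optimal pair exists because `X` is finite, the follower's
solution sets are compact, and the leader's objective is lower semicontinuous, being a supremum of
linear functions.

For binary `x`, the inequalities on `w` force `w r j = beta r * x j` whatever `M` is, so `M` can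
only cut off solutions. It cuts off nothing essential once, for each `x`, it bounds `beta` in one
optimal dual solution: that dual solution can be combined with every optimal response `y`
(`Standing.exists_extension`). Finiteness of `X` then yields a real `M₀`.

For rational data, the follower's dual polyhedron does not depend on `x`; only its objective does.
Basic optimal solutions are therefore bounded by a power of two with polynomial exponent, uniformly
in `x` (`exists_small_minimizer`), and this power is a constant of polynomial encoding length. -/

/-! ### Linear programming duality -/

section LinearProgramming

/-- Among the minimizers of a linear functional over `{z ≥ 0 | T z = T z₀}` there is one whose
support carries no non-zero element of the kernel of `T`. -/
theorem exists_basic_minimizer {ι W : Type*} [Fintype ι] [AddCommGroup W] [Module ℝ W]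
    (T : (ι → ℝ) →ₗ[ℝ] W) (l : (ι → ℝ) →ₗ[ℝ] ℝ) (z₀ : ι → ℝ) (h₀ : 0 ≤ z₀)
    (hmin : ∀ z, 0 ≤ z → T z = T z₀ → l z₀ ≤ l z) :
    ∃ z, 0 ≤ z ∧ T z = T z₀ ∧ l z = l z₀ ∧
      ∀ u, T u = 0 → (∀ i, z i = 0 → u i = 0) → u = 0 := by
  classical
  let supp : (ι → ℝ) → Finset ι := fun z => Finset.univ.filter fun i => z i ≠ 0
  let P : Set (ι → ℝ) := {z | 0 ≤ z ∧ T z = T z₀ ∧ l z = l z₀}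
  -- A minimizer with the fewest non-zero entries. A kernel direction supported on it would allow a
  -- move to another minimizer with one more entry equal to zero.
  obtain ⟨z, ⟨hz, hTz, hlz⟩, hcard⟩ : ∃ z ∈ P, ∀ z' ∈ P, (supp z).card ≤ (supp z').card := by
    have hne : ((fun z => (supp z).card) '' P).Nonempty := ⟨_, z₀, ⟨h₀, rfl, rfl⟩, rfl⟩
    obtain ⟨z, hz, hz'⟩ := Nat.sInf_mem hne
    exact ⟨z, hz, fun z' h' => by rw [show (supp z).card = _ from hz']; exact Nat.sInf_le ⟨z', h', rfl⟩⟩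
  refine ⟨z, hz, hTz, hlz, ?_⟩
  by_contra! hcon
  obtain ⟨u, hTu, hsu, hu⟩ := hcon
  -- a move along a kernel direction with a positive entry
  have key : ∀ u : ι → ℝ, T u = 0 → (∀ i, z i = 0 → u i = 0) → (∃ i, 0 < u i) →
      ∃ θ : ℝ, 0 < θ ∧ 0 ≤ z - θ • u ∧ ∃ i, z i ≠ 0 ∧ (z - θ • u) i = 0 := by
    intro u _ hsu ⟨i₀, hi₀⟩
    -- The ratio test: the smallest quotient is the longest feasible step, and the entry that
    -- attains it vanishes.
    obtain ⟨i, hi, hmin'⟩ := Finset.exists_min_image (Finset.univ.filter fun i => 0 < u i)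
      (fun i => z i / u i) ⟨i₀, by simpa using hi₀⟩
    have hui : 0 < u i := by simpa using hi
    have hzi : z i ≠ 0 := fun h => hui.ne' (hsu i h)
    have hzi' : 0 < z i := lt_of_le_of_ne (hz i) (Ne.symm hzi)
    refine ⟨z i / u i, by positivity, fun j => ?_, i, hzi, ?_⟩
    · simp only [Pi.zero_apply, Pi.sub_apply, Pi.smul_apply, smul_eq_mul, sub_nonneg]
      rcases le_or_gt (u j) 0 with h | h
      · exact (mul_nonpos_of_nonneg_of_nonpos (by positivity) h).trans (hz j)
      · rw [← le_div_iff₀ h]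
        exact hmin' j (by simpa using h)
    · simp [hui.ne']
  -- Minimality excludes a positive slope along `u`. Applied to `u` and `-u`, this makes the
  -- objective constant along kernel directions.
  have hl : ∀ u : ι → ℝ, T u = 0 → (∀ i, z i = 0 → u i = 0) → l u ≤ 0 := by
    intro u hTu hsu
    by_cases hpos : ∃ i, 0 < u i
    · obtain ⟨θ, hθ, hnn, -⟩ := key u hTu hsu hpos
      have := hmin _ hnn (by simp [hTu, hTz])
      simp only [map_sub, map_smul, smul_eq_mul, hlz] at this
      nlinarith
    · push Not at hpos
      have := hmin (z - u) (fun i => by have := hz i; have := hpos i; simp at *; linarith)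
        (by simp [hTu, hTz])
      simp only [map_sub, hlz] at this
      linarith
  have main : ∀ u : ι → ℝ, T u = 0 → (∀ i, z i = 0 → u i = 0) → ¬ ∃ i, 0 < u i := by
    intro u hTu hsu hpos
    obtain ⟨θ, hθ, hnn, i, hi, hi'⟩ := key u hTu hsu hpos
    have h1 := hl u hTu hsu
    have h2 := hl (-u) (by simp [hTu]) (fun i h => by simp [hsu i h])
    have hlu : l u = 0 := by simp only [map_neg] at h2; linarith
    have hle := hcard (z - θ • u) ⟨hnn, by simp [hTu, hTz], by simp [hlu, hlz]⟩
    refine absurd hle (not_le.2 (Finset.card_lt_card ?_))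
    refine Finset.ssubset_iff_subset_ne.2 ⟨fun j hj => ?_, fun h => ?_⟩
    · simp only [supp, Finset.mem_filter, Finset.mem_univ, true_and] at hj ⊢
      intro h
      exact hj (by simp [h, hsu j h])
    · have : i ∈ supp (z - θ • u) := by rw [h]; simpa [supp] using hi
      simp only [supp, Finset.mem_filter] at this
      exact this.2 hi'
  refine hu (funext fun i => ?_)
  rcases lt_trichotomy (u i) 0 with h | h | h
  · exact (main (-u) (by simp [hTu]) (fun i h => by simp [hsu i h]) ⟨i, by simpa using h⟩).elim
  · exact h
  · exact (main u hTu hsu ⟨i, h⟩).elim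

/-- A finitely generated cone in a finite-dimensional space is closed. -/
theorem isClosed_image_nonneg {ι W : Type*} [Fintype ι] [NormedAddCommGroup W]
    [NormedSpace ℝ W] (T : (ι → ℝ) →ₗ[ℝ] W) :
    IsClosed (T '' {z | 0 ≤ z}) := by
  classical
  let V : Finset ι → Submodule ℝ (ι → ℝ) := fun J =>
    ⨅ i ∈ (J : Set ι)ᶜ, LinearMap.ker (LinearMap.proj i : (ι → ℝ) →ₗ[ℝ] ℝ)
  have hV : ∀ J z, z ∈ V J ↔ ∀ i, i ∉ J → z i = 0 := by
    intro J z; simp [V, Submodule.mem_iInf]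
  -- Carathéodory: the cone is the union of the images of the finitely many coordinate faces on
  -- which `T` is injective, and an injective linear map from a finite-dimensional space is a closed
  -- embedding.
  let good : Set (Finset ι) := {J | ∀ u ∈ V J, T u = 0 → u = 0}
  have heq : T '' {z | 0 ≤ z} = ⋃ J ∈ good, (T.comp (V J).subtype) '' {z | 0 ≤ (z : ι → ℝ)} := by
    ext w
    simp only [Set.mem_image, Set.mem_ofPred_eq, Set.mem_iUnion, exists_prop]
    constructor
    · rintro ⟨z₀, h₀, rfl⟩
      obtain ⟨z, hz, hTz, -, hb⟩ := exists_basic_minimizer T 0 z₀ h₀ (fun _ _ _ => le_rfl)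
      refine ⟨Finset.univ.filter fun i => z i ≠ 0, fun u hu hTu => hb u hTu fun i hi => ?_,
        ⟨z, ?_⟩, hz, hTz⟩
      · rw [hV] at hu
        exact hu i (by simpa using hi)
      · rw [hV]; intro i hi; simpa using hi
    · rintro ⟨J, -, z, hz, rfl⟩
      exact ⟨z, hz, rfl⟩
  rw [heq]
  refine (Set.toFinite good).isClosed_biUnion fun J hJ => ?_
  have hinj : LinearMap.ker (T.comp (V J).subtype) = ⊥ := by
    rw [LinearMap.ker_eq_bot']
    intro u hu
    exact Subtype.ext (hJ u u.2 hu)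
  refine ((T.comp (V J).subtype).isClosedEmbedding_of_injective hinj).isClosedMap _ ?_
  exact isClosed_le continuous_const continuous_subtype_val

/-- Farkas' lemma for a finitely generated cone. -/
theorem exists_nonneg_or_separated {ι W : Type*} [Fintype ι] [NormedAddCommGroup W]
    [NormedSpace ℝ W] (T : (ι → ℝ) →ₗ[ℝ] W) (w : W) :
    (∃ z, 0 ≤ z ∧ T z = w) ∨ ∃ f : W →L[ℝ] ℝ, (∀ z, 0 ≤ z → f (T z) ≤ 0) ∧ 0 < f w := by
  by_cases hw : w ∈ T '' {z | 0 ≤ z}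
  · obtain ⟨z, hz, rfl⟩ := hw
    exact Or.inl ⟨z, hz, rfl⟩
  · right
    have hconv : Convex ℝ (T '' {z | 0 ≤ z}) := (convex_Ici (0 : ι → ℝ)).linear_image T
    obtain ⟨f, u, hu, hfw⟩ := geometric_hahn_banach_closed_point hconv (isClosed_image_nonneg T) hw
    have hu0 : 0 < u := by simpa using hu 0 ⟨0, le_refl (0 : ι → ℝ), map_zero T⟩
    refine ⟨f, fun z hz => ?_, hu0.trans hfw⟩
    by_contra! hpos
    have hs : 0 ≤ u / f (T z) := by positivity
    have := hu (T ((u / f (T z)) • z)) ⟨_, smul_nonneg hs hz, rfl⟩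
    simp [hpos.ne'] at this

/-- The affine Farkas lemma: a linear inequality that holds on a non-empty polyhedron is a
non-negative combination of the defining inequalities. -/
theorem exists_multipliers_of_le {ι V : Type*} [Fintype ι] [AddCommGroup V] [Module ℝ V]
    [FiniteDimensional ℝ V] (φ : ι → V →ₗ[ℝ] ℝ) (b : ι → ℝ) (c : V →ₗ[ℝ] ℝ) (K : ℝ)
    (hne : ∃ v, ∀ i, φ i v ≤ b i) (hK : ∀ v, (∀ i, φ i v ≤ b i) → c v ≤ K) :
    ∃ z : ι → ℝ, 0 ≤ z ∧ (∀ v, ∑ i, z i * φ i v = c v) ∧ ∑ i, z i * b i ≤ K := by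
  classical
  let B := Module.finBasis ℝ V
  -- The extra generator `none` is a slack: it turns the equation for the constant term into the
  -- inequality with `K`.
  let a : Option ι → (Fin (Module.finrank ℝ V) → ℝ) × ℝ := fun o =>
    match o with
    | none => (0, 1)
    | some i => (fun j => φ i (B j), b i)
  let T : (Option ι → ℝ) →ₗ[ℝ] (Fin (Module.finrank ℝ V) → ℝ) × ℝ :=
    Fintype.linearCombination ℝ a
  have hT : ∀ z, T z = (fun j => ∑ i, z (some i) * φ i (B j),
      z none + ∑ i, z (some i) * b i) := by
    intro z
    simp only [T, Fintype.linearCombination_apply, Fintype.sum_option, a]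
    ext <;> simp [Prod.fst_sum, Prod.snd_sum]
  rcases exists_nonneg_or_separated T (fun j => c (B j), K) with ⟨z, hz, hTz⟩ | ⟨f, hf, hfw⟩
  · rw [hT, Prod.mk.injEq] at hTz
    refine ⟨fun i => z (some i), fun i => hz _, fun v => ?_, ?_⟩
    · have : (∑ i, z (some i) • φ i) = c := B.ext fun j => by
        simpa using congrFun hTz.1 j
      simpa using congrArg (fun g => g v) this
    · have := hz none
      simp only [Pi.zero_apply] at this
      linarith [hTz.2]
  · exfalso
    -- The separating functional is a pair `(v, τ)` with `φ i v + b i * τ ≤ 0`, `τ ≤ 0` and `c v + K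
    -- * τ > 0`. If `τ < 0`, the point `v / (-τ)` is feasible and violates the bound `K`; if `τ =
    -- 0`, then `v` is a recession direction along which `c` grows without bound.
    let v : V := ∑ j, f (Pi.single j 1, 0) • B j
    let τ : ℝ := f (0, 1)
    have hfe : ∀ w : Fin (Module.finrank ℝ V) → ℝ, ∀ r : ℝ,
        f (w, r) = ∑ j, w j * f (Pi.single j 1, 0) + r * τ := by
      intro w r
      have h1 : (w, r) = (∑ j, w j • ((Pi.single j 1, 0) : (Fin (Module.finrank ℝ V) → ℝ) × ℝ))
          + r • ((0, 1) : (Fin (Module.finrank ℝ V) → ℝ) × ℝ) := by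
        ext j <;> simp [Prod.fst_sum, Prod.snd_sum, Finset.sum_apply, Pi.single_apply]
      rw [h1, map_add, map_sum, map_smul]
      simp only [map_smul, smul_eq_mul, τ]
    have hgen : ∀ g : V →ₗ[ℝ] ℝ, ∀ r, f (fun j => g (B j), r) = g v + r * τ := by
      intro g r
      rw [hfe]
      simp [v, mul_comm]
    have hφ : ∀ i, φ i v + b i * τ ≤ 0 := by
      intro i
      have := hf (Pi.single (some i) 1) (Pi.single_nonneg.2 zero_le_one)
      rw [← hgen]
      refine le_of_eq_of_le (congrArg f ?_) this
      rw [hT]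
      ext <;> simp [Pi.single_apply]
    have hτ : τ ≤ 0 := by
      have := hf (Pi.single none 1) (Pi.single_nonneg.2 zero_le_one)
      refine le_of_eq_of_le (congrArg f ?_) this
      rw [hT]
      ext <;> simp
    have hc : 0 < c v + K * τ := by rw [← hgen]; exact hfw
    rcases hτ.lt_or_eq with hτ | hτ
    · have hinv : 0 < (-τ)⁻¹ := by rw [inv_pos]; linarith
      have := hK ((-τ)⁻¹ • v) fun i => by
        rw [map_smul, smul_eq_mul, inv_mul_le_iff₀ (by linarith)]
        linarith [hφ i]
      rw [map_smul, smul_eq_mul, inv_mul_le_iff₀ (by linarith)] at this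
      linarith
    · rw [hτ] at hc
      simp only [hτ, mul_zero, add_zero] at hφ hc
      obtain ⟨v₀, hv₀⟩ := hne
      have h1 : ∀ s : ℝ, 0 ≤ s → c v₀ + s * c v ≤ K := fun s hs => by
        have := hK (v₀ + s • v) fun i => by
          rw [map_add, map_smul, smul_eq_mul]
          linarith [hv₀ i, mul_nonpos_of_nonneg_of_nonpos hs (hφ i)]
        simpa using this
      have h0 := h1 0 le_rfl
      have := h1 ((K - c v₀ + 1) / c v) (div_nonneg (by linarith) hc.le)
      rw [div_mul_cancel₀ _ hc.ne'] at this
      linarith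

/-- Strong duality of linear programming: a feasible program with a bounded objective has an
optimal solution, and its dual has an optimal solution with the same value. -/
theorem exists_primal_dual_optimal {ι V : Type*} [Fintype ι] [AddCommGroup V] [Module ℝ V]
    [FiniteDimensional ℝ V] (φ : ι → V →ₗ[ℝ] ℝ) (b : ι → ℝ) (c : V →ₗ[ℝ] ℝ) (K : ℝ)
    (hne : ∃ v, ∀ i, φ i v ≤ b i) (hK : ∀ v, (∀ i, φ i v ≤ b i) → c v ≤ K) :
    ∃ v, ∃ z : ι → ℝ, (∀ i, φ i v ≤ b i) ∧ 0 ≤ z ∧ (∀ v, ∑ i, z i * φ i v = c v) ∧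
      ∑ i, z i * b i = c v := by
  let Z : Set ℝ := c '' {v | ∀ i, φ i v ≤ b i}
  have hZne : Z.Nonempty := (show Set.Nonempty {v | ∀ i, φ i v ≤ b i} from hne).image c
  have hZbdd : BddAbove Z := ⟨K, by rintro _ ⟨v, hv, rfl⟩; exact hK v hv⟩
  obtain ⟨z, hz, hzc, hzb⟩ := exists_multipliers_of_le φ b c (sSup Z) hne
    fun v hv => le_csSup hZbdd ⟨v, hv, rfl⟩
  have weak : ∀ v, (∀ i, φ i v ≤ b i) → c v ≤ ∑ i, z i * b i := fun v hv => by
    rw [← hzc]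
    exact Finset.sum_le_sum fun i _ => mul_le_mul_of_nonneg_left (hv i) (hz i)
  have hzb' : ∑ i, z i * b i = sSup Z :=
    le_antisymm hzb (csSup_le hZne (by rintro _ ⟨v, hv, rfl⟩; exact weak v hv))
  by_cases hatt : ∃ v, (∀ i, φ i v ≤ b i) ∧ sSup Z ≤ c v
  · obtain ⟨v, hv, hvs⟩ := hatt
    exact ⟨v, z, hv, hz, hzc, by rw [hzb']; exact le_antisymm hvs (le_csSup hZbdd ⟨v, hv, rfl⟩)⟩
  · exfalso
    push Not at hatt
    obtain ⟨v₀, hv₀⟩ := hne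
    -- Homogenization. If the supremum is not attained, the system `φ i x ≤ b i * τ`, `sSup Z * τ ≤
    -- c x` implies `τ ≤ 0`. The multipliers of this implication give `y none * c v ≤ y none * sSup
    -- Z - 1` on the polyhedron: a bound below the supremum if `y none > 0`, and `0 ≤ -1` if `y none
    -- = 0`.
    let ψ : Option ι → (V × ℝ) →ₗ[ℝ] ℝ := fun o =>
      match o with
      | none => sSup Z • LinearMap.snd ℝ V ℝ - c.comp (LinearMap.fst ℝ V ℝ)
      | some i => (φ i).comp (LinearMap.fst ℝ V ℝ) - b i • LinearMap.snd ℝ V ℝ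
    obtain ⟨y, hy, hyc, -⟩ := exists_multipliers_of_le ψ 0 (LinearMap.snd ℝ V ℝ) 0
      ⟨0, fun i => by simp⟩ (by
        rintro ⟨x, τ⟩ h
        simp only [LinearMap.snd_apply]
        by_contra! hτ
        have hx : ∀ i, φ i (τ⁻¹ • x) ≤ b i := fun i => by
          have := h (some i)
          simp only [ψ, LinearMap.sub_apply, LinearMap.comp_apply, LinearMap.fst_apply,
            LinearMap.smul_apply, LinearMap.snd_apply, smul_eq_mul, Pi.zero_apply] at this
          rw [map_smul, smul_eq_mul, inv_mul_le_iff₀ hτ]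
          linarith
        have h1 := hatt _ hx
        have h2 := h none
        simp only [ψ, LinearMap.sub_apply, LinearMap.comp_apply, LinearMap.fst_apply,
          LinearMap.smul_apply, LinearMap.snd_apply, smul_eq_mul, Pi.zero_apply] at h2
        rw [map_smul, smul_eq_mul, inv_mul_lt_iff₀ hτ] at h1
        linarith)
    have hfst : ∀ v, ∑ i, y (some i) * φ i v = y none * c v := fun v => by
      have := hyc (v, 0)
      simp [Fintype.sum_option, ψ] at this
      linarith
    have hsnd : ∑ i, y (some i) * b i = y none * sSup Z - 1 := by
      have := hyc (0, 1)
      simp [Fintype.sum_option, ψ] at this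
      linarith
    have hall : ∀ v, (∀ i, φ i v ≤ b i) → y none * c v ≤ y none * sSup Z - 1 := fun v hv => by
      rw [← hfst, ← hsnd]
      exact Finset.sum_le_sum fun i _ => mul_le_mul_of_nonneg_left (hv i) (hy _)
    rcases (hy none).lt_or_eq with h | h
    · simp only [Pi.zero_apply] at h
      have : sSup Z ≤ (y none * sSup Z - 1) / y none := csSup_le hZne (by
        rintro _ ⟨v, hv, rfl⟩
        rw [le_div_iff₀ h]
        linarith [hall v hv])
      rw [le_div_iff₀ h] at this
      linarith
    · have := hall v₀ hv₀
      simp only [Pi.zero_apply] at h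
      rw [← h] at this
      linarith

end LinearProgramming

/-! ### The norms `ℓ₁` and `ℓ_∞` -/

namespace Ell

variable {n : ℕ}

theorem norm_nonneg (p : Ell) (v : Fin n → ℝ) : 0 ≤ p.norm v := by
  cases p
  · exact Finset.sum_nonneg fun i _ => abs_nonneg _
  · exact _root_.norm_nonneg v

theorem norm_zero (p : Ell) : p.norm (0 : Fin n → ℝ) = 0 := by
  cases p <;> simp [norm]

theorem norm_add_le (p : Ell) (u v : Fin n → ℝ) : p.norm (u + v) ≤ p.norm u + p.norm v := by
  cases p
  · simp only [norm, ← Finset.sum_add_distrib]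
    exact Finset.sum_le_sum fun i _ => abs_add_le _ _
  · exact _root_.norm_add_le u v

theorem norm_smul (p : Ell) (r : ℝ) (v : Fin n → ℝ) : p.norm (r • v) = |r| * p.norm v := by
  cases p
  · simp [norm, abs_mul, Finset.mul_sum]
  · simpa [norm] using _root_.norm_smul r v

theorem norm_sum_le (p : Ell) {ι : Type*} (s : Finset ι) (v : ι → Fin n → ℝ) :
    p.norm (∑ i ∈ s, v i) ≤ ∑ i ∈ s, p.norm (v i) := by
  classical
  induction s using Finset.induction_on with
  | empty => simp [norm_zero]
  | insert a s ha ih =>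
    rw [Finset.sum_insert ha, Finset.sum_insert ha]
    exact (p.norm_add_le _ _).trans (by gcongr)

theorem continuous_norm (p : Ell) : Continuous (p.norm : (Fin n → ℝ) → ℝ) := by
  cases p
  · unfold norm; fun_prop
  · exact _root_.continuous_norm

theorem norm_one_eq (v : Fin n → ℝ) : one.norm v = ∑ i, |v i| := rfl

theorem norm_infty_le_iff {v : Fin n → ℝ} {r : ℝ} (hr : 0 ≤ r) :
    infty.norm v ≤ r ↔ ∀ i, |v i| ≤ r := by
  simp [norm, pi_norm_le_iff_of_nonneg hr]

theorem dotProduct_le_norm_mul_norm (p : Ell) (u v : Fin n → ℝ) :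
    u ⬝ᵥ v ≤ p.norm u * p.conj.norm v := by
  cases p
  · simp only [dotProduct, norm, conj, Finset.sum_mul]
    refine Finset.sum_le_sum fun i _ => (le_abs_self _).trans ?_
    rw [abs_mul]
    exact mul_le_mul_of_nonneg_left (norm_le_pi_norm v i) (abs_nonneg _)
  · simp only [dotProduct, norm, conj, Finset.mul_sum]
    refine Finset.sum_le_sum fun i _ => (le_abs_self _).trans ?_
    rw [abs_mul]
    exact mul_le_mul_of_nonneg_right (norm_le_pi_norm u i) (abs_nonneg _)

/-- The conjugate norm is the support function of finitely many points of the unit ball. -/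
theorem exists_finset_conj_norm_le (p : Ell) (n : ℕ) :
    ∃ E : Finset (Fin n → ℝ), (∀ e ∈ E, p.norm e ≤ 1) ∧
      ∀ (v : Fin n → ℝ) (r : ℝ), 0 ≤ r → (∀ e ∈ E, e ⬝ᵥ v ≤ r) → p.conj.norm v ≤ r := by
  classical
  cases p
  · refine ⟨(Finset.univ.image fun i => Pi.single i 1) ∪
      Finset.univ.image fun i => Pi.single i (-1), ?_, ?_⟩
    · intro e he
      simp only [Finset.mem_union, Finset.mem_image, Finset.mem_univ, true_and] at he
      rcases he with ⟨i, rfl⟩ | ⟨i, rfl⟩ <;> simp [norm, Pi.single_apply, apply_ite]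
    · intro v r hr h
      refine (norm_infty_le_iff hr).2 fun i => abs_le.2 ⟨?_, ?_⟩
      · have := h (Pi.single i (-1)) (by simp)
        simp at this
        linarith
      · have := h (Pi.single i 1) (by simp)
        simpa using this
  -- All sign vectors. Their number is exponential in `n`, which is harmless since they serve only
  -- the duality proof and not the mixed-integer program.
  · refine ⟨Finset.univ.image fun (σ : Fin n → Bool) i => if σ i then 1 else -1, ?_, ?_⟩
    · intro e he
      obtain ⟨σ, -, rfl⟩ := Finset.mem_image.1 he
      refine (norm_infty_le_iff zero_le_one).2 fun i => ?_
      split_ifs <;> simp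
    · intro v r _ h
      refine le_of_eq_of_le ?_ (h (fun i => if decide (0 ≤ v i) then 1 else -1)
        (Finset.mem_image.2 ⟨fun i => decide (0 ≤ v i), Finset.mem_univ _, rfl⟩))
      refine Finset.sum_congr rfl fun i _ => ?_
      rcases le_or_gt 0 (v i) with h | h
      · simp [h, abs_of_nonneg h]
      · simp [not_le.2 h, abs_of_neg h]

end Ell

/-! ### The linear program of the worst-case left-tail conditional value at risk -/

section WorstCaseProgram

variable {n N k : ℕ}

/-- The constraints of the linear program whose value is the worst-case left-tail CVaR
of `y`. -/
structure CVaRPrimal (p : Ell) (B : Matrix (Fin N) (Fin n) ℝ) (Δ : Fin k → Fin N → ℝ)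
    (c : Fin k → Fin n → ℝ) (y : Fin n → ℝ) (ν : Fin k → Fin N → ℝ) (s : Fin k → ℝ)
    (l t : ℝ) : Prop where
  loss : ∀ j, -(c j ⬝ᵥ y) + t + Δ j ⬝ᵥ ν j ≤ s j
  norm : ∀ j, p.conj.norm (Bᵀ *ᵥ ν j + y) ≤ l
  nu_nonneg : ∀ j, 0 ≤ ν j
  s_nonneg : ∀ j, 0 ≤ s j
  lam_nonneg : 0 ≤ l

/-- The objective of this program, with `a = 1 / (1 - α)`. -/
noncomputable def cvarObjective (a ε : ℝ) (s : Fin k → ℝ) (l t : ℝ) : ℝ :=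
  t - a * (ε * l + 1 / (k : ℝ) * ∑ j, s j)

/-- The constraints of the dual program. -/
structure CVaRDual (p : Ell) (B : Matrix (Fin N) (Fin n) ℝ) (Δ : Fin k → Fin N → ℝ)
    (a ε : ℝ) (γ : Fin k → ℝ) (μ : Fin k → Fin n → ℝ) : Prop where
  gamma_nonneg : ∀ j, 0 ≤ γ j
  gamma_le : ∀ j, γ j ≤ a * (1 / (k : ℝ))
  gamma_sum : ∑ j, γ j = 1
  nu_col : ∀ j, 0 ≤ γ j • Δ j + B *ᵥ μ j
  budget : ∑ j, p.norm (μ j) ≤ a * ε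

/-- Weak duality: `loss` is weighted by `γ j`, `s_nonneg` is paired with the slack of `gamma_le`,
`nu_col` is paired with `ν j`, and Hölder's inequality for `μ j` against `Bᵀ ν j + y` brings in the
norm constraint. Summation over `j` uses `gamma_sum` and `budget`. -/
theorem CVaRPrimal.objective_le {p : Ell} {B : Matrix (Fin N) (Fin n) ℝ} {Δ : Fin k → Fin N → ℝ}
    {c : Fin k → Fin n → ℝ} {y : Fin n → ℝ} {ν : Fin k → Fin N → ℝ} {s : Fin k → ℝ} {l t : ℝ}
    (h : CVaRPrimal p B Δ c y ν s l t) {a ε : ℝ} {γ : Fin k → ℝ} {μ : Fin k → Fin n → ℝ}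
    (h' : CVaRDual p B Δ a ε γ μ) :
    cvarObjective a ε s l t ≤ (∑ j, γ j • c j - ∑ j, μ j) ⬝ᵥ y := by
  have key : ∀ j, γ j * t ≤
      γ j * (c j ⬝ᵥ y) + p.norm (μ j) * l - μ j ⬝ᵥ y + a * (1 / (k : ℝ)) * s j := by
    intro j
    have h1 := mul_le_mul_of_nonneg_left (h.loss j) (h'.gamma_nonneg j)
    have h2 := mul_le_mul_of_nonneg_right (h'.gamma_le j) (h.s_nonneg j)
    have h3 : 0 ≤ (γ j • Δ j + B *ᵥ μ j) ⬝ᵥ ν j :=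
      dotProduct_nonneg_of_nonneg (h'.nu_col j) (h.nu_nonneg j)
    have h4 : (B *ᵥ μ j) ⬝ᵥ ν j = μ j ⬝ᵥ (Bᵀ *ᵥ ν j) := by
      rw [Matrix.mulVec_transpose, dotProduct_comm, Matrix.dotProduct_mulVec, dotProduct_comm]
    have h5 := p.dotProduct_le_norm_mul_norm (μ j) (Bᵀ *ᵥ ν j + y)
    have h6 := mul_le_mul_of_nonneg_left (h.norm j) (p.norm_nonneg (μ j))
    rw [add_dotProduct, smul_dotProduct, h4, smul_eq_mul] at h3
    rw [dotProduct_add] at h5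
    nlinarith
  have hsum := Finset.sum_le_sum fun j (_ : j ∈ Finset.univ) => key j
  simp only [Finset.sum_add_distrib, Finset.sum_sub_distrib, ← Finset.sum_mul, ← Finset.mul_sum,
    h'.gamma_sum] at hsum
  have hb := mul_le_mul_of_nonneg_right h'.budget h.lam_nonneg
  rw [sub_dotProduct, sum_dotProduct, sum_dotProduct]
  simp only [smul_dotProduct, smul_eq_mul, cvarObjective]
  linarith

/-- The space of the variables `(y, ν, s, λ, t)` of the linear program of the worst-case CVaR. -/
abbrev CVaRSpace (n N k : ℕ) : Type :=
  (Fin n → ℝ) × (Fin k → Fin N → ℝ) × (Fin k → ℝ) × ℝ × ℝ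

/-- Strong duality for the problem of maximizing the worst-case left-tail CVaR over a
polyhedron. -/
theorem exists_cvar_optimal {ι : Type} [Fintype ι] (p : Ell) (B : Matrix (Fin N) (Fin n) ℝ)
    (Δ : Fin k → Fin N → ℝ) (c : Fin k → Fin n → ℝ) (a ε : ℝ) (G : ι → Fin n → ℝ) (g : ι → ℝ)
    (hk : 0 < k) (hΔ : ∀ j, 0 ≤ Δ j) (ha : 1 ≤ a) (hε : 0 ≤ ε)
    (hne : ∃ y, ∀ i, G i ⬝ᵥ y ≤ g i) (K : ℝ)
    (hK : ∀ y, (∀ i, G i ⬝ᵥ y ≤ g i) → ∀ j, c j ⬝ᵥ y ≤ K) :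
    ∃ y ν s l t, (∀ i, G i ⬝ᵥ y ≤ g i) ∧ CVaRPrimal p B Δ c y ν s l t ∧
      ∃ (β : ι → ℝ) (γ : Fin k → ℝ) (μ : Fin k → Fin n → ℝ), 0 ≤ β ∧ CVaRDual p B Δ a ε γ μ ∧
        ∑ i, β i • G i = ∑ j, γ j • c j - ∑ j, μ j ∧
        ∑ i, β i * g i = cvarObjective a ε s l t := by
  classical
  obtain ⟨E, hE1, hE⟩ := p.exists_finset_conj_norm_le n
  -- The rows, in this order: the constraints on `y`, the losses, the norm constraints split into
  -- the linear forms given by `E`, and the signs of `ν`, `s` and `λ`.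
  let I := ι ⊕ Fin k ⊕ (Fin k × E) ⊕ (Fin k × Fin N) ⊕ Fin k ⊕ Unit
  let φ : I → CVaRSpace n N k →ₗ[ℝ] ℝ := fun i =>
    match i with
    | .inl i => IsLinearMap.mk' (fun v : CVaRSpace n N k => G i ⬝ᵥ v.1)
        ⟨fun u v => by simp [dotProduct_add], fun r v => by simp [dotProduct_smul]⟩
    | .inr (.inl j) => IsLinearMap.mk'
        (fun v : CVaRSpace n N k => -(c j ⬝ᵥ v.1) + v.2.2.2.2 + Δ j ⬝ᵥ v.2.1 j - v.2.2.1 j)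
        ⟨fun u v => by simp only [Prod.fst_add, Prod.snd_add, Pi.add_apply, dotProduct_add]; ring,
          fun r v => by
            simp only [Prod.smul_fst, Prod.smul_snd, Pi.smul_apply, dotProduct_smul,
              smul_eq_mul]; ring⟩
    | .inr (.inr (.inl je)) => IsLinearMap.mk'
        (fun v : CVaRSpace n N k => (B *ᵥ (je.2 : Fin n → ℝ)) ⬝ᵥ v.2.1 je.1 + (je.2 : Fin n → ℝ) ⬝ᵥ v.1
          - v.2.2.2.1)
        ⟨fun u v => by simp only [Prod.fst_add, Prod.snd_add, Pi.add_apply, dotProduct_add]; ring,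
          fun r v => by
            simp only [Prod.smul_fst, Prod.smul_snd, Pi.smul_apply, dotProduct_smul,
              smul_eq_mul]; ring⟩
    | .inr (.inr (.inr (.inl jr))) => IsLinearMap.mk' (fun v : CVaRSpace n N k => -v.2.1 jr.1 jr.2)
        ⟨fun u v => by simp only [Prod.fst_add, Prod.snd_add, Pi.add_apply]; ring,
          fun r v => by simp⟩
    | .inr (.inr (.inr (.inr (.inl j)))) => IsLinearMap.mk' (fun v : CVaRSpace n N k => -v.2.2.1 j)
        ⟨fun u v => by simp only [Prod.fst_add, Prod.snd_add, Pi.add_apply]; ring,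
          fun r v => by simp⟩
    | .inr (.inr (.inr (.inr (.inr _)))) => IsLinearMap.mk' (fun v : CVaRSpace n N k => -v.2.2.2.1)
        ⟨fun u v => by simp only [Prod.fst_add, Prod.snd_add]; ring, fun r v => by simp⟩
  let b : I → ℝ := fun i =>
    match i with
    | .inl i => g i
    | .inr _ => 0
  let obj : CVaRSpace n N k →ₗ[ℝ] ℝ := IsLinearMap.mk'
    (fun v : CVaRSpace n N k => cvarObjective a ε v.2.2.1 v.2.2.2.1 v.2.2.2.2)
    ⟨fun u v => by
      simp only [cvarObjective, Prod.fst_add, Prod.snd_add, Pi.add_apply,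
        Finset.sum_add_distrib]; ring,
     fun r v => by
      simp only [cvarObjective, Prod.smul_fst, Prod.smul_snd, Pi.smul_apply, smul_eq_mul,
        ← Finset.mul_sum]; ring⟩
  have hBt : ∀ (e : Fin n → ℝ) (w : Fin N → ℝ), (B *ᵥ e) ⬝ᵥ w = e ⬝ᵥ (Bᵀ *ᵥ w) := fun e w => by
    rw [Matrix.mulVec_transpose, dotProduct_comm, Matrix.dotProduct_mulVec, dotProduct_comm]
  have hfeas : ∀ v : CVaRSpace n N k, (∀ i, φ i v ≤ b i) ↔ (∀ i, G i ⬝ᵥ v.1 ≤ g i) ∧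
      CVaRPrimal p B Δ c v.1 v.2.1 v.2.2.1 v.2.2.2.1 v.2.2.2.2 := by
    intro v
    constructor
    · intro h
      have hl : 0 ≤ v.2.2.2.1 := by
        have := h (.inr (.inr (.inr (.inr (.inr ())))))
        simpa [φ, b] using this
      refine ⟨fun i => by have := h (.inl i); simpa [φ, b] using this,
        ⟨fun j => ?_, fun j => ?_, fun j r => ?_, fun j => ?_, hl⟩⟩
      · have := h (.inr (.inl j))
        simp only [φ, b, IsLinearMap.mk'_apply] at this
        linarith
      · refine hE _ _ hl fun e he => ?_
        have := h (.inr (.inr (.inl (j, ⟨e, he⟩))))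
        simp only [φ, b, IsLinearMap.mk'_apply, hBt] at this
        rw [dotProduct_add]
        linarith
      · have := h (.inr (.inr (.inr (.inl (j, r)))))
        simpa [φ, b] using this
      · have := h (.inr (.inr (.inr (.inr (.inl j)))))
        simpa [φ, b] using this
    · rintro ⟨hG, h⟩ (i | j | ⟨j, e⟩ | ⟨j, r⟩ | j | u) <;>
        simp only [φ, b, IsLinearMap.mk'_apply]
      · exact hG i
      · linarith [h.loss j]
      · have h1 := p.dotProduct_le_norm_mul_norm (e : Fin n → ℝ) (Bᵀ *ᵥ v.2.1 j + v.1)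
        have h2 := mul_le_mul (hE1 e e.2) (h.norm j) (p.conj.norm_nonneg _) zero_le_one
        rw [dotProduct_add] at h1
        rw [hBt]
        linarith
      · have := h.nu_nonneg j r
        simp only [Pi.zero_apply] at this
        linarith
      · linarith [h.s_nonneg j]
      · linarith [h.lam_nonneg]
  have hk' : (0 : ℝ) < k := by exact_mod_cast hk
  obtain ⟨v, z, hv, hz, hzc, hzb⟩ := exists_primal_dual_optimal φ b obj K (by
      obtain ⟨y, hy⟩ := hne
      refine ⟨(y, 0, fun j => |c j ⬝ᵥ y|, p.conj.norm y, 0), (hfeas _).2 ⟨hy, ?_⟩⟩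
      exact ⟨fun j => by simpa using neg_le_abs _, fun j => by simp, fun j => le_rfl,
        fun j => abs_nonneg _, p.conj.norm_nonneg _⟩) (by
      intro v hv
      obtain ⟨hG, h⟩ := (hfeas v).1 hv
      -- The objective is at most `K`: the losses give `t - K ≤ s j` for every `j`, hence `t - K` is
      -- at most the average of `s`, which enters the objective with a factor `a ≥ 1`.
      have h1 : (k : ℝ) * (v.2.2.2.2 - K) ≤ ∑ j, v.2.2.1 j := by
        have : ∑ _j : Fin k, (v.2.2.2.2 - K) ≤ ∑ j, v.2.2.1 j := Finset.sum_le_sum fun j _ => by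
          have := h.loss j
          have h2 := dotProduct_nonneg_of_nonneg (hΔ j) (h.nu_nonneg j)
          linarith [hK _ hG j]
        rwa [Finset.sum_const, Finset.card_univ, Fintype.card_fin, nsmul_eq_mul] at this
      have h2 : v.2.2.2.2 - K ≤ 1 / (k : ℝ) * ∑ j, v.2.2.1 j := by
        rw [one_div, ← div_eq_inv_mul, le_div_iff₀ hk']
        linarith
      have h3 : 0 ≤ 1 / (k : ℝ) * ∑ j, v.2.2.1 j :=
        mul_nonneg (by positivity) (Finset.sum_nonneg fun j _ => h.s_nonneg j)
      have h4 := mul_nonneg hε h.lam_nonneg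
      simp only [obj, IsLinearMap.mk'_apply, cvarObjective]
      nlinarith)
  obtain ⟨hG, hprim⟩ := (hfeas v).1 hv
  let γ : Fin k → ℝ := fun j => z (.inr (.inl j))
  let η : Fin k → E → ℝ := fun j e => z (.inr (.inr (.inl (j, e))))
  -- The multipliers of the norm rows combine points of the unit ball, so the norm of `μ j` is at
  -- most their sum. That sum is what the column of `λ` controls.
  let μ : Fin k → Fin n → ℝ := fun j => ∑ e, η j e • (e : Fin n → ℝ)
  have hexp : ∀ u : CVaRSpace n N k, ∑ i, z (.inl i) * G i ⬝ᵥ u.1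
      + ((∑ j, γ j * (-(c j ⬝ᵥ u.1) + u.2.2.2.2 + Δ j ⬝ᵥ u.2.1 j - u.2.2.1 j))
      + ((∑ j, ∑ e : E, η j e * ((B *ᵥ (e : Fin n → ℝ)) ⬝ᵥ u.2.1 j + (e : Fin n → ℝ) ⬝ᵥ u.1
          - u.2.2.2.1))
      + ((∑ j, ∑ r, z (.inr (.inr (.inr (.inl (j, r))))) * -u.2.1 j r)
      + ((∑ j, z (.inr (.inr (.inr (.inr (.inl j))))) * -u.2.2.1 j)
      + z (.inr (.inr (.inr (.inr (.inr ()))))) * -u.2.2.2.1))))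
      = cvarObjective a ε u.2.2.1 u.2.2.2.1 u.2.2.2.2 := by
    intro u
    have := hzc u
    simpa only [I, Fintype.sum_sum_type, Fintype.sum_prod_type, Finset.univ_unique,
      Finset.sum_singleton, φ, obj, IsLinearMap.mk'_apply] using this
  -- Each dual constraint is `hexp` at a unit vector of one group of variables: `s` for `gamma_le`,
  -- `t` for `gamma_sum`, `ν` for `nu_col`, `λ` for `budget`, `y` for the equation of the columns.
  refine ⟨v.1, v.2.1, v.2.2.1, v.2.2.2.1, v.2.2.2.2, hG, hprim, fun i => z (.inl i), γ, μ,
    fun i => hz _, ⟨fun j => hz _, fun j => ?_, ?_, fun j r => ?_, ?_⟩, ?_, ?_⟩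
  · have := hexp (0, 0, Pi.single j 1, 0, 0)
    simp [Pi.single_apply, cvarObjective] at this
    have h2 := hz (.inr (.inr (.inr (.inr (.inl j)))))
    simp only [Pi.zero_apply] at h2
    rw [one_div]
    linarith
  · have := hexp (0, 0, 0, 0, 1)
    simpa [cvarObjective] using this
  · have := hexp (0, Pi.single j (Pi.single r 1), 0, 0, 0)
    have h2 := hz (.inr (.inr (.inr (.inl (j, r)))))
    simp [cvarObjective, -Finset.univ_eq_attach] at this h2
    rw [Fintype.sum_eq_single j fun x hx => by simp [Pi.single_eq_of_ne hx],
      Fintype.sum_eq_single j fun x hx => by simp [Pi.single_eq_of_ne hx],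
      Fintype.sum_eq_single j fun x hx => by simp [Pi.single_eq_of_ne hx]] at this
    simp [-Finset.univ_eq_attach, Pi.single_apply] at this
    simp [μ, -Finset.univ_eq_attach, Finset.sum_apply, Matrix.mulVec_sum, Matrix.mulVec_smul]
    linarith
  · have := hexp (0, 0, 0, 1, 0)
    simp [cvarObjective, -Finset.univ_eq_attach] at this
    have h2 := hz (.inr (.inr (.inr (.inr (.inr ())))))
    simp only [Pi.zero_apply] at h2
    have h3 : ∑ j, p.norm (μ j) ≤ ∑ j, ∑ e : E, η j e := Finset.sum_le_sum fun j _ =>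
      (p.norm_sum_le _ _).trans (Finset.sum_le_sum fun e _ => by
        rw [p.norm_smul, abs_of_nonneg (hz _)]
        exact mul_le_of_le_one_right (hz _) (hE1 e e.2))
    linarith
  · funext i
    have := hexp (Pi.single i 1, 0, 0, 0, 0)
    simp [cvarObjective, -Finset.univ_eq_attach] at this
    simp [μ, -Finset.univ_eq_attach, Finset.sum_apply]
    linarith
  · have : ∑ i, z i * b i = ∑ i, z (.inl i) * g i := by
      simp [I, b]
    rw [← this, hzb]
    rfl

/-- Strong duality for the worst-case left-tail CVaR of a fixed decision. -/
theorem exists_cvar_optimal_of_fixed (p : Ell) (B : Matrix (Fin N) (Fin n) ℝ)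
    (Δ : Fin k → Fin N → ℝ) (c : Fin k → Fin n → ℝ) (a ε : ℝ)
    (hk : 0 < k) (hΔ : ∀ j, 0 ≤ Δ j) (ha : 1 ≤ a) (hε : 0 ≤ ε) (y : Fin n → ℝ) :
    ∃ ν s l t, CVaRPrimal p B Δ c y ν s l t ∧
      ∃ (γ : Fin k → ℝ) (μ : Fin k → Fin n → ℝ), CVaRDual p B Δ a ε γ μ ∧
        (∑ j, γ j • c j - ∑ j, μ j) ⬝ᵥ y = cvarObjective a ε s l t := by
  -- Two opposite inequalities per coordinate shrink the polyhedron of decisions to the single point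
  -- `y`.
  have hy : ∀ y' : Fin n → ℝ, (∀ i : Fin n ⊕ Fin n,
      Sum.elim (fun i => Pi.single i 1) (fun i => Pi.single i (-1)) i ⬝ᵥ y' ≤
        Sum.elim y (-y) i) → y' = y := by
    intro y' h
    funext i
    have h1 := h (.inl i)
    have h2 := h (.inr i)
    simp at h1 h2
    linarith
  obtain ⟨y', ν, s, l, t, hG, hp, β, γ, μ, -, hd, hcol, hval⟩ :=
    exists_cvar_optimal (ι := Fin n ⊕ Fin n) p B Δ c a ε
      (Sum.elim (fun i => Pi.single i 1) (fun i => Pi.single i (-1))) (Sum.elim y (-y))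
      hk hΔ ha hε ⟨y, by rintro (i | i) <;> simp⟩ (∑ j, |c j ⬝ᵥ y|) (by
        intro y' h j
        rw [hy y' h]
        exact (le_abs_self _).trans
          (Finset.single_le_sum (f := fun j => |c j ⬝ᵥ y|) (fun _ _ => abs_nonneg _)
            (Finset.mem_univ j)))
  obtain rfl := hy y' hG
  refine ⟨ν, s, l, t, hp, γ, μ, hd, ?_⟩
  rw [← hcol, ← hval, sum_dotProduct]
  simp [smul_dotProduct]

end WorstCaseProgram

/-! ### The worst-case conditional value at risk over a Wasserstein ball -/

section WorstCase

variable {n N k : ℕ}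

theorem continuous_dotProduct_left (y : Fin n → ℝ) : Continuous fun c : Fin n → ℝ => c ⬝ᵥ y := by
  unfold dotProduct; fun_prop

theorem exists_abs_dotProduct_le {S : Set (Fin n → ℝ)} (hS : IsCompact S) (y : Fin n → ℝ) :
    ∃ R, ∀ c ∈ S, |c ⬝ᵥ y| ≤ R := by
  obtain ⟨R, hR⟩ := hS.exists_bound_of_continuousOn (continuous_dotProduct_left y).continuousOn
  exact ⟨R, fun c hc => hR c hc⟩

theorem ae_mem_of_measure_compl_eq_zero {Ω : Type*} [MeasurableSpace Ω] {S : Set Ω}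
    {Q : Measure Ω} (h : Q Sᶜ = 0) : ∀ᵐ c ∂Q, c ∈ S := h

/-! ### Attainment of the CVaR for a fixed distribution -/

section Tail

variable {S : Set (Fin n → ℝ)} {Q : Measure (Fin n → ℝ)} [IsProbabilityMeasure Q]

theorem integrable_tail (hS : IsCompact S) (hQ : Q Sᶜ = 0) (y : Fin n → ℝ) (t : ℝ) :
    Integrable (fun c => max (c ⬝ᵥ y - t) 0) Q := by
  obtain ⟨R, hR⟩ := exists_abs_dotProduct_le hS y
  refine Integrable.of_bound (C := R + |t|) ?_ ?_
  · exact (((continuous_dotProduct_left y).sub continuous_const).max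
      continuous_const).aestronglyMeasurable
  · filter_upwards [ae_mem_of_measure_compl_eq_zero hQ] with c hc
    have h1 := abs_le.1 (hR c hc)
    have h2 := neg_abs_le t
    have h3 := abs_nonneg t
    rw [Real.norm_of_nonneg (le_max_right _ _)]
    exact max_le (by linarith) (by linarith [abs_nonneg (c ⬝ᵥ y), hR c hc])

theorem continuous_rightTailFun (hS : IsCompact S) (hQ : Q Sᶜ = 0) (α : ℝ) (y : Fin n → ℝ) :
    Continuous (rightTailFun α y Q) := by
  have : Continuous fun t : ℝ => ∫ c, max (c ⬝ᵥ y - t) 0 ∂Q := by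
    refine LipschitzWith.continuous (K := 1) (LipschitzWith.of_dist_le_mul fun t u => ?_)
    rw [dist_eq_norm, ← integral_sub (integrable_tail hS hQ y t) (integrable_tail hS hQ y u)]
    refine (norm_integral_le_of_norm_le_const (C := dist t u) ?_).trans (by simp)
    refine Filter.Eventually.of_forall fun c => ?_
    rw [Real.norm_eq_abs, Real.dist_eq]
    refine (abs_max_sub_max_le_abs _ _ _).trans (le_of_eq ?_)
    rw [abs_sub_comm t u]
    congr 1
    ring
  unfold rightTailFun
  fun_prop

/-- On the support `|cᵀy| ≤ R`. For `t → -∞` the function lies above a line of slope `1 - 1 / (1 -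
α)`, which is negative because `α > 0`; for `t → ∞` it lies above `t`. -/
theorem tendsto_rightTailFun (hS : IsCompact S) (hQ : Q Sᶜ = 0) {α : ℝ} (h0 : 0 < α) (h1 : α < 1)
    (y : Fin n → ℝ) : Filter.Tendsto (rightTailFun α y Q) (Filter.cocompact ℝ) Filter.atTop := by
  obtain ⟨R, hR⟩ := exists_abs_dotProduct_le hS y
  have ha : 1 < 1 / (1 - α) := by rw [lt_div_iff₀] <;> linarith
  rw [cocompact_eq_atBot_atTop, Filter.tendsto_sup]
  constructor
  · have hlin : Filter.Tendsto (fun t : ℝ => (1 - 1 / (1 - α)) * t + 1 / (1 - α) * -R)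
        Filter.atBot Filter.atTop :=
      Filter.tendsto_atTop_add_const_right _ _
        (Filter.tendsto_id.const_mul_atBot_of_neg (by linarith))
    refine Filter.tendsto_atTop_mono (fun t => ?_) hlin
    have hI : -R - t ≤ ∫ c, max (c ⬝ᵥ y - t) 0 ∂Q := by
      have : ∫ _c : Fin n → ℝ, (-R - t) ∂Q = -R - t := by simp
      rw [← this]
      refine integral_mono_ae (integrable_const _) (integrable_tail hS hQ y t) ?_
      filter_upwards [ae_mem_of_measure_compl_eq_zero hQ] with c hc
      exact le_max_of_le_left (by linarith [(abs_le.1 (hR c hc)).1])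
    have := mul_le_mul_of_nonneg_left hI (zero_le_one.trans ha.le)
    unfold rightTailFun
    linarith
  · refine Filter.tendsto_atTop_mono (fun t => ?_) Filter.tendsto_id
    have hI : 0 ≤ ∫ c, max (c ⬝ᵥ y - t) 0 ∂Q := integral_nonneg fun c => le_max_right _ _
    have := mul_nonneg (zero_le_one.trans ha.le) hI
    unfold rightTailFun
    simp only [id]
    linarith

theorem isLeast_rightCVaR (hS : IsCompact S) (hQ : Q Sᶜ = 0) {α : ℝ} (h0 : 0 < α) (h1 : α < 1)
    (y : Fin n → ℝ) : IsLeast (Set.range (rightTailFun α y Q)) (rightCVaR α y Q) := by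
  obtain ⟨t, ht⟩ := (continuous_rightTailFun hS hQ α y).exists_forall_le
    (tendsto_rightTailFun hS hQ h0 h1 y)
  have : IsLeast (Set.range (rightTailFun α y Q)) (rightTailFun α y Q t) :=
    ⟨⟨t, rfl⟩, by rintro _ ⟨u, rfl⟩; exact ht u⟩
  rw [rightCVaR, this.csInf_eq]
  exact this

end Tail

/-- This reflection reduces the follower's left tail to the right tail of `-y`, so only one
worst-case analysis is needed. -/
theorem leftTailFun_eq (α : ℝ) (y : Fin n → ℝ) (Q : Measure (Fin n → ℝ)) (t : ℝ) :
    leftTailFun α y Q t = -rightTailFun α (-y) Q (-t) := by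
  have : ∀ c : Fin n → ℝ, min (c ⬝ᵥ y - t) 0 = -max (c ⬝ᵥ (-y) - -t) 0 := fun c => by
    rw [← min_neg_neg, dotProduct_neg]
    congr 1 <;> ring
  simp only [leftTailFun, rightTailFun, this, integral_neg]
  ring

theorem range_leftTailFun (α : ℝ) (y : Fin n → ℝ) (Q : Measure (Fin n → ℝ)) :
    Set.range (leftTailFun α y Q) = -Set.range (rightTailFun α (-y) Q) := by
  ext r
  simp only [Set.mem_range, Set.mem_neg, leftTailFun_eq]
  constructor
  · rintro ⟨t, rfl⟩
    exact ⟨-t, by ring⟩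
  · rintro ⟨t, ht⟩
    exact ⟨-t, by rw [neg_neg, ht, neg_neg]⟩

theorem leftCVaR_eq (α : ℝ) (y : Fin n → ℝ) (Q : Measure (Fin n → ℝ)) :
    leftCVaR α y Q = -rightCVaR α (-y) Q := by
  rw [leftCVaR, rightCVaR, range_leftTailFun, Real.sInf_def, neg_neg]

/-- The loss at a point of the support is bounded through the constraints of the linear
program. -/
theorem CVaRPrimal.tail_le {p : Ell} {B : Matrix (Fin N) (Fin n) ℝ} {b : Fin N → ℝ}
    {c : Fin k → Fin n → ℝ} {y : Fin n → ℝ} {ν : Fin k → Fin N → ℝ} {s : Fin k → ℝ} {l t : ℝ}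
    (h : CVaRPrimal p B (fun j => b - B *ᵥ c j) c (-y) ν s l t) {c' : Fin n → ℝ}
    (hc' : B *ᵥ c' ≤ b) (j : Fin k) :
    max (c' ⬝ᵥ y - -t) 0 ≤ s j + l * p.norm (c j - c') := by
  have h0 := mul_nonneg h.lam_nonneg (p.norm_nonneg (c j - c'))
  refine max_le ?_ (by linarith [h.s_nonneg j])
  have h1 := h.loss j
  -- Hölder's inequality compares the losses at `c j` and `c'` up to the terms in `ν j`. These have
  -- the right sign because `ν j ≥ 0` and `B c' ≤ b`; this is the only use of the support. The
  -- program is the one for `-y`, so the threshold is `-t`.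
  have h2 := p.dotProduct_le_norm_mul_norm (c j - c') (Bᵀ *ᵥ ν j + -y)
  have h3 := mul_le_mul_of_nonneg_left (h.norm j) (p.norm_nonneg (c j - c'))
  have h4 : ∀ e : Fin n → ℝ, e ⬝ᵥ (Bᵀ *ᵥ ν j) = (B *ᵥ e) ⬝ᵥ ν j := fun e => by
    rw [Matrix.mulVec_transpose, dotProduct_comm, ← Matrix.dotProduct_mulVec, dotProduct_comm]
  have h5 : (B *ᵥ c') ⬝ᵥ ν j ≤ b ⬝ᵥ ν j :=
    dotProduct_le_dotProduct_of_nonneg_right hc' (h.nu_nonneg j)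
  rw [dotProduct_add, h4, Matrix.mulVec_sub, sub_dotProduct, sub_dotProduct] at h2
  rw [sub_dotProduct] at h1
  simp only [dotProduct_neg] at h1 h2
  linarith

theorem lintegral_empirical {f : (Fin n → ℝ) → ℝ≥0∞} (c : Fin k → Fin n → ℝ) :
    ∫⁻ x, f x ∂(empirical c) = (k : ℝ≥0∞)⁻¹ * ∑ j, f (c j) := by
  simp [empirical, lintegral_smul_measure]

/-- Finitely many point masses make any function almost everywhere measurable, with no regularity
required of `f`. -/
theorem aemeasurable_empirical {f : (Fin n → ℝ) → ℝ≥0∞} (c : Fin k → Fin n → ℝ) :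
    AEMeasurable f (empirical c) := by
  refine AEMeasurable.smul_measure ?_ _
  rw [← Measure.sum_fintype]
  exact AEMeasurable.sum_measure fun j => aemeasurable_dirac

/-- Weak duality: the tail functional of every distribution in the ball is at most the objective
of a feasible solution of the linear program. -/
theorem CVaRPrimal.rightTailFun_le {p : Ell} {B : Matrix (Fin N) (Fin n) ℝ} {b : Fin N → ℝ}
    {c : Fin k → Fin n → ℝ} {y : Fin n → ℝ} {ν : Fin k → Fin N → ℝ} {s : Fin k → ℝ} {l t : ℝ}
    (h : CVaRPrimal p B (fun j => b - B *ᵥ c j) c (-y) ν s l t)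
    (hS : IsCompact {c | B *ᵥ c ≤ b}) {α ε : ℝ} (h1 : α < 1) (hε : 0 ≤ ε)
    {Q : Measure (Fin n → ℝ)} (hQ : Q ∈ wassersteinBall p {c | B *ᵥ c ≤ b} (empirical c) ε) :
    rightTailFun α y Q (-t) ≤ -cvarObjective (1 / (1 - α)) ε s l t := by
  obtain ⟨hprob, hsupp, hW⟩ := hQ
  have ha : 0 ≤ 1 / (1 - α) := by rw [one_div_nonneg]; linarith
  have hs : 0 ≤ 1 / (k : ℝ) * ∑ j, s j :=
    mul_nonneg (by positivity) (Finset.sum_nonneg fun j _ => h.s_nonneg j)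
  have hcoup : ∀ π : Measure ((Fin n → ℝ) × (Fin n → ℝ)), π.map Prod.fst = empirical c →
      π.map Prod.snd = Q →
      ∫⁻ x, ENNReal.ofReal (max (x ⬝ᵥ y - -t) 0) ∂Q ≤ ENNReal.ofReal (1 / (k : ℝ) * ∑ j, s j) +
        ENNReal.ofReal l * ∫⁻ z, ENNReal.ofReal (p.norm (z.1 - z.2)) ∂π := by
    intro π hfst hsnd
    -- Samples may coincide, so `s` is not a function of the point; the smallest value over the
    -- samples at `x` is. Away from the samples `g` is infinite, which the empirical distribution
    -- does not see.
    let g : (Fin n → ℝ) → ℝ≥0∞ := fun x => ⨅ j : {j // c j = x}, ENNReal.ofReal (s j)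
    have hg1 : AEMeasurable g (π.map Prod.fst) := by rw [hfst]; exact aemeasurable_empirical c
    have hm2 : Measurable fun x : Fin n → ℝ => ENNReal.ofReal (max (x ⬝ᵥ y - -t) 0) := by
      have := continuous_dotProduct_left y
      exact ENNReal.measurable_ofReal.comp (by fun_prop)
    have hm3 : Measurable fun z : (Fin n → ℝ) × (Fin n → ℝ) =>
        ENNReal.ofReal (p.norm (z.1 - z.2)) := by
      have := p.continuous_norm (n := n)
      exact ENNReal.measurable_ofReal.comp (by fun_prop)
    have hsnd' : ∀ᵐ z ∂π, B *ᵥ z.2 ≤ b := by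
      have : ∀ᵐ x ∂(π.map Prod.snd), x ∈ {c | B *ᵥ c ≤ b} := by rw [hsnd]; exact hsupp
      exact ae_of_ae_map measurable_snd.aemeasurable this
    calc ∫⁻ x, ENNReal.ofReal (max (x ⬝ᵥ y - -t) 0) ∂Q
        = ∫⁻ z, ENNReal.ofReal (max (z.2 ⬝ᵥ y - -t) 0) ∂π := by
          rw [← hsnd, lintegral_map hm2 measurable_snd]
      _ ≤ ∫⁻ z, (g z.1 + ENNReal.ofReal l * ENNReal.ofReal (p.norm (z.1 - z.2))) ∂π := by
          refine lintegral_mono_ae ?_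
          filter_upwards [hsnd'] with z hz
          rw [ENNReal.iInf_add]
          refine le_iInf fun ⟨j, hj⟩ => ?_
          rw [← ENNReal.ofReal_mul h.lam_nonneg, ← ENNReal.ofReal_add (h.s_nonneg j)
            (mul_nonneg h.lam_nonneg (p.norm_nonneg _)), ← hj]
          exact ENNReal.ofReal_le_ofReal (h.tail_le hz j)
      _ = ∫⁻ z, g z.1 ∂π + ENNReal.ofReal l * ∫⁻ z, ENNReal.ofReal (p.norm (z.1 - z.2)) ∂π := by
          rw [lintegral_add_right _ (hm3.const_mul _), lintegral_const_mul _ hm3]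
      _ ≤ _ := by
          gcongr
          rw [← lintegral_map' hg1 measurable_fst.aemeasurable, hfst, lintegral_empirical,
            ENNReal.ofReal_mul (by positivity), ENNReal.ofReal_sum_of_nonneg
            fun j _ => h.s_nonneg j]
          refine mul_le_mul' ?_ (Finset.sum_le_sum fun j _ =>
            iInf_le (fun i : {i // c i = c j} => ENNReal.ofReal (s i)) ⟨j, rfl⟩)
          -- Without samples the empirical measure is zero and cannot be coupled with a probability
          -- measure.
          rcases Nat.eq_zero_or_pos k with rfl | hk
          · have := hprob
            have h0 : (empirical c) Set.univ = Q Set.univ := by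
              rw [← hfst, ← hsnd, Measure.map_apply measurable_fst MeasurableSet.univ,
                Measure.map_apply measurable_snd MeasurableSet.univ]
              rfl
            simp [empirical] at h0
          · rw [one_div, ENNReal.ofReal_inv_of_pos (by exact_mod_cast hk), ENNReal.ofReal_natCast]
  have hle : ∫⁻ x, ENNReal.ofReal (max (x ⬝ᵥ y - -t) 0) ∂Q ≤
      ENNReal.ofReal (1 / (k : ℝ) * ∑ j, s j) + ENNReal.ofReal l * ENNReal.ofReal ε := by
    refine le_trans ?_ (add_le_add_right (mul_le_mul_right hW _) _)
    rw [wasserstein, iInf_subtype']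
    rw [wasserstein, iInf_subtype'] at hW
    -- An optimal coupling is not needed: the bound for each coupling passes to the infimum. If
    -- there were no coupling at all, the infimum would be infinite and exceed the radius.
    rcases isEmpty_or_nonempty {π : Measure ((Fin n → ℝ) × (Fin n → ℝ)) //
      π ∈ {π : Measure ((Fin n → ℝ) × (Fin n → ℝ)) |
        π.map Prod.fst = empirical c ∧ π.map Prod.snd = Q}} with hemp | hne
    · rw [iInf_of_empty] at hW
      exact absurd hW (by simp)
    · rw [ENNReal.mul_iInf (fun h => absurd h ENNReal.ofReal_ne_top), ENNReal.add_iInf]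
      exact le_iInf fun π => hcoup π.1 π.2.1 π.2.2
  have hint : ∫ x, max (x ⬝ᵥ y - -t) 0 ∂Q ≤ 1 / (k : ℝ) * ∑ j, s j + l * ε := by
    rw [integral_eq_lintegral_of_nonneg_ae
      (Filter.Eventually.of_forall fun x : Fin n → ℝ => le_max_right (x ⬝ᵥ y - -t) (0 : ℝ))
      (integrable_tail hS hsupp y (-t)).aestronglyMeasurable]
    refine ENNReal.toReal_le_of_le_ofReal (add_nonneg hs (mul_nonneg h.lam_nonneg hε)) ?_
    rwa [ENNReal.ofReal_add hs (mul_nonneg h.lam_nonneg hε), ENNReal.ofReal_mul h.lam_nonneg]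
  have := mul_le_mul_of_nonneg_left hint ha
  unfold rightTailFun cvarObjective
  linarith

/-- A compact polyhedron has no recession direction. For a dual solution this forces `μ j = 0`
whenever `γ j = 0`, so the quotient `μ j / γ j` loses no information. -/
theorem eq_zero_of_recession {B : Matrix (Fin N) (Fin n) ℝ} {b : Fin N → ℝ} {c u : Fin n → ℝ}
    (hS : IsCompact {c | B *ᵥ c ≤ b}) (hc : B *ᵥ c ≤ b) (hu : 0 ≤ B *ᵥ u) : u = 0 := by
  obtain ⟨R, hR⟩ := hS.isBounded.exists_norm_le
  by_contra hne
  have hpos : 0 < ‖u‖ := norm_pos_iff.2 hne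
  have hR0 : 0 ≤ R := (norm_nonneg c).trans (hR c hc)
  have hr : 0 ≤ (R + ‖c‖ + 1) / ‖u‖ := by positivity
  have hmem : B *ᵥ (c - ((R + ‖c‖ + 1) / ‖u‖) • u) ≤ b := by
    rw [Matrix.mulVec_sub, Matrix.mulVec_smul]
    exact (sub_le_self _ (smul_nonneg hr hu)).trans hc
  have h1 := hR _ hmem
  have h2 := norm_sub_norm_le (((R + ‖c‖ + 1) / ‖u‖) • u) c
  rw [norm_smul, Real.norm_of_nonneg hr, div_mul_cancel₀ _ hpos.ne', norm_sub_rev] at h2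
  linarith

/-- Every feasible solution of the dual program is attained by a distribution in the ball. -/
theorem CVaRDual.exists_measure {p : Ell} {B : Matrix (Fin N) (Fin n) ℝ} {b : Fin N → ℝ}
    {c : Fin k → Fin n → ℝ} {γ : Fin k → ℝ} {μ : Fin k → Fin n → ℝ} {α ε : ℝ}
    (h : CVaRDual p B (fun j => b - B *ᵥ c j) (1 / (1 - α)) ε γ μ)
    (hS : IsCompact {c | B *ᵥ c ≤ b}) (hc : ∀ j, B *ᵥ c j ≤ b) (hk : 0 < k) (h1 : α < 1) :
    ∃ Q ∈ wassersteinBall p {c | B *ᵥ c ≤ b} (empirical c) ε, ∀ y t,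
      (∑ j, γ j • c j - ∑ j, μ j) ⬝ᵥ y ≤ rightTailFun α y Q t := by
  have hα : 0 < 1 - α := by linarith
  have hk' : (0 : ℝ) < k := by exact_mod_cast hk
  have hμ : ∀ j, γ j = 0 → μ j = 0 := fun j hj => by
    have := h.nu_col j
    rw [hj, zero_smul, zero_add] at this
    exact eq_zero_of_recession hS (hc j) this
  -- The destination of the mass that leaves `c j`. For `γ j = 0` the inverse is `0` by convention,
  -- and `d j = c j`.
  let d : Fin k → Fin n → ℝ := fun j => c j - (γ j)⁻¹ • μ j
  have hγd : ∀ j, γ j • d j = γ j • c j - μ j := fun j => by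
    by_cases hj : γ j = 0
    · simp [hj, hμ j hj]
    · simp [d, smul_sub, smul_smul, hj]
  have hd : ∀ j, B *ᵥ d j ≤ b := fun j => by
    rcases (h.gamma_nonneg j).lt_or_eq with hj | hj
    · have h2 := h.nu_col j
      intro i
      have h3 := h2 i
      have h4 : (B *ᵥ d j) i = (B *ᵥ c j) i - (γ j)⁻¹ * (B *ᵥ μ j) i := by
        simp [d, Matrix.mulVec_sub, Matrix.mulVec_smul]
      simp only [Pi.zero_apply, Pi.add_apply, Pi.smul_apply, Pi.sub_apply, smul_eq_mul] at h3
      have h5 := mul_nonneg (inv_nonneg.2 hj.le) h3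
      rw [mul_add, inv_mul_cancel_left₀ hj.ne'] at h5
      linarith
    · simpa [d, ← hj] using hc j
  -- At the sample `c j`, the mass `w j` moves to `d j` and `u j` stays; `gamma_le` says precisely
  -- that `u j ≥ 0`.
  let w : Fin k → ℝ := fun j => (1 - α) * γ j
  let u : Fin k → ℝ := fun j => 1 / (k : ℝ) - w j
  have hw : ∀ j, 0 ≤ w j := fun j => mul_nonneg hα.le (h.gamma_nonneg j)
  have hu : ∀ j, 0 ≤ u j := fun j => by
    have := mul_le_mul_of_nonneg_left (h.gamma_le j) hα.le
    rw [← mul_assoc, mul_one_div_cancel hα.ne', one_mul] at this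
    exact sub_nonneg.2 this
  have hwu : ∀ j, ENNReal.ofReal (w j) + ENNReal.ofReal (u j) = (k : ℝ≥0∞)⁻¹ := fun j => by
    rw [← ENNReal.ofReal_add (hw j) (hu j)]
    simp only [u, add_sub_cancel]
    rw [one_div, ENNReal.ofReal_inv_of_pos hk', ENNReal.ofReal_natCast]
  let Q : Measure (Fin n → ℝ) := ∑ j, (ENNReal.ofReal (w j) • Measure.dirac (d j) +
    ENNReal.ofReal (u j) • Measure.dirac (c j))
  let π : Measure ((Fin n → ℝ) × (Fin n → ℝ)) :=
    ∑ j, (ENNReal.ofReal (w j) • Measure.dirac (c j, d j) +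
      ENNReal.ofReal (u j) • Measure.dirac (c j, c j))
  have hmap : ∀ (f : (Fin n → ℝ) × (Fin n → ℝ) → Fin n → ℝ), Measurable f → π.map f =
      ∑ j, (ENNReal.ofReal (w j) • Measure.dirac (f (c j, d j)) +
        ENNReal.ofReal (u j) • Measure.dirac (f (c j, c j))) := by
    intro f hf
    rw [← Measure.mapₗ_apply_of_measurable hf, map_sum]
    simp only [Measure.mapₗ_apply_of_measurable hf, Measure.map_add _ _ hf, Measure.map_smul,
      Measure.map_dirac' hf]
  have hprob : IsProbabilityMeasure Q := by
    constructor
    simp only [Q, Measure.finsetSum_apply, Measure.add_apply, Measure.smul_apply, measure_univ,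
      smul_eq_mul, mul_one, hwu]
    simp [ENNReal.mul_inv_cancel, hk.ne']
  have hQS : Q {c | B *ᵥ c ≤ b}ᶜ = 0 := by
    have hmeas : MeasurableSet {c | B *ᵥ c ≤ b}ᶜ := hS.isClosed.measurableSet.compl
    simp only [Q, Measure.finsetSum_apply, Measure.add_apply, Measure.smul_apply, smul_eq_mul,
      Measure.dirac_apply' _ hmeas]
    refine Finset.sum_eq_zero fun j _ => ?_
    simp [Set.indicator, hd j, hc j]
  refine ⟨Q, ⟨hprob, hQS, ?_⟩, fun y t => ?_⟩
  · have hπ : π.map Prod.fst = empirical c ∧ π.map Prod.snd = Q := by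
      constructor
      · rw [hmap _ measurable_fst]
        simp only [← add_smul, hwu, empirical, Finset.smul_sum]
      · rw [hmap _ measurable_snd]
    · refine (iInf₂_le π hπ).trans ?_
      have hm3 : Measurable fun z : (Fin n → ℝ) × (Fin n → ℝ) =>
          ENNReal.ofReal (p.norm (z.1 - z.2)) := by
        have := p.continuous_norm (n := n)
        exact ENNReal.measurable_ofReal.comp (by fun_prop)
      -- The cost of each move is `(1 - α) * p.norm (μ j)`, so `budget` says that this plan costs at
      -- most `ε`.
      have hcost : ∀ j, w j * p.norm (c j - d j) = (1 - α) * p.norm (μ j) := fun j => by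
        simp only [d, sub_sub_cancel, w, p.norm_smul]
        by_cases hj : γ j = 0
        · simp [hj, hμ j hj, p.norm_zero]
        · rw [abs_of_nonneg (inv_nonneg.2 (h.gamma_nonneg j))]
          field_simp
      calc ∫⁻ z, ENNReal.ofReal (p.norm (z.1 - z.2)) ∂π
          = ∑ j, ENNReal.ofReal (w j * p.norm (c j - d j)) := by
            simp only [π, lintegral_finsetSum_measure, lintegral_add_measure,
              lintegral_smul_measure, lintegral_dirac' _ hm3, sub_self, p.norm_zero,
              ENNReal.ofReal_zero, mul_zero, add_zero, smul_eq_mul]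
            exact Finset.sum_congr rfl fun j _ => (ENNReal.ofReal_mul (hw j)).symm
        _ = ENNReal.ofReal ((1 - α) * ∑ j, p.norm (μ j)) := by
            rw [← ENNReal.ofReal_sum_of_nonneg fun j _ => mul_nonneg (hw j) (p.norm_nonneg _),
              Finset.mul_sum]
            simp only [hcost]
        _ ≤ ENNReal.ofReal ε := by
            refine ENNReal.ofReal_le_ofReal ?_
            have := mul_le_mul_of_nonneg_left h.budget hα.le
            rwa [← mul_assoc, mul_one_div_cancel hα.ne', one_mul] at this
  · let f : (Fin n → ℝ) → ℝ := fun x => max (x ⬝ᵥ y - t) 0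
    have hint : ∫ x, f x ∂Q = ∑ j, (w j * f (d j) + u j * f (c j)) := by
      have hi : ∀ (r : ℝ) (x : Fin n → ℝ),
          Integrable f (ENNReal.ofReal r • Measure.dirac x) := fun r x =>
        (integrable_dirac (by simp)).smul_measure ENNReal.ofReal_ne_top
      rw [integral_finsetSum_measure fun j _ => (hi _ _).add_measure (hi _ _)]
      refine Finset.sum_congr rfl fun j _ => ?_
      rw [integral_add_measure (hi _ _) (hi _ _), integral_smul_measure, integral_smul_measure,
        integral_dirac, integral_dirac, ENNReal.toReal_ofReal (hw j),
        ENNReal.toReal_ofReal (hu j), smul_eq_mul, smul_eq_mul]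
    -- The mass that stays is dropped, and on the moved mass the positive part is bounded below by
    -- its argument. Since the `γ j` sum to one, the threshold `t` cancels in the end.
    have hlow : ∑ j, (1 - α) * (γ j * (d j ⬝ᵥ y - t)) ≤ ∫ x, f x ∂Q := by
      rw [hint]
      refine Finset.sum_le_sum fun j _ => ?_
      have e1 : w j * (d j ⬝ᵥ y - t) ≤ w j * f (d j) :=
        mul_le_mul_of_nonneg_left (le_max_left _ _) (hw j)
      have e2 : 0 ≤ u j * f (c j) := mul_nonneg (hu j) (le_max_right _ _)
      rw [← mul_assoc]
      linarith
    have := mul_le_mul_of_nonneg_left hlow (one_div_nonneg.2 hα.le)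
    rw [← Finset.mul_sum, ← mul_assoc, one_div_mul_cancel hα.ne', one_mul] at this
    have heq : ∑ j, γ j * (d j ⬝ᵥ y - t) = (∑ j, γ j • c j - ∑ j, μ j) ⬝ᵥ y - t := by
      simp only [mul_sub, Finset.sum_sub_distrib, ← Finset.sum_mul, h.gamma_sum, one_mul]
      rw [← Finset.sum_sub_distrib, sum_dotProduct]
      congr 1
      refine Finset.sum_congr rfl fun j _ => ?_
      rw [← hγd, smul_dotProduct, smul_eq_mul]
    unfold rightTailFun
    linarith

/-- The worst-case CVaR over the Wasserstein ball is attained, and it is the value of the linear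
program and of its dual. -/
theorem exists_isGreatest_rightCVaR {p : Ell} {B : Matrix (Fin N) (Fin n) ℝ} {b : Fin N → ℝ}
    {c : Fin k → Fin n → ℝ} {α ε : ℝ} (hS : IsCompact {c | B *ᵥ c ≤ b})
    (hc : ∀ j, B *ᵥ c j ≤ b) (hk : 0 < k) (h0 : 0 < α) (h1 : α < 1) (hε : 0 ≤ ε)
    (y : Fin n → ℝ) :
    ∃ ν s l t, CVaRPrimal p B (fun j => b - B *ᵥ c j) c (-y) ν s l t ∧
      ∃ (γ : Fin k → ℝ) (μ : Fin k → Fin n → ℝ),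
        CVaRDual p B (fun j => b - B *ᵥ c j) (1 / (1 - α)) ε γ μ ∧
        (∑ j, γ j • c j - ∑ j, μ j) ⬝ᵥ y = -cvarObjective (1 / (1 - α)) ε s l t ∧
        IsGreatest (rightCVaR α y '' wassersteinBall p {c | B *ᵥ c ≤ b} (empirical c) ε)
          (-cvarObjective (1 / (1 - α)) ε s l t) := by
  have ha : 1 ≤ 1 / (1 - α) := by rw [le_div_iff₀] <;> linarith
  obtain ⟨ν, s, l, t, hp, γ, μ, hd, hval⟩ := exists_cvar_optimal_of_fixed p B
    (fun j => b - B *ᵥ c j) c (1 / (1 - α)) ε hk (fun j => sub_nonneg.2 (hc j)) ha hε (-y)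
  rw [dotProduct_neg] at hval
  -- The primal solution bounds all distributions through the one threshold `-t`; the dual solution
  -- gives one distribution that reaches the same value at every threshold. Hence the two orders of
  -- optimization agree.
  have hle : ∀ Q ∈ wassersteinBall p {c | B *ᵥ c ≤ b} (empirical c) ε,
      rightCVaR α y Q ≤ -cvarObjective (1 / (1 - α)) ε s l t := fun Q hQ => by
    have := hQ.1
    exact ((isLeast_rightCVaR hS hQ.2.1 h0 h1 y).2 ⟨-t, rfl⟩).trans
      (hp.rightTailFun_le hS h1 hε hQ)
  obtain ⟨Q, hQ, hQt⟩ := hd.exists_measure hS hc hk h1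
  refine ⟨ν, s, l, t, hp, γ, μ, hd, by linarith, ⟨Q, hQ, le_antisymm (hle Q hQ) ?_⟩, ?_⟩
  · have := hQ.1
    obtain ⟨τ, hτ⟩ := (isLeast_rightCVaR hS hQ.2.1 h0 h1 y).1
    rw [← hτ]
    linarith [hQt y τ]
  · rintro _ ⟨Q, hQ, rfl⟩
    exact hle Q hQ

end WorstCase

/-! ### The worst-case CVaR as a function of the decision -/

section WorstValue

variable {n N k : ℕ}

/-- The worst-case right-tail CVaR over a Wasserstein ball. -/
noncomputable def worstCVaR (p : Ell) (B : Matrix (Fin N) (Fin n) ℝ) (b : Fin N → ℝ)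
    (c : Fin k → Fin n → ℝ) (α ε : ℝ) (y : Fin n → ℝ) : ℝ :=
  sSup (rightCVaR α y '' wassersteinBall p {c | B *ᵥ c ≤ b} (empirical c) ε)

variable {p : Ell} {B : Matrix (Fin N) (Fin n) ℝ} {b : Fin N → ℝ} {c : Fin k → Fin n → ℝ}
  {α ε : ℝ}

theorem exists_worstCVaR_eq (hS : IsCompact {c | B *ᵥ c ≤ b}) (hc : ∀ j, B *ᵥ c j ≤ b)
    (hk : 0 < k) (h0 : 0 < α) (h1 : α < 1) (hε : 0 ≤ ε) (y : Fin n → ℝ) :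
    ∃ ν s l t, CVaRPrimal p B (fun j => b - B *ᵥ c j) c (-y) ν s l t ∧
      worstCVaR p B b c α ε y = -cvarObjective (1 / (1 - α)) ε s l t := by
  obtain ⟨ν, s, l, t, hp, -, -, -, -, hg⟩ :=
    exists_isGreatest_rightCVaR (p := p) hS hc hk h0 h1 hε y
  exact ⟨ν, s, l, t, hp, hg.csSup_eq⟩

theorem isGreatest_worstCVaR (hS : IsCompact {c | B *ᵥ c ≤ b}) (hc : ∀ j, B *ᵥ c j ≤ b)
    (hk : 0 < k) (h0 : 0 < α) (h1 : α < 1) (hε : 0 ≤ ε) (y : Fin n → ℝ) :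
    IsGreatest (rightCVaR α y '' wassersteinBall p {c | B *ᵥ c ≤ b} (empirical c) ε)
      (worstCVaR p B b c α ε y) := by
  obtain ⟨ν, s, l, t, hp, -, -, -, -, hg⟩ :=
    exists_isGreatest_rightCVaR (p := p) hS hc hk h0 h1 hε y
  rw [worstCVaR, hg.csSup_eq]
  exact hg

theorem worstCVaR_le (hS : IsCompact {c | B *ᵥ c ≤ b}) (hc : ∀ j, B *ᵥ c j ≤ b)
    (hk : 0 < k) (h0 : 0 < α) (h1 : α < 1) (hε : 0 ≤ ε) {y : Fin n → ℝ}
    {ν : Fin k → Fin N → ℝ} {s : Fin k → ℝ} {l t : ℝ}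
    (h : CVaRPrimal p B (fun j => b - B *ᵥ c j) c (-y) ν s l t) :
    worstCVaR p B b c α ε y ≤ -cvarObjective (1 / (1 - α)) ε s l t := by
  obtain ⟨Q, hQ, hQe⟩ := (isGreatest_worstCVaR (p := p) hS hc hk h0 h1 hε y).1
  have := hQ.1
  rw [← hQe]
  exact ((isLeast_rightCVaR hS hQ.2.1 h0 h1 y).2 ⟨-t, rfl⟩).trans (h.rightTailFun_le hS h1 hε hQ)

/-- By duality, the worst case is a supremum of linear functions of `y`, one for each dual solution,
so its sublevel sets are intersections of closed half-spaces. -/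
theorem lowerSemicontinuous_worstCVaR (hS : IsCompact {c | B *ᵥ c ≤ b})
    (hc : ∀ j, B *ᵥ c j ≤ b) (hk : 0 < k) (h0 : 0 < α) (h1 : α < 1) (hε : 0 ≤ ε) :
    LowerSemicontinuous (worstCVaR p B b c α ε) := by
  let K : Set (Fin n → ℝ) := {e | ∃ (γ : Fin k → ℝ) (μ : Fin k → Fin n → ℝ),
    CVaRDual p B (fun j => b - B *ᵥ c j) (1 / (1 - α)) ε γ μ ∧ e = ∑ j, γ j • c j - ∑ j, μ j}
  rw [lowerSemicontinuous_iff_isClosed_preimage]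
  intro r
  have : worstCVaR p B b c α ε ⁻¹' Set.Iic r = ⋂ e ∈ K, {y | e ⬝ᵥ y ≤ r} := by
    ext y
    obtain ⟨ν, s, l, t, hp, γ, μ, hd, hval, hg⟩ :=
      exists_isGreatest_rightCVaR (p := p) hS hc hk h0 h1 hε y
    have hw : worstCVaR p B b c α ε y = -cvarObjective (1 / (1 - α)) ε s l t := hg.csSup_eq
    simp only [Set.mem_preimage, Set.mem_Iic, Set.mem_iInter, hw]
    constructor
    · rintro h _ ⟨γ', μ', hd', rfl⟩
      have := hp.objective_le hd'
      rw [dotProduct_neg] at this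
      exact le_trans (by linarith) h
    · intro h
      rw [← hval]
      exact h _ ⟨γ, μ, hd, rfl⟩
  rw [this]
  refine isClosed_biInter fun e _ => isClosed_le ?_ continuous_const
  unfold dotProduct
  fun_prop

end WorstValue

/-- A criterion for a reformulation. -/
theorem IsReformulation.of_extensions {E Z : Type} {feas : Set E} {obj : E → ℝ} {Feas : Set Z}
    {Obj : Z → ℝ} {proj : Z → E}
    (hle : ∀ z ∈ Feas, proj z ∈ feas ∧ obj (proj z) ≤ Obj z)
    (hext : ∀ e ∈ feas, ∃ z ∈ Feas, proj z = e ∧ Obj z = obj e)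
    (hmin : ∃ e ∈ feas, ∀ e' ∈ feas, obj e ≤ obj e') :
    IsReformulation feas obj Feas Obj proj where
  feasible_eq := by
    ext e
    constructor
    · rintro ⟨z, hz, rfl⟩
      exact (hle z hz).1
    · intro he
      obtain ⟨z, hz, hze, -⟩ := hext e he
      exact ⟨z, hz, hze⟩
  fibre_min := fun e he => by
    obtain ⟨z, hz, hze, hzo⟩ := hext e he
    refine ⟨⟨z, ⟨hz, hze⟩, hzo⟩, ?_⟩
    rintro _ ⟨z', ⟨hz', rfl⟩, rfl⟩
    exact (hle z' hz').2
  value_eq := by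
    obtain ⟨e, he, hmin⟩ := hmin
    obtain ⟨z, hz, hze, hzo⟩ := hext e he
    refine ⟨obj e, ⟨⟨e, he, rfl⟩, ?_⟩, ⟨⟨z, hz, hzo⟩, ?_⟩⟩
    · rintro _ ⟨e', he', rfl⟩
      exact hmin e' he'
    · rintro _ ⟨z', hz', rfl⟩
      exact (hmin _ (hle z' hz').1).trans (hle z' hz').2

namespace DRIData

variable {d : Dims} {D : DRIData d ℝ}

/-! ### The two levels as linear programs -/

theorem worstL_eq (D : DRIData d ℝ) (y : Fin d.n → ℝ) :
    D.worstL y = worstCVaR D.p D.B D.b D.cl D.al D.el y := rfl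

theorem image_leftCVaR (D : DRIData d ℝ) (y : Fin d.n → ℝ) :
    leftCVaR D.af y '' D.ambF = -(rightCVaR D.af (-y) '' D.ambF) := by
  ext r
  simp only [Set.mem_image, Set.mem_neg, leftCVaR_eq]
  constructor
  · rintro ⟨Q, hQ, rfl⟩
    exact ⟨Q, hQ, (neg_neg _).symm⟩
  · rintro ⟨Q, hQ, h⟩
    exact ⟨Q, hQ, by rw [h, neg_neg]⟩

theorem worstF_eq (D : DRIData d ℝ) (y : Fin d.n → ℝ) :
    D.worstF y = -worstCVaR D.p D.B D.b D.cf D.af D.ef (-y) := by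
  rw [worstF, image_leftCVaR, Real.sInf_def, neg_neg]
  rfl

theorem slObjective_eq (D : DRIData d ℝ) (v : SLVars d) :
    D.slObjective v = -cvarObjective (1 / (1 - D.al)) D.el v.sL v.lamL (-v.tL) := by
  unfold slObjective cvarObjective
  ring

theorem primalObjective_eq (D : DRIData d ℝ) (v : SLVars d) :
    D.primalObjective v = cvarObjective (1 / (1 - D.af)) D.ef v.sF v.lamF v.tF := rfl

theorem leaderFeasible_iff (hk : 0 < d.kl) (v : SLVars d) :
    D.LeaderFeasible v ↔
      CVaRPrimal D.p D.B D.deltaL D.cl (-v.y) v.nuL v.sL v.lamL (-v.tL) := by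
  constructor
  · intro h
    refine ⟨fun j => ?_, fun j => ?_, h.nu_nonneg, h.s_nonneg,
      -- The sign of `lamL` is not among the leader's constraints; the norm constraint of any one
      -- sample implies it.
      (D.p.conj.norm_nonneg _).trans (h.norm ⟨0, hk⟩)⟩
    · have := h.loss j
      rw [dotProduct_neg]
      linarith
    · rw [← sub_eq_add_neg]
      exact h.norm j
  · intro h
    refine ⟨fun j => ?_, fun j => ?_, h.nu_nonneg, h.s_nonneg⟩
    · have := h.loss j
      rw [dotProduct_neg] at this
      linarith
    · rw [sub_eq_add_neg]
      exact h.norm j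

theorem primalFeasible_iff (v : SLVars d) :
    D.PrimalFeasible v ↔ v.y ∈ D.Y v.x ∧
      CVaRPrimal D.p D.B D.deltaF D.cf v.y v.nuF v.sF v.lamF v.tF :=
  ⟨fun h => ⟨⟨h.y_nonneg, le_sub_iff_add_le.1 h.system⟩,
    ⟨h.loss, h.norm, h.nu_nonneg, h.s_nonneg, h.lam_nonneg⟩⟩,
   fun h => ⟨le_sub_iff_add_le.2 h.1.2, h.2.loss, h.2.norm, h.2.nu_nonneg, h.2.s_nonneg, h.1.1,
    h.2.lam_nonneg⟩⟩

/-- Only the difference of `muUp` and `muLo` matters. Both being non-negative, it is dominated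
entrywise by their sum, which is what the budget bounds. -/
theorem DualFeasible.cvarDual {v : SLVars d} (h : D.DualFeasible v) :
    CVaRDual D.p D.B D.deltaF (1 / (1 - D.af)) D.ef v.gamma (fun k => v.muUp k - v.muLo k) where
  gamma_nonneg := h.gamma_nonneg
  gamma_le := fun k => by rw [one_div_mul_one_div]; exact h.gamma_le k
  gamma_sum := h.gamma_sum
  nu_col := h.nu_col
  budget := by
    refine le_trans (Finset.sum_le_sum fun k _ => ?_) h.budget
    have hle : ∀ i, |(v.muUp k - v.muLo k) i| ≤ |(v.muUp k + v.muLo k) i| := fun i => by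
      have h1 := h.muUp_nonneg k i
      have h2 := h.muLo_nonneg k i
      simp only [Pi.zero_apply, Pi.sub_apply, Pi.add_apply] at *
      rw [abs_of_nonneg (add_nonneg h1 h2)]
      exact abs_le.2 ⟨by linarith, by linarith⟩
    cases D.p
    · exact Finset.sum_le_sum fun i _ => hle i
    · exact (Ell.norm_infty_le_iff (Ell.norm_nonneg _ _)).2 fun i =>
        (hle i).trans (norm_le_pi_norm (v.muUp k + v.muLo k) i)

/-- Weak duality for the follower's problem. -/
theorem DualFeasible.primalObjective_le {v v' : SLVars d} (h : D.DualFeasible v)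
    (h' : D.PrimalFeasible v') (hx : v'.x = v.x) : D.primalObjective v' ≤ D.dualObjective v := by
  obtain ⟨hY, hp⟩ := (primalFeasible_iff v').1 h'
  refine (hp.objective_le h.cvarDual).trans ?_
  have h1 : (∑ j, v.gamma j • D.cf j - ∑ j, (v.muUp j - v.muLo j)) ⬝ᵥ v'.y ≤
      (D.Fᵀ *ᵥ v.beta) ⬝ᵥ v'.y := by
    refine dotProduct_le_dotProduct_of_nonneg_right ?_ h'.y_nonneg
    intro i
    have := h.y_col i
    simp only [Pi.zero_apply, Pi.add_apply, Pi.sub_apply] at this ⊢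
    linarith
  refine h1.trans ?_
  have h2 : (D.Fᵀ *ᵥ v.beta) ⬝ᵥ v'.y = (D.F *ᵥ v'.y) ⬝ᵥ v.beta := by
    rw [Matrix.mulVec_transpose, ← Matrix.dotProduct_mulVec, dotProduct_comm]
  rw [h2, dualObjective, ← hx, neg_add_eq_sub]
  exact dotProduct_le_dotProduct_of_nonneg_right h'.system h.beta_nonneg

theorem Standing.isCompact_Y (hD : D.Standing) {x : Fin d.m → ℝ} (hx : x ∈ D.X) :
    IsCompact (D.Y x) := by
  refine Metric.isCompact_of_isClosed_isBounded ?_ (hD.Y_bounded x hx)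
  have : D.Y x = {y | 0 ≤ y} ∩ {y | D.F *ᵥ y + D.L *ᵥ x ≤ D.f} := rfl
  rw [this]
  exact (isClosed_le continuous_const continuous_id).inter
    (isClosed_le (by fun_prop) continuous_const)

theorem Standing.deltaL_nonneg (hD : D.Standing) (k : Fin d.kl) : 0 ≤ D.deltaL k :=
  sub_nonneg.2 (hD.cl_mem k)

theorem Standing.deltaF_nonneg (hD : D.Standing) (k : Fin d.kf) : 0 ≤ D.deltaF k :=
  sub_nonneg.2 (hD.cf_mem k)

theorem Standing.attained (hD : D.Standing) : D.Attained where
  rhoL := fun y Q hQ => by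
    have := hQ.1
    exact isLeast_rightCVaR hD.S_compact hQ.2.1 hD.al_pos hD.al_lt y
  rhoF := fun y Q hQ => by
    have := hQ.1
    rw [range_leftTailFun, leftCVaR_eq]
    have := isLeast_rightCVaR hD.S_compact hQ.2.1 hD.af_pos hD.af_lt (-y)
    exact ⟨Set.neg_mem_neg.2 this.1, fun r hr => by linarith [this.2 hr]⟩
  worstL := fun y => isGreatest_worstCVaR hD.S_compact hD.cl_mem hD.kl_pos hD.al_pos hD.al_lt
    hD.el_nonneg y
  worstF := fun y => by
    rw [image_leftCVaR, worstF_eq]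
    have := isGreatest_worstCVaR (p := D.p) hD.S_compact hD.cf_mem hD.kf_pos hD.af_pos hD.af_lt
      hD.ef_nonneg (-y)
    exact ⟨Set.neg_mem_neg.2 this.1, fun r hr => by linarith [this.2 hr]⟩

theorem Standing.worstL_le (hD : D.Standing) {v : SLVars d} (h : D.LeaderFeasible v) :
    D.worstL v.y ≤ D.slObjective v := by
  rw [slObjective_eq, worstL_eq]
  exact worstCVaR_le hD.S_compact hD.cl_mem hD.kl_pos hD.al_pos hD.al_lt hD.el_nonneg
    ((leaderFeasible_iff hD.kl_pos v).1 h)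

theorem Standing.primalObjective_le_worstF (hD : D.Standing) {v : SLVars d}
    (h : D.PrimalFeasible v) : D.primalObjective v ≤ D.worstF v.y := by
  have hp := ((primalFeasible_iff v).1 h).2
  rw [← neg_neg v.y] at hp
  rw [primalObjective_eq, worstF_eq]
  have := worstCVaR_le hD.S_compact hD.cf_mem hD.kf_pos hD.af_pos hD.af_lt hD.ef_nonneg hp
  linarith

/-- Optimality of a solution of the follower's dual linear program. -/
structure IsDualOptimal (D : DRIData d ℝ) (v : SLVars d) : Prop where
  feasible : D.DualFeasible v
  le : ∀ v', D.DualFeasible v' → v'.x = v.x → D.dualObjective v ≤ D.dualObjective v'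

/-- Strong duality for the follower's problem. -/
theorem Standing.exists_strong_duality (hD : D.Standing) {x : Fin d.m → ℝ} (hx : x ∈ D.X) :
    ∃ v : SLVars d, v.x = x ∧ D.PrimalFeasible v ∧ D.DualFeasible v ∧
      D.dualObjective v = D.primalObjective v := by
  classical
  have ha : 1 ≤ 1 / (1 - D.af) := by
    have := hD.af_pos
    have := hD.af_lt
    rw [le_div_iff₀] <;> linarith
  have hG : ∀ y, (∀ i : Fin d.dY ⊕ Fin d.n,
      Sum.elim (fun r => D.F r) (fun i => Pi.single i (-1)) i ⬝ᵥ y ≤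
        Sum.elim (D.f - D.L *ᵥ x) 0 i) ↔ y ∈ D.Y x := by
    intro y
    rw [Sum.forall]
    simp only [Sum.elim_inl, Sum.elim_inr, single_dotProduct]
    constructor
    · rintro ⟨h1, h2⟩
      refine ⟨fun i => ?_, fun r => ?_⟩
      · have := h2 i
        simp only [Pi.zero_apply] at this ⊢
        linarith
      · have := h1 r
        simp only [Pi.sub_apply, Pi.add_apply, Matrix.mulVec] at this ⊢
        linarith
    · rintro ⟨h1, h2⟩
      refine ⟨fun r => ?_, fun i => ?_⟩
      · have := h2 r
        simp only [Pi.sub_apply, Pi.add_apply, Matrix.mulVec] at this ⊢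
        linarith
      · have := h1 i
        simp only [Pi.zero_apply] at this ⊢
        linarith
  have hbd : ∀ j, ∃ R, ∀ y ∈ D.Y x, D.cf j ⬝ᵥ y ≤ R := fun j => by
    obtain ⟨R, hR⟩ := exists_abs_dotProduct_le (hD.isCompact_Y hx) (D.cf j)
    exact ⟨R, fun y hy => by rw [dotProduct_comm]; exact (le_abs_self _).trans (hR y hy)⟩
  choose R hR using hbd
  -- The follower maximizes over `y` and over the program of the left tail at once. Compactness of
  -- `Y x` bounds the losses and hence this joint program.
  obtain ⟨y, ν, s, l, t, hy, hp, β, γ, μ, hβ, hd, hcol, hval⟩ :=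
    exists_cvar_optimal (ι := Fin d.dY ⊕ Fin d.n) D.p D.B D.deltaF D.cf (1 / (1 - D.af)) D.ef
      (Sum.elim (fun r => D.F r) (fun i => Pi.single i (-1))) (Sum.elim (D.f - D.L *ᵥ x) 0)
      hD.kf_pos hD.deltaF_nonneg ha hD.ef_nonneg
      (by obtain ⟨y, hy⟩ := hD.Y_nonempty x hx; exact ⟨y, (hG y).2 hy⟩) (∑ j, |R j|)
      (fun y hy j => (hR j y ((hG y).1 hy)).trans ((le_abs_self _).trans
        (Finset.single_le_sum (f := fun j => |R j|) (fun _ _ => abs_nonneg _)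
          (Finset.mem_univ j))))
  -- Splitting `μ` into positive and negative parts makes the sum of the two parts equal to `|μ|`,
  -- so the budget is unchanged. The leader's components play no role here and are set to zero.
  let v : SLVars d :=
    { x := x, y := y, nuL := 0, sL := 0, lamL := 0, tL := 0, nuF := ν, sF := s, lamF := l, tF := t
      muUp := fun k i => max (μ k i) 0, muLo := fun k i => max (-μ k i) 0
      beta := fun r => β (.inl r), gamma := γ }
  have hsub : ∀ k, v.muUp k - v.muLo k = μ k := fun k => by
    funext i
    simp only [v, Pi.sub_apply]
    rcases le_total (μ k i) 0 with h | h
    · rw [max_eq_right h, max_eq_left (by linarith)]; ring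
    · rw [max_eq_left h, max_eq_right (by linarith)]; ring
  have habs : ∀ k i, |(v.muUp k + v.muLo k) i| = |μ k i| := fun k i => by
    simp only [v, Pi.add_apply]
    rcases le_total (μ k i) 0 with h | h
    · rw [max_eq_right h, max_eq_left (by linarith), zero_add, abs_neg]
    · rw [max_eq_left h, max_eq_right (by linarith), add_zero]
  have hnorm : ∀ k, D.p.norm (v.muUp k + v.muLo k) = D.p.norm (μ k) := fun k => by
    cases D.p
    · exact Finset.sum_congr rfl fun i _ => habs k i
    · refine le_antisymm ((Ell.norm_infty_le_iff (Ell.norm_nonneg _ _)).2 fun i => ?_)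
        ((Ell.norm_infty_le_iff (Ell.norm_nonneg _ _)).2 fun i => ?_)
      · rw [habs]; exact norm_le_pi_norm (μ k) i
      · rw [← habs]; exact norm_le_pi_norm (v.muUp k + v.muLo k) i
  have hdual : D.DualFeasible v :=
    { y_col := fun i => by
        -- The multipliers of `-y ≤ 0` become the slack of this column.
        have h1 := congrFun hcol i
        have h2 := hβ (.inr i)
        simp only [hsub, Pi.zero_apply, Pi.add_apply, Pi.sub_apply] at h2 ⊢
        simp only [Fintype.sum_sum_type, Sum.elim_inl, Sum.elim_inr, Pi.sub_apply,
          Finset.sum_apply, Pi.smul_apply, smul_eq_mul, Pi.single_apply] at h1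
        simp at h1
        simp [v, Matrix.mulVec, dotProduct, Finset.sum_apply]
        simp only [mul_comm (D.F _ _)]
        linarith
      nu_col := fun k => by rw [hsub]; exact hd.nu_col k
      gamma_nonneg := hd.gamma_nonneg
      gamma_le := fun k => by
        have := hd.gamma_le k
        rwa [one_div_mul_one_div] at this
      muUp_nonneg := fun k i => le_max_right _ _
      muLo_nonneg := fun k i => le_max_right _ _
      budget := by simp only [hnorm]; exact hd.budget
      gamma_sum := hd.gamma_sum
      beta_nonneg := fun r => hβ _ }
  refine ⟨v, rfl, (primalFeasible_iff v).2 ⟨(hG y).1 hy, hp⟩, hdual, ?_⟩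
  rw [primalObjective_eq]
  refine Eq.trans ?_ hval
  simp [dualObjective, dotProduct, v, Fintype.sum_sum_type, neg_add_eq_sub, mul_comm]

theorem Standing.exists_isDualOptimal (hD : D.Standing) {x : Fin d.m → ℝ} (hx : x ∈ D.X) :
    ∃ v : SLVars d, v.x = x ∧ D.IsDualOptimal v := by
  obtain ⟨v, hvx, hp, hd, heq⟩ := hD.exists_strong_duality hx
  exact ⟨v, hvx, hd, fun v' hd' hx' => heq.trans_le (hd'.primalObjective_le hp hx'.symm)⟩

theorem Standing.lowerSemicontinuous_worstL (hD : D.Standing) : LowerSemicontinuous D.worstL :=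
  lowerSemicontinuous_worstCVaR hD.S_compact hD.cl_mem hD.kl_pos hD.al_pos hD.al_lt hD.el_nonneg

/-- Upper semicontinuity of the follower's objective, which makes the follower's solution set
closed. -/
theorem Standing.isClosed_le_worstF (hD : D.Standing) (r : ℝ) :
    IsClosed {y | r ≤ D.worstF y} := by
  have h := lowerSemicontinuous_iff_isClosed_preimage.1 (lowerSemicontinuous_worstCVaR (p := D.p)
    hD.S_compact hD.cf_mem hD.kf_pos hD.af_pos hD.af_lt hD.ef_nonneg) (-r)
  have h2 := h.preimage (continuous_neg (G := Fin d.n → ℝ))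
  convert h2 using 1
  ext y
  simp only [Set.mem_preimage, Set.mem_Iic, worstF_eq]
  exact le_neg (a := r)

theorem finite_X (D : DRIData d ℝ) : D.X.Finite := by
  refine (Set.Finite.pi' (t := fun _ : Fin d.m => ({0, 1} : Set ℝ)) fun _ =>
    Set.toFinite _).subset fun x hx j => ?_
  simpa using hx.1 j

/-! ### The single-level reformulation -/

/-- A competitor `y`, together with an optimal certificate of its own worst case, is primal feasible
for the same `x`. Weak duality puts its value below the dual objective, which equals the primal
objective of `v` and so is at most the true value of `v.y`. -/
theorem Standing.slFeasible_le (hD : D.Standing) {v : SLVars d} (h : v ∈ D.slFeasible) :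
    (v.x, v.y) ∈ D.bilevelFeasible ∧ D.worstL v.y ≤ D.slObjective v := by
  obtain ⟨hX, hl, hp, hd, heq⟩ := h
  refine ⟨⟨hX, ((primalFeasible_iff v).1 hp).1, fun y hy => ?_⟩, hD.worstL_le hl⟩
  obtain ⟨ν, s, l, t, hp', hval⟩ := exists_worstCVaR_eq (p := D.p) hD.S_compact hD.cf_mem
    hD.kf_pos hD.af_pos hD.af_lt hD.ef_nonneg (-y)
  rw [neg_neg] at hp'
  have h1 := hd.primalObjective_le (v' := { v with y := y, nuF := ν, sF := s, lamF := l, tF := t })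
    ((primalFeasible_iff _).2 ⟨hy, hp'⟩) rfl
  rw [worstF_eq, hval, neg_neg]
  exact h1.trans (heq.trans_le (hD.primalObjective_le_worstF hp))

/-- The follower's dual constraints and objective do not involve `y`, so one optimal dual solution
for `x` certifies every optimal response. Keeping `beta` prescribed is what later allows a bound on
it that is independent of `y`. -/
theorem Standing.exists_extension (hD : D.Standing) {z : (Fin d.m → ℝ) × (Fin d.n → ℝ)}
    (hz : z ∈ D.bilevelFeasible) {vd : SLVars d} (hx : vd.x = z.1) (hvd : D.IsDualOptimal vd) :
    ∃ v ∈ D.slFeasible, (v.x, v.y) = z ∧ v.beta = vd.beta ∧ D.slObjective v = D.worstL z.2 := by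
  obtain ⟨hX, hY, hmax⟩ := hz
  obtain ⟨ν, s, l, t, hp, hval⟩ := exists_worstCVaR_eq (p := D.p) hD.S_compact hD.cf_mem
    hD.kf_pos hD.af_pos hD.af_lt hD.ef_nonneg (-z.2)
  rw [neg_neg] at hp
  obtain ⟨ν', s', l', t', hp', hval'⟩ := exists_worstCVaR_eq (p := D.p) hD.S_compact hD.cl_mem
    hD.kl_pos hD.al_pos hD.al_lt hD.el_nonneg z.2
  let v : SLVars d :=
    { x := z.1, y := z.2, nuL := ν', sL := s', lamL := l', tL := -t'
      nuF := ν, sF := s, lamF := l, tF := t, muUp := vd.muUp, muLo := vd.muLo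
      beta := vd.beta, gamma := vd.gamma }
  have hF := hvd.feasible
  have hdual : D.DualFeasible v := ⟨hF.y_col, hF.nu_col, hF.gamma_nonneg, hF.gamma_le,
    hF.muUp_nonneg, hF.muLo_nonneg, hF.budget, hF.gamma_sum, hF.beta_nonneg⟩
  have hprim : D.PrimalFeasible v := (primalFeasible_iff v).2 ⟨hY, hp⟩
  refine ⟨v, ⟨hX, ?_, hprim, hdual, ?_⟩, rfl, rfl, ?_⟩
  · refine (leaderFeasible_iff hD.kl_pos v).2 ?_
    rw [← neg_neg t'] at hp'
    exact hp'
  · refine le_antisymm ?_ (hdual.primalObjective_le hprim rfl)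
    -- A primal-dual pair `w` for the same `x` links the two sides: dual value of `vd` ≤ dual value
    -- of `w` = primal value of `w` ≤ worst case of `w.y` ≤ worst case of the optimal response.
    obtain ⟨w, hwx, hwp, hwd, hweq⟩ := hD.exists_strong_duality hX
    have e1 : D.dualObjective v = D.dualObjective vd := by simp only [dualObjective, v, hx]
    have e2 : D.primalObjective v = D.worstF z.2 := by
      rw [worstF_eq, hval, neg_neg]; rfl
    have hwY : w.y ∈ D.Y z.1 := by
      rw [← hwx]; exact ((primalFeasible_iff w).1 hwp).1
    rw [e1, e2]
    exact (hvd.le w hwd (hwx.trans hx.symm)).trans (hweq.trans_le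
      ((hD.primalObjective_le_worstF hwp).trans (hmax _ hwY)))
  · rw [slObjective_eq, worstL_eq, hval']
    simp only [v, neg_neg]

theorem Standing.exists_isMin (hD : D.Standing) :
    ∃ z ∈ D.bilevelFeasible, ∀ z' ∈ D.bilevelFeasible, D.worstL z.2 ≤ D.worstL z'.2 := by
  have hne : D.bilevelFeasible.Nonempty := by
    obtain ⟨x, hx⟩ := hD.X_nonempty
    obtain ⟨v, hvx, hp, hd, heq⟩ := hD.exists_strong_duality hx
    obtain ⟨hY, -⟩ := (primalFeasible_iff v).1 hp
    subst hvx
    obtain ⟨ν, s, l, t, hl, -⟩ := exists_worstCVaR_eq (p := D.p) hD.S_compact hD.cl_mem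
      hD.kl_pos hD.al_pos hD.al_lt hD.el_nonneg v.y
    -- A leader's certificate grafted onto a primal-dual pair gives a point of the single-level
    -- problem, hence a feasible pair.
    let w : SLVars d := { v with nuL := ν, sL := s, lamL := l, tL := -t }
    refine ⟨_, (hD.slFeasible_le (v := w) ⟨hx, (leaderFeasible_iff hD.kl_pos w).2 ?_, ?_, ?_,
      heq⟩).1⟩
    · rw [← neg_neg t] at hl
      exact hl
    · exact ⟨hp.system, hp.loss, hp.norm, hp.nu_nonneg, hp.s_nonneg, hp.y_nonneg, hp.lam_nonneg⟩
    · exact ⟨hd.y_col, hd.nu_col, hd.gamma_nonneg, hd.gamma_le, hd.muUp_nonneg, hd.muLo_nonneg,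
        hd.budget, hd.gamma_sum, hd.beta_nonneg⟩
  have hcomp : IsCompact D.bilevelFeasible := by
    -- Finitely many `x`, each with a closed subset of the compact `Y x`.
    have : D.bilevelFeasible = ⋃ x ∈ D.X, {x} ×ˢ (D.Y x ∩ ⋂ y ∈ D.Y x,
        {y' | D.worstF y ≤ D.worstF y'}) := by
      ext ⟨x, y⟩
      simp [bilevelFeasible, and_left_comm]
    rw [this]
    exact D.finite_X.isCompact_biUnion fun x hx => isCompact_singleton.prod
      ((hD.isCompact_Y hx).inter_right (isClosed_biInter fun y _ => hD.isClosed_le_worstF _))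
  have hlsc : LowerSemicontinuous fun z : (Fin d.m → ℝ) × (Fin d.n → ℝ) => D.worstL z.2 :=
    hD.lowerSemicontinuous_worstL.comp continuous_snd
  obtain ⟨z, hz, hmin⟩ := (hlsc.lowerSemicontinuousOn _).exists_isMinOn hne hcomp
  exact ⟨z, hz, fun z' hz' => hmin hz'⟩

/-- The single-level problem is a reformulation of the bilevel problem. -/
theorem Standing.isReformulation_sl (hD : D.Standing) :
    IsReformulation D.bilevelFeasible (fun z => D.worstL z.2) D.slFeasible D.slObjective
      (fun v => (v.x, v.y)) := by
  refine .of_extensions (fun v hv => hD.slFeasible_le hv) (fun z hz => ?_) hD.exists_isMin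
  obtain ⟨vd, hx, hvd⟩ := hD.exists_isDualOptimal hz.1
  obtain ⟨v, hv, hvz, -, hobj⟩ := hD.exists_extension hz hx hvd
  exact ⟨v, hv, hvz, hobj⟩

end DRIData

namespace DRIData

variable {d : Dims} {D : DRIData d ℝ}

/-! ### The mixed-integer linear program -/

/-- The variables of the single-level problem inside of those of the linearized problem. -/
def toSL (z : MVar d → ℝ) : SLVars d where
  x := fun j => z (.x j)
  y := fun i => z (.y i)
  nuL := fun k r => z (.nuL k r)
  sL := fun k => z (.sL k)
  lamL := z .lamL
  tL := z .tL
  nuF := fun k r => z (.nuF k r)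
  sF := fun k => z (.sF k)
  lamF := z .lamF
  tF := z .tF
  muUp := fun k i => z (.muUp k i)
  muLo := fun k i => z (.muLo k i)
  beta := fun r => z (.beta r)
  gamma := fun k => z (.gamma k)

/-- The point of the linearized problem that belongs to a point of the single-level problem. -/
noncomputable def ofSL (D : DRIData d ℝ) (v : SLVars d) : MVar d → ℝ
  | .x j => v.x j
  | .y i => v.y i
  | .nuL k r => v.nuL k r
  | .sL k => v.sL k
  | .lamL => v.lamL
  | .tL => v.tL
  | .uL k i => |(D.Bᵀ *ᵥ v.nuL k - v.y) i|
  | .nuF k r => v.nuF k r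
  | .sF k => v.sF k
  | .lamF => v.lamF
  | .tF => v.tF
  | .uF k i => |(D.Bᵀ *ᵥ v.nuF k + v.y) i|
  | .muUp k i => v.muUp k i
  | .muLo k i => v.muLo k i
  | .tau k => D.p.norm (v.muUp k + v.muLo k)
  | .beta r => v.beta r
  | .gamma k => v.gamma k
  | .w r j => v.beta r * v.x j

@[simp]
theorem coord_dotProduct (i : MVar d) (z : MVar d → ℝ) : coord i ⬝ᵥ z = z i := by
  simp [coord]

theorem mul_sum_mulVec_transpose (B : Matrix (Fin d.dS) (Fin d.n) ℝ) (u : Fin d.dS → ℝ)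
    (i : Fin d.n) : (Bᵀ *ᵥ u) i = ∑ r, B r i * u r := by
  simp [Matrix.mulVec, dotProduct]

/-- The constraints that involve only the variables of the follower's dual program. -/
def isDualCon : MCon d → Bool
  | .yCol _ | .nuCol _ _ | .gammaUpper _ | .normMu _ _ | .budget | .gammaSumLe
  | .gammaSumGe => true
  | _ => false

/-- Only rows free of `x`, `y`, `w` and `M` are used, so the same argument later applies to the
follower's dual polyhedron on its own. -/
theorem dualFeasible_of_rows {M : ℝ} {z : MVar d → ℝ} (hz : ∀ i, i ≠ .tL → i ≠ .tF → 0 ≤ z i)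
    (h : ∀ r, isDualCon r = true → D.milpRow M r ⬝ᵥ z ≤ D.milpRhs M r) :
    D.DualFeasible (toSL z) where
  y_col := fun i => by
    have := h (.yCol i) rfl
    simp [milpRow, milpRhs, sum_dotProduct] at this
    simp [toSL, Matrix.mulVec, dotProduct, Finset.sum_apply]
    simp only [mul_comm (z (.gamma _))]
    linarith
  nu_col := fun k r => by
    have := h (.nuCol k r) rfl
    simp [milpRow, milpRhs, sum_dotProduct] at this
    simp [toSL, Matrix.mulVec, dotProduct]
    rw [mul_comm]
    linarith
  gamma_nonneg := fun k => hz _ (by simp) (by simp)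
  gamma_le := fun k => by
    have := h (.gammaUpper k) rfl
    rwa [milpRow, milpRhs, coord_dotProduct] at this
  muUp_nonneg := fun k i => hz _ (by simp) (by simp)
  muLo_nonneg := fun k i => hz _ (by simp) (by simp)
  budget := by
    have hb : ∑ k, z (.tau k) ≤ 1 / (1 - D.af) * D.ef := by
      simpa [milpRow, milpRhs, sum_dotProduct] using h .budget rfl
    refine le_trans (Finset.sum_le_sum fun k _ => ?_) hb
    have htau : 0 ≤ z (.tau k) := hz _ (by simp) (by simp)
    have h1 := fun i => h (.normMu k i) rfl
    have hup : ∀ i, 0 ≤ z (.muUp k i) := fun i => hz _ (by simp) (by simp)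
    have hlo : ∀ i, 0 ≤ z (.muLo k i) := fun i => hz _ (by simp) (by simp)
    rcases hp : D.p with _ | _
    · simp only [Ell.norm_one_eq, Pi.add_apply]
      simp only [abs_of_nonneg (add_nonneg (hup _) (hlo _)), toSL]
      -- The rows `normMu` are indexed by coordinates; for `n = 0` there are none, and `tau ≥ 0`
      -- takes their place.
      rcases isEmpty_or_nonempty (Fin d.n) with he | ⟨⟨i⟩⟩
      · simpa using htau
      · have := h1 i
        simp [milpRow, milpRhs, sum_dotProduct, hp, Finset.sum_add_distrib] at this
        simp only [Finset.sum_add_distrib]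
        linarith
    · refine (Ell.norm_infty_le_iff htau).2 fun i => ?_
      have := h1 i
      simp [milpRow, milpRhs, hp] at this
      rw [Pi.add_apply]
      simp only [toSL, abs_of_nonneg (add_nonneg (hup _) (hlo _))]
      linarith
  gamma_sum := by
    have h1 := h .gammaSumLe rfl
    have h2 := h .gammaSumGe rfl
    simp [milpRow, milpRhs, sum_dotProduct] at h1 h2
    exact le_antisymm h1 h2
  beta_nonneg := fun r => hz _ (by simp) (by simp)

theorem DualFeasible.rows_le {v : SLVars d} (h : D.DualFeasible v) (M : ℝ) {r : MCon d}
    (hr : isDualCon r = true) : D.milpRow M r ⬝ᵥ D.ofSL v ≤ D.milpRhs M r := by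
  cases r <;> simp [isDualCon] at hr <;> simp [milpRow, milpRhs, sum_dotProduct, ofSL]
  case yCol i =>
    have := h.y_col i
    simp [Matrix.mulVec, dotProduct, Finset.sum_apply] at this
    simp only [mul_comm (v.gamma _)] at this
    linarith
  case nuCol k r =>
    have := h.nu_col k r
    simp [Matrix.mulVec, dotProduct] at this
    rw [mul_comm] at this
    linarith
  case gammaUpper k => simpa using h.gamma_le k
  case normMu k i =>
    have hup := h.muUp_nonneg k
    have hlo := h.muLo_nonneg k
    rcases hp : D.p with _ | _
    · simp only [Ell.norm_one_eq, Pi.add_apply, abs_of_nonneg (add_nonneg (hup _) (hlo _))]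
      simp [sum_dotProduct, ofSL]
    · simpa [Ell.norm, ofSL] using (le_abs_self _).trans (norm_le_pi_norm (v.muUp k + v.muLo k) i)
  case budget => simpa using h.budget
  case gammaSumLe => exact h.gamma_sum.le
  case gammaSumGe => exact h.gamma_sum.ge

theorem objective_milp (M : ℝ) (z : MVar d → ℝ) :
    (D.milp M).objective z = D.slObjective (toSL z) := by
  simp [MILP.objective, milp, slObjective, toSL, sum_dotProduct, mul_add]

theorem gapRow_dotProduct (z : MVar d → ℝ) (hw : ∀ r j, z (.w r j) = z (.beta r) * z (.x j)) :
    D.gapRow ⬝ᵥ z = D.dualObjective (toSL z) - D.primalObjective (toSL z) := by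
  simp only [gapRow, dualObjective, primalObjective, toSL, sum_dotProduct, sub_dotProduct, add_dotProduct,
      neg_dotProduct, smul_dotProduct, smul_eq_mul, coord_dotProduct, hw]
  rw [neg_add_eq_sub]
  simp only [dotProduct, Matrix.mulVec, Finset.sum_mul]
  have : ∀ r j, D.L r j * (z (.beta r) * z (.x j)) = D.L r j * z (.x j) * z (.beta r) :=
    fun r j => by ring
  simp only [this]

/-- The maximum norm and the sum norm through their linear descriptions. -/
theorem norm_le_of_rows {n : ℕ} (p : Ell) {e u : Fin n → ℝ} {l : ℝ} (hl : 0 ≤ l)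
    (hpos : ∀ i, e i ≤ u i) (hneg : ∀ i, -e i ≤ u i)
    (hu : ∀ _ : Fin n, p = .infty → ∑ i, u i ≤ l)
    (hu' : ∀ i : Fin n, p = .one → u i ≤ l) : p.conj.norm e ≤ l := by
  have habs : ∀ i, |e i| ≤ u i := fun i => abs_le'.2 ⟨hpos i, hneg i⟩
  cases p
  · exact (Ell.norm_infty_le_iff hl).2 fun i => (habs i).trans (hu' i rfl)
  · rcases isEmpty_or_nonempty (Fin n) with he | ⟨⟨i⟩⟩
    · simpa [Ell.conj, Ell.norm] using hl
    · exact (Finset.sum_le_sum fun i _ => habs i).trans (hu i rfl)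

/-- This holds for every `M`: a constant that is too small removes points but never creates false
ones. -/
theorem toSL_mem_slFeasible {M : ℝ} {z : MVar d → ℝ}
    (hz : z ∈ (D.milp M).feasible) : toSL z ∈ D.slFeasible := by
  obtain ⟨hA, hint⟩ := hz
  have hrow : ∀ r, D.milpRow M r ⬝ᵥ z ≤ D.milpRhs M r := hA
  have hnn : ∀ i, i ≠ .tL → i ≠ .tF → 0 ≤ z i := by
    intro i h1 h2
    have := hrow (.nonneg i)
    cases i <;> simp [milpRow, milpRhs] at this h1 h2 ⊢ <;> linarith
  have hx : ∀ j, z (.x j) = 0 ∨ z (.x j) = 1 := by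
    intro j
    obtain ⟨a, ha⟩ := hint (.x j) ⟨j, rfl⟩
    have h1 : z (.x j) ≤ 1 := by simpa [milpRow, milpRhs] using hrow (.xUpper j)
    have h0 := hnn (.x j) (by simp) (by simp)
    rw [ha] at h0 h1 ⊢
    have h0' : 0 ≤ a := by exact_mod_cast h0
    have h1' : a ≤ 1 := by exact_mod_cast h1
    have : a = 0 ∨ a = 1 := by omega
    exact_mod_cast this
  -- At `x j = 0` the rows `prodX` and `nonneg` give `w = 0`; at `x j = 1` the rows `prodBeta` and
  -- `prodLower` give `w = beta`, with `M` cancelling.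
  have hw : ∀ r j, z (.w r j) = z (.beta r) * z (.x j) := by
    intro r j
    have h1 := hrow (.prodBeta r j)
    have h2 := hrow (.prodX r j)
    have h3 := hrow (.prodLower r j)
    have h4 := hnn (.w r j) (by simp) (by simp)
    simp [milpRow, milpRhs] at h1 h2 h3
    rcases hx j with h | h <;> rw [h] at h2 h3 ⊢ <;> linarith
  refine ⟨⟨hx, fun r => ?_⟩, ⟨fun k => ?_, fun k => ?_, fun k r => ?_, fun k => ?_⟩,
    ⟨fun r => ?_, fun k => ?_, fun k => ?_, fun k r => ?_, fun k => ?_, fun i => ?_, ?_⟩,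
    dualFeasible_of_rows hnn fun r _ => hrow r, ?_⟩
  · have := hrow (.xSystem r)
    simp only [milpRow, milpRhs, sum_dotProduct, smul_dotProduct, smul_eq_mul,
      coord_dotProduct] at this
    exact this
  · have := hrow (.lossL k)
    simp [milpRow, milpRhs, sum_dotProduct] at this
    simp [toSL, dotProduct]
    linarith
  · refine norm_le_of_rows D.p (u := fun i => z (.uL k i)) (hnn .lamL (by simp) (by simp))
      (fun i => ?_) (fun i => ?_) (fun i hp => ?_) (fun i hp => ?_)
    · have := hrow (.absPosL k i)
      simp [milpRow, milpRhs, sum_dotProduct] at this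
      rw [Pi.sub_apply, mul_sum_mulVec_transpose]
      simp only [toSL]
      linarith
    · have := hrow (.absNegL k i)
      simp [milpRow, milpRhs, sum_dotProduct] at this
      rw [Pi.sub_apply, mul_sum_mulVec_transpose]
      simp only [toSL]
      linarith
    · have := hrow (.normL k i)
      simp only [milpRow, milpRhs, hp, sub_dotProduct, sum_dotProduct, coord_dotProduct,
        sub_nonpos] at this
      exact this
    · have := hrow (.normL k i)
      simp only [milpRow, milpRhs, hp, sub_dotProduct, coord_dotProduct, sub_nonpos] at this
      exact this
  · exact hnn _ (by simp) (by simp)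
  · exact hnn _ (by simp) (by simp)
  · have := hrow (.ySystem r)
    simp [milpRow, milpRhs, sum_dotProduct] at this
    simp [toSL, Matrix.mulVec, dotProduct]
    linarith
  · have := hrow (.lossF k)
    simp [milpRow, milpRhs, sum_dotProduct] at this
    simp [toSL, dotProduct]
    linarith
  · refine norm_le_of_rows D.p (u := fun i => z (.uF k i)) (hnn .lamF (by simp) (by simp))
      (fun i => ?_) (fun i => ?_) (fun i hp => ?_) (fun i hp => ?_)
    · have := hrow (.absPosF k i)
      simp [milpRow, milpRhs, sum_dotProduct] at this
      rw [Pi.add_apply, mul_sum_mulVec_transpose]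
      simp only [toSL]
      linarith
    · have := hrow (.absNegF k i)
      simp [milpRow, milpRhs, sum_dotProduct] at this
      rw [Pi.add_apply, mul_sum_mulVec_transpose]
      simp only [toSL]
      linarith
    · have := hrow (.normF k i)
      simp only [milpRow, milpRhs, hp, sub_dotProduct, sum_dotProduct, coord_dotProduct,
        sub_nonpos] at this
      exact this
    · have := hrow (.normF k i)
      simp only [milpRow, milpRhs, hp, sub_dotProduct, coord_dotProduct, sub_nonpos] at this
      exact this
  · exact hnn _ (by simp) (by simp)
  · exact hnn _ (by simp) (by simp)
  · exact hnn _ (by simp) (by simp)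
  · exact hnn _ (by simp) (by simp)
  · have h1 := hrow .dualityLe
    have h2 := hrow .dualityGe
    simp only [milpRow, milpRhs, neg_dotProduct, gapRow_dotProduct z hw] at h1 h2
    linarith

/-- The size of `M` matters only in `prodX` and `prodLower`, where the bound on `beta` is multiplied
by `x j` and by `1 - x j`. -/
theorem ofSL_mem_feasible (hk : 0 < d.kl) {M : ℝ} {v : SLVars d} (hv : v ∈ D.slFeasible)
    (hM : ∀ r, v.beta r ≤ M) : D.ofSL v ∈ (D.milp M).feasible := by
  obtain ⟨hX, hL, hP, hDu, heq⟩ := hv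
  have hx0 : ∀ j, 0 ≤ v.x j := fun j => by rcases hX.1 j with h | h <;> simp [h]
  have hx1 : ∀ j, v.x j ≤ 1 := fun j => by rcases hX.1 j with h | h <;> simp [h]
  have hw : ∀ r j, D.ofSL v (.w r j) = D.ofSL v (.beta r) * D.ofSL v (.x j) := fun r j => rfl
  have hgap : D.gapRow ⬝ᵥ D.ofSL v = 0 := by
    rw [gapRow_dotProduct _ hw, sub_eq_zero]
    exact heq
  refine ⟨fun r => ?_, ?_⟩
  · change D.milpRow M r ⬝ᵥ D.ofSL v ≤ D.milpRhs M r
    by_cases hr : isDualCon r = true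
    · exact hDu.rows_le M hr
    cases r with
    | nonneg i =>
      cases i with
      | tL => simp [milpRow, milpRhs]
      | tF => simp [milpRow, milpRhs]
      | x j => simpa [milpRow, milpRhs, ofSL] using hx0 j
      | y i => simpa [milpRow, milpRhs, ofSL] using hP.y_nonneg i
      | nuL k r => simpa [milpRow, milpRhs, ofSL] using hL.nu_nonneg k r
      | sL k => simpa [milpRow, milpRhs, ofSL] using hL.s_nonneg k
      | lamL => simpa [milpRow, milpRhs, ofSL] using
          (D.p.conj.norm_nonneg _).trans (hL.norm ⟨0, hk⟩)
      | uL k i => simp [milpRow, milpRhs, ofSL]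
      | nuF k r => simpa [milpRow, milpRhs, ofSL] using hP.nu_nonneg k r
      | sF k => simpa [milpRow, milpRhs, ofSL] using hP.s_nonneg k
      | lamF => simpa [milpRow, milpRhs, ofSL] using hP.lam_nonneg
      | uF k i => simp [milpRow, milpRhs, ofSL]
      | muUp k i => simpa [milpRow, milpRhs, ofSL] using hDu.muUp_nonneg k i
      | muLo k i => simpa [milpRow, milpRhs, ofSL] using hDu.muLo_nonneg k i
      | tau k => simpa [milpRow, milpRhs, ofSL] using D.p.norm_nonneg _
      | beta r => simpa [milpRow, milpRhs, ofSL] using hDu.beta_nonneg r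
      | gamma k => simpa [milpRow, milpRhs, ofSL] using hDu.gamma_nonneg k
      | w r j => simpa [milpRow, milpRhs, ofSL] using mul_nonneg (hDu.beta_nonneg r) (hx0 j)
    | xUpper j => simpa [milpRow, milpRhs, ofSL] using hx1 j
    | xSystem r =>
      simp only [milpRow, milpRhs, sum_dotProduct, smul_dotProduct, smul_eq_mul, coord_dotProduct]
      exact hX.2 r
    | lossL k =>
      have := hL.loss k
      simp [dotProduct] at this
      simp [milpRow, milpRhs, sum_dotProduct, ofSL]
      linarith
    | absPosL k i =>
      have := le_abs_self ((D.Bᵀ *ᵥ v.nuL k - v.y) i)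
      simp only [milpRow, milpRhs, sum_dotProduct, sub_dotProduct, smul_dotProduct, smul_eq_mul,
        coord_dotProduct, ofSL]
      rw [Pi.sub_apply, mul_sum_mulVec_transpose] at this ⊢
      linarith
    | absNegL k i =>
      have := neg_abs_le ((D.Bᵀ *ᵥ v.nuL k - v.y) i)
      simp only [milpRow, milpRhs, sum_dotProduct, sub_dotProduct, smul_dotProduct, smul_eq_mul,
        neg_dotProduct, coord_dotProduct, ofSL]
      rw [Pi.sub_apply, mul_sum_mulVec_transpose] at this ⊢
      linarith
    | normL k i =>
      have h := hL.norm k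
      simp only [milpRow, milpRhs, sub_dotProduct, sub_nonpos, coord_dotProduct]
      rcases hp : D.p with _ | _ <;> rw [hp] at h <;>
        simp only [sum_dotProduct, coord_dotProduct, ofSL]
      · exact (norm_le_pi_norm _ i).trans h
      · exact h
    | ySystem r =>
      have := hP.system r
      simp [Matrix.mulVec, dotProduct] at this
      simp [milpRow, milpRhs, sum_dotProduct, ofSL]
      linarith
    | lossF k =>
      have := hP.loss k
      simp [dotProduct] at this
      simp [milpRow, milpRhs, sum_dotProduct, ofSL]
      linarith
    | absPosF k i =>
      have := le_abs_self ((D.Bᵀ *ᵥ v.nuF k + v.y) i)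
      simp only [milpRow, milpRhs, sum_dotProduct, sub_dotProduct, add_dotProduct,
        smul_dotProduct, smul_eq_mul, coord_dotProduct, ofSL]
      rw [Pi.add_apply, mul_sum_mulVec_transpose] at this ⊢
      linarith
    | absNegF k i =>
      have := neg_abs_le ((D.Bᵀ *ᵥ v.nuF k + v.y) i)
      simp only [milpRow, milpRhs, sum_dotProduct, sub_dotProduct, add_dotProduct,
        smul_dotProduct, smul_eq_mul, neg_dotProduct, coord_dotProduct, ofSL]
      rw [Pi.add_apply, mul_sum_mulVec_transpose] at this ⊢
      linarith
    | normF k i =>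
      have h := hP.norm k
      simp only [milpRow, milpRhs, sub_dotProduct, sub_nonpos, coord_dotProduct]
      rcases hp : D.p with _ | _ <;> rw [hp] at h <;>
        simp only [sum_dotProduct, coord_dotProduct, ofSL]
      · exact (norm_le_pi_norm _ i).trans h
      · exact h
    | dualityLe => simp [milpRow, milpRhs, hgap]
    | dualityGe => simp [milpRow, milpRhs, hgap]
    | prodBeta r j =>
      have := mul_le_mul_of_nonneg_left (hx1 j) (hDu.beta_nonneg r)
      simp [milpRow, milpRhs, ofSL] at this ⊢
      linarith
    | prodX r j =>
      have := mul_le_mul_of_nonneg_right (hM r) (hx0 j)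
      simp [milpRow, milpRhs, ofSL] at this ⊢
      linarith
    | prodLower r j =>
      have := mul_le_mul_of_nonneg_right (hM r) (sub_nonneg.2 (hx1 j))
      simp [milpRow, milpRhs, ofSL] at this ⊢
      linarith
    | yCol _ | nuCol _ _ | gammaUpper _ | normMu _ _ | budget | gammaSumLe | gammaSumGe =>
      exact absurd rfl hr
  · rintro _ ⟨j, rfl⟩
    rcases hX.1 j with h | h
    · exact ⟨0, by simp [ofSL, h]⟩
    · exact ⟨1, by simp [ofSL, h]⟩

/-- The mixed-integer program is a reformulation of the bilevel problem if `M` bounds some optimal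
solution of the follower's dual program, for each `x`. -/
theorem Standing.isReformulation_milp (hD : D.Standing) {M : ℝ}
    (hM : ∀ x ∈ D.X, ∃ v : SLVars d, v.x = x ∧ D.IsDualOptimal v ∧ ∀ r, v.beta r ≤ M) :
    IsReformulation D.bilevelFeasible (fun z => D.worstL z.2) (D.milp M).feasible
      (D.milp M).objective MVar.pair := by
  refine .of_extensions (fun z hz => ?_) (fun e he => ?_) hD.exists_isMin
  · have h := toSL_mem_slFeasible hz
    rw [objective_milp]
    exact hD.slFeasible_le h
  · obtain ⟨vd, hx, hvd, hb⟩ := hM e.1 he.1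
    obtain ⟨v, hv, hve, hbeta, hobj⟩ := hD.exists_extension he hx hvd
    refine ⟨D.ofSL v, ofSL_mem_feasible hD.kl_pos hv (by rw [hbeta]; exact hb), hve, ?_⟩
    rw [objective_milp]
    exact hobj

/-- One optimal dual solution is chosen for each of the finitely many `x`, and all their entries
`|beta r|` are added up. -/
theorem Standing.exists_bigM (hD : D.Standing) :
    ∃ M₀ : ℝ, ∀ M : ℝ, M₀ ≤ M →
      IsReformulation D.bilevelFeasible (fun z => D.worstL z.2)
        (D.milp M).feasible (D.milp M).objective MVar.pair := by
  obtain ⟨x₀, hx₀⟩ := hD.X_nonempty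
  have : Nonempty (SLVars d) := ⟨(hD.exists_isDualOptimal hx₀).choose⟩
  choose! v hvx hv using fun x (hx : x ∈ D.X) => hD.exists_isDualOptimal hx
  refine ⟨∑ x ∈ D.finite_X.toFinset, ∑ r, |(v x).beta r|, fun M hM =>
    hD.isReformulation_milp fun x hx => ⟨v x, hvx x hx, hv x hx, fun r => ?_⟩⟩
  refine (le_abs_self _).trans (le_trans ?_ hM)
  refine (Finset.single_le_sum (f := fun r => |(v x).beta r|) (fun _ _ => abs_nonneg _)
    (Finset.mem_univ r)).trans ?_
  exact Finset.single_le_sum (f := fun x => ∑ r, |(v x).beta r|)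
    (fun _ _ => Finset.sum_nonneg fun _ _ => abs_nonneg _) (D.finite_X.mem_toFinset.2 hx)

end DRIData

/-! ### The size of basic solutions -/

section BasicSolutions

/-- A solution of a linear system with integer coefficients and linearly independent columns is
small. -/
theorem abs_le_of_independent_columns {C J : Type*} [Fintype C] [Fintype J]
    (A : Matrix C J ℤ) (b : C → ℤ) {N h : ℕ} (hJ : Fintype.card J ≤ N) (hC : Fintype.card C ≤ N)
    (hA : ∀ r j, |A r j| ≤ 2 ^ h) (hb : ∀ r, |b r| ≤ 2 ^ h)
    (hinj : ∀ u : J → ℝ, A.map (Int.cast : ℤ → ℝ) *ᵥ u = 0 → u = 0) (z : J → ℝ)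
    (hz : A.map (Int.cast : ℤ → ℝ) *ᵥ z = fun r => (b r : ℝ)) (j : J) :
    |z j| ≤ 2 ^ (N + N ^ 2 + (N + 1) * (N + 2 * h)) := by
  classical
  let Ar : Matrix C J ℝ := A.map (Int.cast : ℤ → ℝ)
  -- The Gram matrix makes the selection of a non-singular square submatrix unnecessary: it is
  -- integral and invertible, and Cramer's rule gives `det G * z = adj G * Aᵀ b`. As `|det G| ≥ 1`,
  -- the right-hand side bounds `z`.
  let G : Matrix J J ℤ := Aᵀ * A
  have hGr : G.map (Int.cast : ℤ → ℝ) = Arᵀ * Ar := by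
    ext i j
    simp [G, Ar, Matrix.mul_apply]
  have hdet : G.det ≠ 0 := by
    intro h0
    have h1 : (G.map (Int.cast : ℤ → ℝ)).det = 0 := by
      have := RingHom.map_det (Int.castRingHom ℝ) G
      rw [h0, map_zero] at this
      exact this.symm
    obtain ⟨v, hv, hGv⟩ := Matrix.exists_mulVec_eq_zero_iff.2 h1
    rw [hGr] at hGv
    have hker : v ∈ LinearMap.ker (Arᵀ * Ar).mulVecLin := by
      rw [LinearMap.mem_ker, Matrix.mulVecLin_apply]
      exact hGv
    rw [Matrix.ker_mulVecLin_transpose_mul_self] at hker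
    exact hv (hinj v (by simpa using hker))
  let m : J → ℤ := G.adjugate *ᵥ (Aᵀ *ᵥ b)
  have hm : (G.det : ℝ) * z j = m j := by
    have h1 : (Arᵀ * Ar) *ᵥ z = Arᵀ *ᵥ fun r => (b r : ℝ) := by
      rw [← Matrix.mulVec_mulVec]; congr 1
    have h2 : (G.adjugate.map (Int.cast : ℤ → ℝ)) *ᵥ ((G.map (Int.cast : ℤ → ℝ)) *ᵥ z) =
        (G.adjugate.map (Int.cast : ℤ → ℝ)) *ᵥ (Arᵀ *ᵥ fun r => (b r : ℝ)) := by
      rw [hGr, h1]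
    have h3 : (G.adjugate.map (Int.cast : ℤ → ℝ)) * (G.map (Int.cast : ℤ → ℝ)) =
        (G.det : ℝ) • 1 := by
      ext i j
      have := congrArg (Int.cast : ℤ → ℝ) (congrFun (congrFun G.adjugate_mul i) j)
      simp only [Matrix.mul_apply, Matrix.smul_apply, Matrix.one_apply, Matrix.map_apply,
        smul_eq_mul, mul_ite, mul_one, mul_zero, Int.cast_ite, Int.cast_zero] at this ⊢
      rw [← this]
      push_cast
      rfl
    rw [Matrix.mulVec_mulVec, h3, Matrix.smul_mulVec, Matrix.one_mulVec] at h2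
    have h4 := congrFun h2 j
    simp only [Pi.smul_apply, smul_eq_mul] at h4
    rw [h4]
    simp only [m, Matrix.mulVec, dotProduct, Ar, Matrix.map_apply, Matrix.transpose_apply]
    push_cast
    rfl
  -- Entries of `G` and of `Aᵀ b` are sums of at most `N ≤ 2 ^ N` products of two numbers up to `2 ^
  -- h`.
  have hE : ∀ (f g : C → ℤ), (∀ r, |f r| ≤ 2 ^ h) → (∀ r, |g r| ≤ 2 ^ h) →
      |∑ r, f r * g r| ≤ 2 ^ (N + 2 * h) := by
    intro f g hf hg
    refine (Finset.abs_sum_le_sum_abs _ _).trans ?_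
    have : ∀ r ∈ Finset.univ, |f r * g r| ≤ (2 : ℤ) ^ (2 * h) := fun r _ => by
      rw [abs_mul, two_mul, pow_add]
      exact mul_le_mul (hf r) (hg r) (abs_nonneg _) (by positivity)
    refine (Finset.sum_le_sum this).trans ?_
    rw [Finset.sum_const, Finset.card_univ, nsmul_eq_mul, pow_add]
    refine mul_le_mul_of_nonneg_right ?_ (by positivity)
    have h1 : Fintype.card C ≤ 2 ^ N := hC.trans Nat.lt_two_pow_self.le
    exact_mod_cast h1
  have hG : ∀ i j, |G i j| ≤ 2 ^ (N + 2 * h) := fun i j => by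
    simp only [G, Matrix.mul_apply, Matrix.transpose_apply]
    exact hE _ _ (fun r => hA r i) (fun r => hA r j)
  -- A determinant of order at most `N` with entries up to `2 ^ (N + 2 * h)`, where `N! ≤ 2 ^ (N ^
  -- 2)`.
  have hadj : ∀ i j, |G.adjugate i j| ≤ 2 ^ (N ^ 2 + N * (N + 2 * h)) := fun i j => by
    rw [Matrix.adjugate_apply]
    have h1 := Matrix.det_le (A := G.updateRow j (Pi.single i (1 : ℤ))) (abv := (AbsoluteValue.abs : AbsoluteValue ℤ ℤ))
      (x := (2 : ℤ) ^ (N + 2 * h)) (fun i' j' => by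
        simp only [AbsoluteValue.abs_apply, Matrix.updateRow_apply]
        split_ifs
        · rw [Pi.single_apply]
          split_ifs
          · rw [abs_one]; exact one_le_pow₀ (by norm_num)
          · rw [abs_zero]; positivity
        · exact hG _ _)
    simp only [AbsoluteValue.abs_apply, nsmul_eq_mul] at h1
    refine h1.trans ?_
    rw [pow_add _ (N ^ 2)]
    have h0 : (0 : ℤ) ≤ (2 ^ (N + 2 * h)) ^ Fintype.card J := by positivity
    have h0' : (0 : ℤ) ≤ 2 ^ (N ^ 2) := by positivity
    refine mul_le_mul ?_ ?_ h0 h0'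
    · have h2 : (Fintype.card J).factorial ≤ 2 ^ (N ^ 2) := by
        refine (Nat.factorial_le hJ).trans ((Nat.factorial_le_pow N).trans ?_)
        rw [pow_two, pow_mul]
        exact Nat.pow_le_pow_left Nat.lt_two_pow_self.le N
      exact_mod_cast h2
    · rw [← pow_mul, mul_comm]
      exact pow_le_pow_right₀ (by norm_num) (Nat.mul_le_mul_right _ hJ)
  have hmj : |m j| ≤ 2 ^ (N + N ^ 2 + (N + 1) * (N + 2 * h)) := by
    simp only [m, Matrix.mulVec, dotProduct]
    refine (Finset.abs_sum_le_sum_abs _ _).trans ?_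
    have : ∀ i ∈ Finset.univ, |G.adjugate j i * ∑ r, Aᵀ i r * b r| ≤
        (2 : ℤ) ^ (N ^ 2 + N * (N + 2 * h)) * 2 ^ (N + 2 * h) := fun i _ => by
      rw [abs_mul]
      exact mul_le_mul (hadj j i) (hE _ _ (fun r => hA r i) hb) (abs_nonneg _) (by positivity)
    refine (Finset.sum_le_sum this).trans ?_
    rw [Finset.sum_const, Finset.card_univ, nsmul_eq_mul, ← pow_add]
    have h1 : Fintype.card J ≤ 2 ^ N := hJ.trans Nat.lt_two_pow_self.le
    have h2 : (Fintype.card J : ℤ) ≤ 2 ^ N := by exact_mod_cast h1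
    refine (mul_le_mul_of_nonneg_right h2 (by positivity)).trans (le_of_eq ?_)
    rw [← pow_add]
    congr 1
    ring
  have hd1 : (1 : ℝ) ≤ |(G.det : ℝ)| := by
    have := Int.one_le_abs hdet
    exact_mod_cast this
  calc |z j| ≤ |(G.det : ℝ)| * |z j| := le_mul_of_one_le_left (abs_nonneg _) hd1
    _ = |(m j : ℝ)| := by rw [← abs_mul, hm]
    _ ≤ _ := by exact_mod_cast hmj

/-- A linear program over `{z ≥ 0 | A z ≤ b}` with integer `A` and `b` has a small optimal
solution, if it has any. -/
theorem exists_small_minimizer_int {C V : Type*} [Fintype C] [Fintype V] (A : Matrix C V ℤ)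
    (b : C → ℤ) {N h : ℕ} (hN : Fintype.card V + Fintype.card C ≤ N)
    (hA : ∀ r j, |A r j| ≤ 2 ^ h) (hb : ∀ r, |b r| ≤ 2 ^ h) (l : V → ℝ) (z₀ : V → ℝ)
    (h₀ : 0 ≤ z₀) (hz₀ : A.map (Int.cast : ℤ → ℝ) *ᵥ z₀ ≤ fun r => (b r : ℝ))
    (hmin : ∀ z, 0 ≤ z → (A.map (Int.cast : ℤ → ℝ) *ᵥ z ≤ fun r => (b r : ℝ)) →
      l ⬝ᵥ z₀ ≤ l ⬝ᵥ z) :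
    ∃ z, 0 ≤ z ∧ (A.map (Int.cast : ℤ → ℝ) *ᵥ z ≤ fun r => (b r : ℝ)) ∧ l ⬝ᵥ z = l ⬝ᵥ z₀ ∧
      ∀ i, z i ≤ 2 ^ (N + N ^ 2 + (N + 1) * (N + 2 * h)) := by
  classical
  -- Slack variables turn the inequalities into equations in non-negative unknowns, the form to
  -- which `exists_basic_minimizer` applies.
  let A' : Matrix C (V ⊕ C) ℤ := Matrix.fromCols A 1
  let Ar : Matrix C (V ⊕ C) ℝ := A'.map (Int.cast : ℤ → ℝ)
  have hAr : ∀ w : V ⊕ C → ℝ, Ar *ᵥ w =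
      A.map (Int.cast : ℤ → ℝ) *ᵥ (fun i => w (.inl i)) + fun r => w (.inr r) := by
    intro w
    funext r
    simp [Ar, A', Matrix.mulVec, dotProduct, Fintype.sum_sum_type, Matrix.one_apply]
  let T := Ar.mulVecLin
  let L : (V ⊕ C → ℝ) →ₗ[ℝ] ℝ := IsLinearMap.mk' (fun w => l ⬝ᵥ fun i => w (.inl i))
    ⟨fun u w => dotProduct_add _ _ _, fun r w => dotProduct_smul _ _ _⟩
  let w₀ : V ⊕ C → ℝ := Sum.elim z₀ fun r => b r - (A.map (Int.cast : ℤ → ℝ) *ᵥ z₀) r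
  have hTw₀ : T w₀ = fun r => (b r : ℝ) := by
    simp only [T, Matrix.mulVecLin_apply, hAr, w₀]
    funext r
    simp
  obtain ⟨w, hw, hTw, hLw, hbas⟩ := exists_basic_minimizer T L w₀
    (by
      rintro (i | r)
      · exact h₀ i
      · exact sub_nonneg.2 (hz₀ r))
    (by
      intro w hw hTw
      refine hmin _ (fun i => hw (.inl i)) fun r => ?_
      rw [hTw₀] at hTw
      have h1 : T w = Ar *ᵥ w := rfl
      rw [h1, hAr] at hTw
      have h2 := congrFun hTw r
      have h3 := hw (.inr r)
      simp only [Pi.add_apply, Pi.zero_apply] at h2 h3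
      linarith)
  rw [hTw₀] at hTw
  have hTw' : Ar *ᵥ w = fun r => (b r : ℝ) := hTw
  refine ⟨fun i => w (.inl i), fun i => hw _, fun r => ?_, hLw, fun i => ?_⟩
  · rw [hAr] at hTw'
    have h2 := congrFun hTw' r
    have h3 := hw (.inr r)
    simp only [Pi.add_apply, Pi.zero_apply] at h2 h3
    linarith
  · by_cases hi : w (.inl i) = 0
    · change w (.inl i) ≤ _
      rw [hi]; positivity
    -- The columns on the support of a basic minimizer are independent, and the minimizer solves the
    -- system restricted to them.
    let J := {j : V ⊕ C // w j ≠ 0}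
    have hext : ∀ (u : V ⊕ C → ℝ), (∀ j, w j = 0 → u j = 0) →
        (A'.submatrix id (Subtype.val : J → V ⊕ C)).map (Int.cast : ℤ → ℝ) *ᵥ
          (fun j : J => u j) = Ar *ᵥ u := by
      intro u hu
      funext r
      simp only [Matrix.mulVec, dotProduct, Matrix.map_apply, Matrix.submatrix_apply, id, Ar]
      have h1 := Finset.sum_subtype (F := inferInstanceAs (Fintype J)) (Finset.univ.filter fun j => w j ≠ 0)
        (p := fun j => w j ≠ 0) (by simp) (fun j => (A' r j : ℝ) * u j)
      refine h1.symm.trans (Finset.sum_filter_of_ne fun j _ hj hwj => ?_)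
      exact hj (by rw [hu j hwj, mul_zero])
    have := abs_le_of_independent_columns (A'.submatrix id (Subtype.val : J → V ⊕ C)) b
      (N := N) (h := h)
      ((Fintype.card_subtype_le _).trans (by rw [Fintype.card_sum]; exact hN))
      (le_of_add_le_right hN) (by
        rintro r ⟨j | r', hj⟩
        · exact hA r j
        · simp only [Matrix.submatrix_apply, id, A', Matrix.fromCols_apply_inr, Matrix.one_apply]
          split_ifs
          · rw [abs_one]; exact one_le_pow₀ (by norm_num)
          · rw [abs_zero]; positivity) hb (by
        intro u hu
        let u' : V ⊕ C → ℝ := fun j => if hj : w j ≠ 0 then u ⟨j, hj⟩ else 0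
        have hu' : (fun j : J => u' j) = u := by
          funext j
          simp [u', j.2]
        have h1 := hext u' (fun j hj => by simp [u', hj])
        rw [hu', hu] at h1
        have h2 := hbas u' h1.symm (fun j hj => by simp [u', hj])
        rw [← hu', h2]
        rfl) (fun j => w j) (by rw [hext w fun j hj => hj]; exact hTw') ⟨.inl i, hi⟩
    exact (le_abs_self _).trans this

/-- The product of all denominators serves; each new numerator is the old one times the remaining
denominators. -/
theorem exists_common_denominator {κ : Type*} [Fintype κ] (q : κ → ℚ) {t : ℕ}
    (hn : ∀ k, |(q k).num| ≤ 2 ^ t) (hd : ∀ k, (q k).den ≤ 2 ^ t) :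
    ∃ (D : ℕ) (m : κ → ℤ), 0 < D ∧ (∀ k, (m k : ℚ) = D * q k) ∧
      ∀ k, |m k| ≤ 2 ^ (t * (Fintype.card κ + 1)) := by
  classical
  refine ⟨∏ k, (q k).den, fun k => (q k).num * ∏ k' ∈ Finset.univ.erase k, ((q k').den : ℤ),
    Finset.prod_pos fun k _ => (q k).den_pos, fun k => ?_, fun k => ?_⟩
  · rw [← Finset.mul_prod_erase Finset.univ (fun k => (q k).den) (Finset.mem_univ k)]
    push_cast
    rw [mul_comm ((q k).den : ℚ), mul_assoc, Rat.den_mul_eq_num, mul_comm]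
  · rw [abs_mul, mul_add, mul_one, add_comm, pow_add]
    refine mul_le_mul (hn k) ?_ (abs_nonneg _) (by positivity)
    rw [Finset.abs_prod]
    refine (Finset.prod_le_prod (fun _ _ => abs_nonneg _)
      (g := fun _ => (2 : ℤ) ^ t) fun k' _ => ?_).trans ?_
    · rw [Nat.abs_cast]
      exact_mod_cast hd k'
    · rw [Finset.prod_const, ← pow_mul]
      exact pow_le_pow_right₀ (by norm_num) (Nat.mul_le_mul_left _
        (Finset.card_le_univ _))

/-- A linear program over `{z ≥ 0 | A z ≤ b}` with rational `A` and `b` has a small optimal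
solution, if it has any. -/
theorem exists_small_minimizer {C V : Type*} [Fintype C] [Fintype V] (A : Matrix C V ℚ)
    (b : C → ℚ) {N t : ℕ} (hN : Fintype.card V + Fintype.card C ≤ N)
    (hA : ∀ r j, |(A r j).num| ≤ 2 ^ t ∧ (A r j).den ≤ 2 ^ t)
    (hb : ∀ r, |(b r).num| ≤ 2 ^ t ∧ (b r).den ≤ 2 ^ t) (l : V → ℝ) (z₀ : V → ℝ)
    (h₀ : 0 ≤ z₀) (hz₀ : A.map (Rat.cast : ℚ → ℝ) *ᵥ z₀ ≤ fun r => (b r : ℝ))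
    (hmin : ∀ z, 0 ≤ z → (A.map (Rat.cast : ℚ → ℝ) *ᵥ z ≤ fun r => (b r : ℝ)) →
      l ⬝ᵥ z₀ ≤ l ⬝ᵥ z) :
    ∃ z, 0 ≤ z ∧ (A.map (Rat.cast : ℚ → ℝ) *ᵥ z ≤ fun r => (b r : ℝ)) ∧ l ⬝ᵥ z = l ⬝ᵥ z₀ ∧
      ∀ i, z i ≤ 2 ^ (N + N ^ 2 + (N + 1) * (N + 2 * (t * (N * (N + 1) + 1)))) := by
  classical
  -- One denominator for all of `A` and `b`, with `none` as the column of `b`: at most `N * (N + 1)`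
  -- numbers. The objective `l` need not be rational, since the bound depends only on `A` and `b`.
  let q : C × Option V → ℚ := fun k =>
    match k with
    | (r, none) => b r
    | (r, some j) => A r j
  obtain ⟨D, m, hD, hm, hmle⟩ := exists_common_denominator q (t := t)
    (by rintro ⟨r, _ | j⟩; exacts [(hb r).1, (hA r j).1])
    (by rintro ⟨r, _ | j⟩; exacts [(hb r).2, (hA r j).2])
  have hcard : Fintype.card (C × Option V) ≤ N * (N + 1) := by
    rw [Fintype.card_prod, Fintype.card_option]
    exact Nat.mul_le_mul (by omega) (by omega)
  have hmle' : ∀ k, |m k| ≤ 2 ^ (t * (N * (N + 1) + 1)) := fun k =>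
    (hmle k).trans (pow_le_pow_right₀ (by norm_num)
      (Nat.mul_le_mul_left _ (Nat.add_le_add_right hcard 1)))
  have hDr : (0 : ℝ) < D := by exact_mod_cast hD
  let A' : Matrix C V ℤ := Matrix.of fun r j => m (r, some j)
  let b' : C → ℤ := fun r => m (r, none)
  have hA' : ∀ z : V → ℝ, ∀ r, (A'.map (Int.cast : ℤ → ℝ) *ᵥ z) r =
      D * (A.map (Rat.cast : ℚ → ℝ) *ᵥ z) r := by
    intro z r
    simp only [Matrix.mulVec, dotProduct, Matrix.map_apply, A', Matrix.of_apply, Finset.mul_sum]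
    refine Finset.sum_congr rfl fun j _ => ?_
    have : ((m (r, some j) : ℚ) : ℝ) = ((D * A r j : ℚ) : ℝ) := by rw [hm]
    push_cast at this
    rw [this, mul_assoc]
  have hb' : ∀ r, (b' r : ℝ) = D * (b r : ℝ) := by
    intro r
    have : ((m (r, none) : ℚ) : ℝ) = ((D * b r : ℚ) : ℝ) := by rw [hm]
    push_cast at this
    exact this
  have hiff : ∀ z : V → ℝ, (A'.map (Int.cast : ℤ → ℝ) *ᵥ z ≤ fun r => (b' r : ℝ)) ↔
      (A.map (Rat.cast : ℚ → ℝ) *ᵥ z ≤ fun r => (b r : ℝ)) := by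
    intro z
    simp only [Pi.le_def, hA', hb', mul_le_mul_iff_right₀ hDr]
  obtain ⟨z, hz, hAz, hlz, hle⟩ := exists_small_minimizer_int A' b' hN
    (fun r j => hmle' _) (fun r => hmle' _) l z₀ h₀ ((hiff z₀).2 hz₀)
    (fun z hz hAz => hmin z hz ((hiff z).1 hAz))
  exact ⟨z, hz, (hiff z).1 hAz, hlz, hle⟩

end BasicSolutions

/-! ### Encoding lengths -/

/-- The height of a rational number. -/
def ratHeight (a : ℚ) : ℕ := a.num.natAbs + a.den

theorem ratHeight_div_le (n : ℤ) {m : ℕ} (hm : 0 < m) :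
    ratHeight ((n : ℚ) / (m : ℚ)) ≤ n.natAbs + m := by
  have he : ((n : ℚ) / (m : ℚ)) = Rat.divInt n m := by
    rw [Rat.divInt_eq_div]
    norm_cast
  have hm' : (m : ℤ) ≠ 0 := by exact_mod_cast hm.ne'
  unfold ratHeight
  rw [he]
  refine add_le_add ?_ ?_
  · rcases eq_or_ne n 0 with rfl | hn
    · simp
    · exact Nat.le_of_dvd (Int.natAbs_pos.2 hn) (Int.natAbs_dvd_natAbs.2 (Rat.num_dvd n hm'))
  · exact Nat.le_of_dvd hm (by exact_mod_cast Rat.den_dvd n m)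

/-- Taking the sum of numerator and denominator makes the height submultiplicative under addition as
well as multiplication: the product of the heights expands into all terms of the unreduced fraction,
and reduction only lowers them. -/
theorem ratHeight_add_le (a b : ℚ) : ratHeight (a + b) ≤ ratHeight a * ratHeight b := by
  have h : a + b = ((a.num * b.den + b.num * a.den : ℤ) : ℚ) / ((a.den * b.den : ℕ) : ℚ) := by
    have ha : (a.den : ℚ) ≠ 0 := by exact_mod_cast a.den_ne_zero
    have hb : (b.den : ℚ) ≠ 0 := by exact_mod_cast b.den_ne_zero
    push_cast
    rw [← Rat.mul_den_eq_num a, ← Rat.mul_den_eq_num b]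
    field_simp
  rw [h]
  refine (ratHeight_div_le _ (Nat.mul_pos a.den_pos b.den_pos)).trans ?_
  have h1 := Int.natAbs_add_le (a.num * b.den) (b.num * a.den)
  rw [Int.natAbs_mul, Int.natAbs_mul, Int.natAbs_natCast, Int.natAbs_natCast] at h1
  unfold ratHeight
  nlinarith [Nat.zero_le (a.num.natAbs * b.num.natAbs)]

theorem ratHeight_mul_le (a b : ℚ) : ratHeight (a * b) ≤ ratHeight a * ratHeight b := by
  have h : a * b = ((a.num * b.num : ℤ) : ℚ) / ((a.den * b.den : ℕ) : ℚ) := by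
    have ha : (a.den : ℚ) ≠ 0 := by exact_mod_cast a.den_ne_zero
    have hb : (b.den : ℚ) ≠ 0 := by exact_mod_cast b.den_ne_zero
    push_cast
    rw [← Rat.mul_den_eq_num a, ← Rat.mul_den_eq_num b]
    field_simp
  rw [h]
  refine (ratHeight_div_le _ (Nat.mul_pos a.den_pos b.den_pos)).trans ?_
  rw [Int.natAbs_mul]
  unfold ratHeight
  nlinarith [Nat.zero_le (a.num.natAbs * b.den), Nat.zero_le (a.den * b.num.natAbs)]

theorem ratHeight_neg (a : ℚ) : ratHeight (-a) = ratHeight a := by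
  simp [ratHeight]

theorem ratHeight_inv_le (a : ℚ) : ratHeight a⁻¹ ≤ ratHeight a := by
  have hpos : ∀ a : ℚ, 0 < a → ratHeight a⁻¹ ≤ ratHeight a := fun a ha => by
    have hn : 0 < a.num := Rat.num_pos.2 ha
    have h : a⁻¹ = ((a.den : ℤ) : ℚ) / (a.num.natAbs : ℚ) := by
      have h1 : ((a.num.natAbs : ℤ) : ℚ) = (a.num : ℚ) := by rw [Int.natAbs_of_nonneg hn.le]
      rw [Int.cast_natCast] at h1
      conv_lhs => rw [← Rat.num_div_den a]
      rw [h1, inv_div, Int.cast_natCast]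
    rw [h]
    refine (ratHeight_div_le _ (Int.natAbs_pos.2 hn.ne')).trans ?_
    rw [Int.natAbs_natCast, add_comm]
    exact le_rfl
  rcases lt_trichotomy a 0 with h | rfl | h
  · have := hpos (-a) (by linarith)
    rwa [inv_neg, ratHeight_neg, ratHeight_neg] at this
  · simp
  · exact hpos a h

theorem ratHeight_le_two_pow_ratSize (a : ℚ) : ratHeight a ≤ 2 ^ ratSize a := by
  have h1 := (Nat.lt_size_self a.num.natAbs).le
  have h2 := (Nat.lt_size_self a.den).le
  have h3 : 2 ^ a.num.natAbs.size ≤ 2 ^ (a.num.natAbs.size + a.den.size) :=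
    Nat.pow_le_pow_right (by norm_num) (by omega)
  have h4 : 2 ^ a.den.size ≤ 2 ^ (a.num.natAbs.size + a.den.size) :=
    Nat.pow_le_pow_right (by norm_num) (by omega)
  unfold ratHeight ratSize
  rw [pow_succ]
  omega

theorem ratSize_le_of_ratHeight_le {a : ℚ} {k : ℕ} (h : ratHeight a ≤ 2 ^ k) :
    ratSize a ≤ 2 * k + 3 := by
  unfold ratHeight at h
  have h0 : 0 < 2 ^ k := by positivity
  have h1 : a.num.natAbs.size ≤ k + 1 := Nat.size_le.2 (by rw [pow_succ]; omega)
  have h2 : a.den.size ≤ k + 1 := Nat.size_le.2 (by rw [pow_succ]; omega)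
  unfold ratSize
  omega

/-- The rational number `x` has at most `K ^ a` bits. -/
def HasBits (K a : ℕ) (x : ℚ) : Prop := ratHeight x ≤ 2 ^ K ^ a

namespace HasBits

variable {K a b : ℕ} {x y : ℚ}

theorem mono (hK : 2 ≤ K) (h : HasBits K a x) (hab : a ≤ b) : HasBits K b x :=
  le_trans (h : ratHeight x ≤ _) (Nat.pow_le_pow_right (by norm_num)
    (Nat.pow_le_pow_right (by omega) hab))

/-- With `K ≥ 2`, one more power of `K` absorbs a sum of two powers. Hence each arithmetic
operation, and each sum of at most `K` terms, costs one unit of the exponent, and size estimates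
reduce to the depth of a formula. -/
theorem two_mul_pow_le (hK : 2 ≤ K) (a b : ℕ) : K ^ a + K ^ b ≤ K ^ (max a b + 1) := by
  have h1 : K ^ a ≤ K ^ max a b := Nat.pow_le_pow_right (by omega) (le_max_left _ _)
  have h2 : K ^ b ≤ K ^ max a b := Nat.pow_le_pow_right (by omega) (le_max_right _ _)
  have h3 := Nat.mul_le_mul_left (K ^ max a b) hK
  rw [pow_succ]
  omega

theorem of_le_mul (hK : 2 ≤ K) (hx : HasBits K a x) (hy : HasBits K b y) {z : ℚ}
    (hz : ratHeight z ≤ ratHeight x * ratHeight y) : HasBits K (max a b + 1) z := by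
  refine hz.trans ((Nat.mul_le_mul hx hy).trans ?_)
  rw [← pow_add]
  exact Nat.pow_le_pow_right (by norm_num) (two_mul_pow_le hK a b)

theorem add (hK : 2 ≤ K) (hx : HasBits K a x) (hy : HasBits K b y) :
    HasBits K (max a b + 1) (x + y) := of_le_mul hK hx hy (ratHeight_add_le x y)

theorem mul (hK : 2 ≤ K) (hx : HasBits K a x) (hy : HasBits K b y) :
    HasBits K (max a b + 1) (x * y) := of_le_mul hK hx hy (ratHeight_mul_le x y)

theorem neg (hx : HasBits K a x) : HasBits K a (-x) := by
  rw [HasBits, ratHeight_neg]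
  exact hx

theorem sub (hK : 2 ≤ K) (hx : HasBits K a x) (hy : HasBits K b y) :
    HasBits K (max a b + 1) (x - y) := by
  rw [sub_eq_add_neg]
  exact hx.add hK hy.neg

theorem inv (hx : HasBits K a x) : HasBits K a x⁻¹ :=
  (ratHeight_inv_le x).trans hx

theorem zero : HasBits K 0 0 := by simp [HasBits, ratHeight]

theorem one : HasBits K 0 1 := by simp [HasBits, ratHeight]

theorem one_div (hx : HasBits K a x) : HasBits K a (1 / x) := by
  rw [_root_.one_div]
  exact hx.inv

theorem sum {n : ℕ} (hn : n ≤ K) {f : Fin n → ℚ} (hf : ∀ i, HasBits K a (f i)) :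
    HasBits K (a + 1) (∑ i, f i) := by
  have key : ∀ s : Finset (Fin n), ratHeight (∑ i ∈ s, f i) ≤ (2 ^ K ^ a) ^ s.card := by
    classical
    intro s
    induction s using Finset.induction_on with
    | empty => simp [ratHeight]
    | insert i s hi ih =>
      rw [Finset.sum_insert hi, Finset.card_insert_of_notMem hi, pow_succ, mul_comm]
      exact (ratHeight_add_le _ _).trans (Nat.mul_le_mul (hf i) ih)
  refine (key Finset.univ).trans ?_
  rw [← pow_mul, Finset.card_univ, Fintype.card_fin, pow_succ]
  exact Nat.pow_le_pow_right (by norm_num) (Nat.mul_le_mul_left _ hn)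

theorem natCast {n : ℕ} (hn : n + 1 ≤ 2 ^ K ^ a) : HasBits K a (n : ℚ) := by
  simpa [HasBits, ratHeight] using hn

theorem ratSize_le (h : HasBits K a x) : ratSize x ≤ 2 * K ^ a + 3 :=
  ratSize_le_of_ratHeight_le h

theorem of_ratSize_le (h : ratSize x ≤ K) : HasBits K 1 x := by
  refine (ratHeight_le_two_pow_ratSize x).trans ?_
  rw [pow_one]
  exact Nat.pow_le_pow_right (by norm_num) h

end HasBits

theorem Fin.le_sum_nat {n : ℕ} (f : Fin n → ℕ) (i : Fin n) : f i ≤ ∑ i, f i :=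
  Finset.single_le_sum (f := f) (fun _ _ => Nat.zero_le _) (Finset.mem_univ i)

theorem Fin.le_sum_sum_nat {m n : ℕ} (f : Fin m → Fin n → ℕ) (i : Fin m) (j : Fin n) :
    f i j ≤ ∑ i, ∑ j, f i j :=
  (Fin.le_sum_nat (f i) j).trans (Fin.le_sum_nat (fun i => ∑ j, f i j) i)

/-! ### The number of variables and constraints -/

section Counting

variable {d : Dims}

/-- A code for the variables. -/
def MVar.code : MVar d → ℕ × ℕ × ℕ
  | .x j => (0, j, 0)
  | .y i => (1, i, 0)
  | .nuL k r => (2, k, r)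
  | .sL k => (3, k, 0)
  | .lamL => (4, 0, 0)
  | .tL => (5, 0, 0)
  | .uL k i => (6, k, i)
  | .nuF k r => (7, k, r)
  | .sF k => (8, k, 0)
  | .lamF => (9, 0, 0)
  | .tF => (10, 0, 0)
  | .uF k i => (11, k, i)
  | .muUp k i => (12, k, i)
  | .muLo k i => (13, k, i)
  | .tau k => (14, k, 0)
  | .beta r => (15, r, 0)
  | .gamma k => (16, k, 0)
  | .w r j => (17, r, j)

/-- A code for the constraints. -/
def MCon.code : MCon d → ℕ × ℕ × ℕ
  | .nonneg v => v.code
  | .xUpper j => (18, j, 0)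
  | .xSystem r => (19, r, 0)
  | .lossL k => (20, k, 0)
  | .absPosL k i => (21, k, i)
  | .absNegL k i => (22, k, i)
  | .normL k i => (23, k, i)
  | .ySystem r => (24, r, 0)
  | .lossF k => (25, k, 0)
  | .absPosF k i => (26, k, i)
  | .absNegF k i => (27, k, i)
  | .normF k i => (28, k, i)
  | .yCol i => (29, i, 0)
  | .nuCol k r => (30, k, r)
  | .gammaUpper k => (31, k, 0)
  | .normMu k i => (32, k, i)
  | .budget => (33, 0, 0)
  | .gammaSumLe => (34, 0, 0)
  | .gammaSumGe => (35, 0, 0)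
  | .dualityLe => (36, 0, 0)
  | .dualityGe => (37, 0, 0)
  | .prodBeta r j => (38, r, j)
  | .prodX r j => (39, r, j)
  | .prodLower r j => (40, r, j)

/-- The tags below 18 belong to the variables, so the constraint `nonneg v` can reuse the code of
`v` without a clash. -/
theorem MVar.code_fst_lt (v : MVar d) : v.code.1 < 18 := by
  cases v <;> simp [MVar.code]

theorem MVar.code_injective : Function.Injective (MVar.code (d := d)) := by
  intro v w h
  cases v <;> cases w <;> simp [MVar.code, Fin.ext_iff] at h ⊢ <;> exact h

theorem MCon.code_injective : Function.Injective (MCon.code (d := d)) := by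
  intro v w h
  cases v
  case nonneg v =>
    have hv := v.code_fst_lt
    cases w
    case nonneg w => rw [MVar.code_injective h]
    all_goals
      exfalso
      have h1 := congrArg Prod.fst h
      simp only [MCon.code] at h1
      omega
  all_goals
    cases w
    case nonneg w =>
      have hw := w.code_fst_lt
      exfalso
      have h1 := congrArg Prod.fst h
      simp only [MCon.code] at h1
      omega
    all_goals
      simp [MCon.code, Fin.ext_iff] at h ⊢ <;> exact h

theorem Dims.le_total (d : Dims) : d.m ≤ d.total ∧ d.n ≤ d.total ∧ d.dX ≤ d.total ∧
    d.dY ≤ d.total ∧ d.dS ≤ d.total ∧ d.kl ≤ d.total ∧ d.kf ≤ d.total := by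
  unfold Dims.total
  omega

theorem MVar.code_mem (v : MVar d) : v.code ∈
    Finset.range 41 ×ˢ Finset.range (d.total + 1) ×ˢ Finset.range (d.total + 1) := by
  have := d.le_total
  cases v <;> simp [MVar.code] <;> omega

theorem MCon.code_mem (v : MCon d) : v.code ∈
    Finset.range 41 ×ˢ Finset.range (d.total + 1) ×ˢ Finset.range (d.total + 1) := by
  have := d.le_total
  cases v
  case nonneg v => exact v.code_mem
  all_goals simp [MCon.code] <;> omega

/-- There are 41 tags and two indices. The ranges reach `T + 1` because absent indices are coded by
`0` even if all dimensions vanish. -/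
theorem card_le_of_code {α : Type} [Fintype α] {c : α → ℕ × ℕ × ℕ} (hc : Function.Injective c)
    {T : ℕ} (h : ∀ a, c a ∈ Finset.range 41 ×ˢ Finset.range (T + 1) ×ˢ Finset.range (T + 1)) :
    Fintype.card α ≤ 41 * (T + 1) ^ 2 := by
  have := Finset.card_le_card_of_injOn (s := Finset.univ) c (fun a _ => h a) hc.injOn
  simpa [pow_two] using this

theorem card_MVar_add_card_MCon_le (d : Dims) :
    Fintype.card (MVar d) + Fintype.card (MCon d) ≤ 82 * (d.total + 1) ^ 2 := by
  have h1 := card_le_of_code (MVar.code_injective (d := d)) MVar.code_mem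
  have h2 := card_le_of_code (MCon.code_injective (d := d)) MCon.code_mem
  omega

end Counting

namespace DRIData

variable {d : Dims}

/-! ### Rational instances -/

section Cast

variable (D : DRIData d ℚ)

theorem coord_cast (i j : MVar d) : ((coord i j : ℚ) : ℝ) = coord i j := by
  simp only [coord, Pi.single_apply]
  split_ifs <;> simp

theorem deltaL_cast (k : Fin d.kl) (r : Fin d.dS) :
    ((D.deltaL k r : ℚ) : ℝ) = D.toReal.deltaL k r := by
  simp [deltaL, toReal, Matrix.mulVec, dotProduct]

theorem deltaF_cast (k : Fin d.kf) (r : Fin d.dS) :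
    ((D.deltaF k r : ℚ) : ℝ) = D.toReal.deltaF k r := by
  simp [deltaF, toReal, Matrix.mulVec, dotProduct]

theorem milpRow_cast (M : ℚ) (r : MCon d) (i : MVar d) :
    ((D.milpRow M r i : ℚ) : ℝ) = D.toReal.milpRow (M : ℝ) r i := by
  cases r
  case nonneg v => cases v <;> simp [milpRow, coord_cast]
  case normL k i' => rcases hp : D.p with _ | _ <;>
    simp [milpRow, coord_cast, hp, toReal, Finset.sum_apply]
  case normF k i' => rcases hp : D.p with _ | _ <;>
    simp [milpRow, coord_cast, hp, toReal, Finset.sum_apply]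
  case normMu k i' => rcases hp : D.p with _ | _ <;>
    simp [milpRow, coord_cast, hp, toReal, Finset.sum_apply]
  all_goals
    simp [milpRow, gapRow, coord_cast, deltaL_cast, deltaF_cast, Finset.sum_apply]
  all_goals simp [toReal]

theorem milpRhs_cast (M : ℚ) (r : MCon d) :
    ((D.milpRhs M r : ℚ) : ℝ) = D.toReal.milpRhs (M : ℝ) r := by
  cases r <;> simp [milpRhs, toReal]

theorem milp_toReal (M : ℚ) : (D.milp M).toReal = D.toReal.milp (M : ℝ) := by
  have h1 : (D.milp M).toReal.obj = (D.toReal.milp (M : ℝ)).obj := by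
    funext i
    simp [MILP.toReal, milp, coord_cast, Finset.sum_apply]
    simp [toReal]
  have h2 : (D.milp M).toReal.A = (D.toReal.milp (M : ℝ)).A := by
    funext r i
    exact D.milpRow_cast M r i
  have h3 : (D.milp M).toReal.rhs = (D.toReal.milp (M : ℝ)).rhs := by
    funext r
    exact D.milpRhs_cast M r
  have h4 : (D.milp M).toReal.int = (D.toReal.milp (M : ℝ)).int := rfl
  cases h : (D.milp M).toReal
  cases h' : D.toReal.milp (M : ℝ)
  simp only [h, h'] at h1 h2 h3 h4
  rw [h1, h2, h3, h4]

end Cast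

/-! ### Bit lengths of the coefficients -/

section Bits

variable (D : DRIData d ℚ)

theorem total_le_size : d.total ≤ D.size := by
  unfold size
  omega

/-- The base `D.size + 2` is at least 2 and exceeds every dimension. The size of each datum is a
summand of `D.size`, whence the exponent 1. -/
theorem hasBits_data : (∀ i j, HasBits (D.size + 2) 1 (D.H i j)) ∧
    (∀ i, HasBits (D.size + 2) 1 (D.h i)) ∧
    (∀ i j, HasBits (D.size + 2) 1 (D.F i j)) ∧ (∀ i j, HasBits (D.size + 2) 1 (D.L i j)) ∧
    (∀ i, HasBits (D.size + 2) 1 (D.f i)) ∧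
    (∀ i j, HasBits (D.size + 2) 1 (D.B i j)) ∧ (∀ i, HasBits (D.size + 2) 1 (D.b i)) ∧
    (∀ k i, HasBits (D.size + 2) 1 (D.cl k i)) ∧ (∀ k i, HasBits (D.size + 2) 1 (D.cf k i)) ∧
    HasBits (D.size + 2) 1 D.al ∧ HasBits (D.size + 2) 1 D.af ∧
    HasBits (D.size + 2) 1 D.el ∧ HasBits (D.size + 2) 1 D.ef := by
  refine ⟨fun i j => ?_, fun i => ?_, fun i j => ?_, fun i j => ?_, fun i => ?_, fun i j => ?_,
    fun i => ?_, fun i j => ?_, fun i j => ?_, ?_, ?_, ?_, ?_⟩ <;> apply HasBits.of_ratSize_le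
  · have := Fin.le_sum_sum_nat (fun i j => ratSize (D.H i j)) i j
    unfold size; omega
  · have := Fin.le_sum_nat (fun i => ratSize (D.h i)) i
    unfold size; omega
  · have := Fin.le_sum_sum_nat (fun i j => ratSize (D.F i j)) i j
    unfold size; omega
  · have := Fin.le_sum_sum_nat (fun i j => ratSize (D.L i j)) i j
    unfold size; omega
  · have := Fin.le_sum_nat (fun i => ratSize (D.f i)) i
    unfold size; omega
  · have := Fin.le_sum_sum_nat (fun i j => ratSize (D.B i j)) i j
    unfold size; omega
  · have := Fin.le_sum_nat (fun i => ratSize (D.b i)) i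
    unfold size; omega
  · have := Fin.le_sum_sum_nat (fun i j => ratSize (D.cl i j)) i j
    unfold size; omega
  · have := Fin.le_sum_sum_nat (fun i j => ratSize (D.cf i j)) i j
    unfold size; omega
  all_goals unfold size; omega

variable {D} {K : ℕ}

theorem hasBits_coord (i j : MVar d) : HasBits K 0 (coord i j : ℚ) := by
  simp only [coord, Pi.single_apply]
  split_ifs
  · exact .one
  · exact .zero

theorem hasBits_delta {n N : ℕ} (hK : 2 ≤ K) (hn : n ≤ K) {B : Matrix (Fin N) (Fin n) ℚ}
    {b : Fin N → ℚ} {c : Fin n → ℚ} (hB : ∀ i j, HasBits K 1 (B i j)) (hb : ∀ i, HasBits K 1 (b i))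
    (hc : ∀ i, HasBits K 1 (c i)) (r : Fin N) : HasBits K 4 ((b - B *ᵥ c) r) := by
  have : (b - B *ᵥ c) r = b r - ∑ i, B r i * c i := rfl
  rw [this]
  exact ((hb r).sub hK (.sum hn fun i => (hB r i).mul hK (hc i))).mono hK (by decide)

theorem hasBits_deltaL (k : Fin d.kl) (r : Fin d.dS) : HasBits (D.size + 2) 4 (D.deltaL k r) := by
  obtain ⟨-, -, -, -, -, hB, hb, hcl, -⟩ := D.hasBits_data
  have := D.total_le_size
  have := d.le_total
  exact hasBits_delta (by omega) (by omega) hB hb (hcl k) r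

theorem hasBits_deltaF (k : Fin d.kf) (r : Fin d.dS) : HasBits (D.size + 2) 4 (D.deltaF k r) := by
  obtain ⟨-, -, -, -, -, hB, hb, -, hcf, -⟩ := D.hasBits_data
  have := D.total_le_size
  have := d.le_total
  exact hasBits_delta (by omega) (by omega) hB hb (hcf k) r

theorem hasBits_natCast {n : ℕ} (hn : n ≤ D.size) : HasBits (D.size + 2) 1 (n : ℚ) := by
  refine .natCast ?_
  have := Nat.lt_two_pow_self (n := D.size + 2)
  rw [pow_one]
  omega

/-- The exponents count nested operations. Rows without `M` fit into 12; in the two rows with `M`, a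
product and a sum or difference add 2 to the exponent of `M`. -/
theorem hasBits_milpRow {M : ℚ} {a : ℕ} (ha : 12 ≤ a) (hM : HasBits (D.size + 2) a M)
    (r : MCon d) (i : MVar d) : HasBits (D.size + 2) (a + 2) (D.milpRow M r i) := by
  obtain ⟨hH, -, hF, hL, hf, hB, -, hcl, hcf, hal, haf, hel, hef⟩ := D.hasBits_data
  have ht := D.total_le_size
  have hd := d.le_total
  have hkf : HasBits (D.size + 2) 1 (d.kf : ℚ) := hasBits_natCast (by omega)
  have hK : 2 ≤ D.size + 2 := by omega
  have hgap : HasBits (D.size + 2) 10 (D.gapRow i) := by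
    simp only [gapRow, Pi.sub_apply, Finset.sum_apply, Pi.smul_apply, Pi.add_apply, smul_eq_mul]
    exact (((HasBits.sum (by omega) fun r => (hf r).mul hK (hasBits_coord _ _)).sub hK
      (.sum (by omega) fun r => .sum (by omega) fun j =>
        (hL r j).mul hK (hasBits_coord _ _))).sub hK
      ((hasBits_coord _ _).sub hK ((HasBits.one.sub hK haf).one_div.mul hK
        ((hef.mul hK (hasBits_coord _ _)).add hK (hkf.one_div.mul hK
          (.sum (by omega) fun k => hasBits_coord _ _)))))).mono hK (by decide)
  have low : HasBits (D.size + 2) 12 (D.milpRow M r i) → HasBits (D.size + 2) (a + 2)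
      (D.milpRow M r i) := fun h => h.mono hK (by omega)
  cases r
  case nonneg v =>
    refine low (HasBits.mono (a := 0) hK ?_ (by decide))
    cases v
    case tL => exact .zero
    case tF => exact .zero
    all_goals exact (hasBits_coord _ _).neg
  case xUpper j => exact low ((hasBits_coord _ _).mono hK (by decide))
  case xSystem r =>
    refine low ?_
    simp only [milpRow, Finset.sum_apply, Pi.smul_apply, smul_eq_mul]
    exact (HasBits.sum (by omega) fun j => (hH r j).mul hK (hasBits_coord _ _)).mono hK
      (by decide)
  case lossL k =>
    refine low ?_
    simp only [milpRow, Pi.sub_apply, Finset.sum_apply, Pi.smul_apply, Pi.add_apply, smul_eq_mul]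
    exact ((((HasBits.sum (by omega) fun i => (hcl k i).mul hK (hasBits_coord _ _)).sub hK
      (hasBits_coord _ _)).add hK (.sum (by omega) fun r =>
        (hasBits_deltaL k r).mul hK (hasBits_coord _ _))).sub hK
      (hasBits_coord _ _)).mono hK (by decide)
  case absPosL k i' =>
    refine low ?_
    simp only [milpRow, Pi.sub_apply, Finset.sum_apply, Pi.smul_apply, smul_eq_mul]
    exact (((HasBits.sum (by omega) fun r => (hB r i').mul hK (hasBits_coord _ _)).sub hK
      (hasBits_coord _ _)).sub hK (hasBits_coord _ _)).mono hK (by decide)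
  case absNegL k i' =>
    refine low ?_
    simp only [milpRow, Pi.sub_apply, Pi.neg_apply, Finset.sum_apply, Pi.smul_apply, smul_eq_mul]
    exact (((HasBits.sum (by omega) fun r => (hB r i').mul hK (hasBits_coord _ _)).sub hK
      (hasBits_coord _ _)).neg.sub hK (hasBits_coord _ _)).mono hK (by decide)
  case normL k i' =>
    refine low ?_
    simp only [milpRow, Pi.sub_apply]
    rcases D.p with _ | _
    · exact ((hasBits_coord _ _).sub hK (hasBits_coord _ _)).mono hK (by decide)
    · simp only [Finset.sum_apply]
      exact ((HasBits.sum (by omega) fun i => hasBits_coord _ _).sub hK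
        (hasBits_coord _ _)).mono hK (by decide)
  case ySystem r =>
    refine low ?_
    simp only [milpRow, Pi.add_apply, Finset.sum_apply, Pi.smul_apply, smul_eq_mul]
    exact ((HasBits.sum (by omega) fun i => (hF r i).mul hK (hasBits_coord _ _)).add hK
      (.sum (by omega) fun j => (hL r j).mul hK (hasBits_coord _ _))).mono hK (by decide)
  case lossF k =>
    refine low ?_
    simp only [milpRow, Pi.sub_apply, Pi.neg_apply, Finset.sum_apply, Pi.smul_apply,
      Pi.add_apply, smul_eq_mul]
    exact ((((HasBits.sum (by omega) fun i => (hcf k i).mul hK (hasBits_coord _ _)).neg.add hK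
      (hasBits_coord _ _)).add hK (.sum (by omega) fun r =>
        (hasBits_deltaF k r).mul hK (hasBits_coord _ _))).sub hK
      (hasBits_coord _ _)).mono hK (by decide)
  case absPosF k i' =>
    refine low ?_
    simp only [milpRow, Pi.sub_apply, Pi.add_apply, Finset.sum_apply, Pi.smul_apply, smul_eq_mul]
    exact (((HasBits.sum (by omega) fun r => (hB r i').mul hK (hasBits_coord _ _)).add hK
      (hasBits_coord _ _)).sub hK (hasBits_coord _ _)).mono hK (by decide)
  case absNegF k i' =>
    refine low ?_
    simp only [milpRow, Pi.sub_apply, Pi.add_apply, Pi.neg_apply, Finset.sum_apply,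
      Pi.smul_apply, smul_eq_mul]
    exact (((HasBits.sum (by omega) fun r => (hB r i').mul hK (hasBits_coord _ _)).add hK
      (hasBits_coord _ _)).neg.sub hK (hasBits_coord _ _)).mono hK (by decide)
  case normF k i' =>
    refine low ?_
    simp only [milpRow, Pi.sub_apply]
    rcases D.p with _ | _
    · exact ((hasBits_coord _ _).sub hK (hasBits_coord _ _)).mono hK (by decide)
    · simp only [Finset.sum_apply]
      exact ((HasBits.sum (by omega) fun i => hasBits_coord _ _).sub hK
        (hasBits_coord _ _)).mono hK (by decide)
  case yCol i' =>
    refine low ?_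
    simp only [milpRow, Pi.sub_apply, Pi.add_apply, Pi.neg_apply, Finset.sum_apply,
      Pi.smul_apply, smul_eq_mul]
    exact (((HasBits.sum (by omega) fun r => (hF r i').mul hK (hasBits_coord _ _)).sub hK
      (.sum (by omega) fun k => (hcf k i').mul hK (hasBits_coord _ _))).add hK
      (.sum (by omega) fun k => (hasBits_coord _ _).sub hK (hasBits_coord _ _))).neg.mono hK
      (by decide)
  case nuCol k r =>
    refine low ?_
    simp only [milpRow, Pi.sub_apply, Pi.add_apply, Pi.neg_apply, Finset.sum_apply,
      Pi.smul_apply, smul_eq_mul]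
    exact (((hasBits_deltaF k r).mul hK (hasBits_coord _ _)).add hK (.sum (by omega) fun i =>
      (hB r i).mul hK ((hasBits_coord _ _).sub hK (hasBits_coord _ _)))).neg.mono hK (by decide)
  case gammaUpper k => exact low ((hasBits_coord _ _).mono hK (by decide))
  case normMu k i' =>
    refine low ?_
    simp only [milpRow, Pi.sub_apply]
    rcases D.p with _ | _
    · simp only [Finset.sum_apply, Pi.add_apply]
      exact ((HasBits.sum (by omega) fun i => (hasBits_coord _ _).add hK
        (hasBits_coord _ _)).sub hK (hasBits_coord _ _)).mono hK (by decide)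
    · exact (((hasBits_coord _ _).add hK (hasBits_coord _ _)).sub hK
        (hasBits_coord _ _)).mono hK (by decide)
  case budget =>
    refine low ?_
    simp only [milpRow, Finset.sum_apply]
    exact (HasBits.sum (by omega) fun k => hasBits_coord _ _).mono hK (by decide)
  case gammaSumLe =>
    refine low ?_
    simp only [milpRow, Finset.sum_apply]
    exact (HasBits.sum (by omega) fun k => hasBits_coord _ _).mono hK (by decide)
  case gammaSumGe =>
    refine low ?_
    simp only [milpRow, Finset.sum_apply, Pi.neg_apply]
    exact (HasBits.sum (by omega) fun k => hasBits_coord _ _).neg.mono hK (by decide)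
  case dualityLe => exact low (hgap.mono hK (by decide))
  case dualityGe => exact low (hgap.neg.mono hK (by decide))
  case prodBeta r j =>
    exact low (((hasBits_coord _ _).sub hK (hasBits_coord _ _)).mono hK (by decide))
  case prodX r j =>
    simp only [milpRow, Pi.sub_apply, Pi.smul_apply, smul_eq_mul]
    exact ((hasBits_coord _ _).sub hK (hM.mul hK (hasBits_coord _ _))).mono hK (by simp)
  case prodLower r j =>
    simp only [milpRow, Pi.sub_apply, Pi.add_apply, Pi.smul_apply, smul_eq_mul]
    exact (((hasBits_coord _ _).sub hK (hasBits_coord _ _)).add hK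
      (hM.mul hK (hasBits_coord _ _))).mono hK (by simp)

theorem hasBits_milpRhs {M : ℚ} {a : ℕ} (ha : 12 ≤ a) (hM : HasBits (D.size + 2) a M)
    (r : MCon d) : HasBits (D.size + 2) a (D.milpRhs M r) := by
  obtain ⟨-, hh, -, -, hf, -, -, -, -, -, haf, -, hef⟩ := D.hasBits_data
  have ht := D.total_le_size
  have hd := d.le_total
  have hkf : HasBits (D.size + 2) 1 (d.kf : ℚ) := hasBits_natCast (by omega)
  have hK : 2 ≤ D.size + 2 := by omega
  cases r
  case xUpper j => exact HasBits.one.mono hK (Nat.zero_le _)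
  case xSystem r => exact (hh r).mono hK (by omega)
  case ySystem r => exact (hf r).mono hK (by omega)
  case gammaUpper k =>
    exact (((HasBits.one.sub hK haf).mul hK hkf).one_div).mono hK (le_trans (by decide) ha)
  case budget =>
    exact ((HasBits.one.sub hK haf).one_div.mul hK hef).mono hK (le_trans (by decide) ha)
  case gammaSumLe => exact HasBits.one.mono hK (Nat.zero_le _)
  case gammaSumGe => exact HasBits.one.neg.mono hK (Nat.zero_le _)
  case prodLower r j => exact hM
  all_goals exact HasBits.zero.mono hK (Nat.zero_le _)

theorem hasBits_milp_obj (M : ℚ) (i : MVar d) :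
    HasBits (D.size + 2) 12 ((D.milp M).obj i) := by
  obtain ⟨-, -, -, -, -, -, -, -, -, hal, -, hel, -⟩ := D.hasBits_data
  have ht := D.total_le_size
  have hd := d.le_total
  have hkl : HasBits (D.size + 2) 1 (d.kl : ℚ) := hasBits_natCast (by omega)
  have hK : 2 ≤ D.size + 2 := by omega
  simp only [milp, Finset.sum_apply, Pi.smul_apply, Pi.add_apply, smul_eq_mul]
  exact ((hasBits_coord _ _).add hK ((HasBits.one.sub hK hal).one_div.mul hK
    ((hel.mul hK (hasBits_coord _ _)).add hK (hkl.one_div.mul hK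
      (.sum (by omega) fun k => hasBits_coord _ _))))).mono hK (by decide)

end Bits

end DRIData

/-! ### A rational big-M constant of polynomial encoding length -/

namespace HasBits

theorem num_den {K a : ℕ} {x : ℚ} (h : HasBits K a x) :
    |x.num| ≤ 2 ^ K ^ a ∧ x.den ≤ 2 ^ K ^ a := by
  unfold HasBits ratHeight at h
  refine ⟨?_, by omega⟩
  rw [Int.abs_eq_natAbs]
  exact_mod_cast (by omega : x.num.natAbs ≤ 2 ^ K ^ a)

end HasBits

/-- The exponent of the bound on the entries of basic solutions of a system with at most `N`
variables and constraints whose coefficients have numerators and denominators up to `2 ^ t`. -/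
def basicExponent (N t : ℕ) : ℕ := N + N ^ 2 + (N + 1) * (N + 2 * (t * (N * (N + 1) + 1)))

/-- The exponent 9 comes from `card_le_pow_size` and 14 = 12 + 2 from `hasBits_milpRow`. The added 1
leaves room for the height `2 ^ e + 1` of the integer `2 ^ e`. -/
theorem basicExponent_lt {K : ℕ} (hK : 2 ≤ K) : basicExponent (K ^ 9) (K ^ 14) + 1 ≤ K ^ 48 := by
  have h (a b : ℕ) : K ^ a + K ^ b ≤ K ^ (max a b + 1) := HasBits.two_mul_pow_le hK a b
  have h1 : K ^ 9 + 1 ≤ K ^ 10 := by simpa using h 9 0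
  have h2 : K ^ 9 * (K ^ 9 + 1) + 1 ≤ K ^ 20 :=
    calc K ^ 9 * (K ^ 9 + 1) + 1 ≤ K ^ 9 * K ^ 10 + K ^ 0 := by gcongr; simp
      _ = K ^ 19 + K ^ 0 := by rw [← pow_add]
      _ ≤ K ^ 20 := h 19 0
  have h3 : 2 * (K ^ 14 * (K ^ 9 * (K ^ 9 + 1) + 1)) ≤ K ^ 35 :=
    calc 2 * (K ^ 14 * (K ^ 9 * (K ^ 9 + 1) + 1)) ≤ K * (K ^ 14 * K ^ 20) := by gcongr
      _ = K ^ 35 := by ring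
  have h4 : (K ^ 9 + 1) * (K ^ 9 + 2 * (K ^ 14 * (K ^ 9 * (K ^ 9 + 1) + 1))) ≤ K ^ 46 :=
    calc _ ≤ K ^ 10 * (K ^ 9 + K ^ 35) := by gcongr
      _ ≤ K ^ 10 * K ^ 36 := Nat.mul_le_mul_left _ (h 9 35)
      _ = K ^ 46 := by rw [← pow_add]
  have h5 : K ^ 9 + (K ^ 9) ^ 2 ≤ K ^ 19 := by
    rw [← pow_mul]
    exact h 9 18
  have h6 := h 19 46
  have h7 := h 47 0
  norm_num at h6 h7
  unfold basicExponent
  omega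

namespace DRIData

variable {d : Dims} {D : DRIData d ℚ}

theorem card_le_pow_size (D : DRIData d ℚ) :
    Fintype.card (MVar d) + Fintype.card (MCon d) ≤ (D.size + 2) ^ 9 :=
  calc _ ≤ 82 * (d.total + 1) ^ 2 := card_MVar_add_card_MCon_le d
    _ ≤ 2 ^ 7 * (D.size + 2) ^ 2 := by
      gcongr
      · norm_num
      · exact D.total_le_size
      · norm_num
    _ ≤ (D.size + 2) ^ 7 * (D.size + 2) ^ 2 := by
      gcongr
      omega
    _ = (D.size + 2) ^ 9 := by rw [← pow_add]

/-- The follower's dual program has optimal solutions of polynomial encoding length. -/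
theorem exists_isDualOptimal_beta_le (hD : D.toReal.Standing) {x : Fin d.m → ℝ}
    (hx : x ∈ D.toReal.X) : ∃ v, v.x = x ∧ D.toReal.IsDualOptimal v ∧
      ∀ r, v.beta r ≤ 2 ^ basicExponent ((D.size + 2) ^ 9) ((D.size + 2) ^ 14) := by
  have hK : 2 ≤ D.size + 2 := by omega
  have hzero : HasBits (D.size + 2) 12 0 := HasBits.zero.mono hK (by decide)
  obtain ⟨v₀, rfl, hv₀⟩ := hD.exists_isDualOptimal hx
  -- All other rows are erased, which leaves the follower's dual polyhedron, the same for every `x`.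
  -- The value of `M` is immaterial in these rows and is set to zero.
  let A : Matrix (MCon d) (MVar d) ℚ :=
    Matrix.of fun r => if isDualCon r then D.milpRow 0 r else 0
  let b : MCon d → ℚ := fun r => if isDualCon r then D.milpRhs 0 r else 0
  -- Dual optimality says nothing about the remaining components, which may be negative; they are
  -- set to zero to satisfy the sign condition.
  let w : SLVars d :=
    { v₀ with
      x := 0, y := 0, nuL := 0, sL := 0, lamL := 0, tL := 0, nuF := 0, sF := 0, lamF := 0,
      tF := 0 }
  have hw : D.toReal.DualFeasible w :=
    ⟨hv₀.feasible.y_col, hv₀.feasible.nu_col, hv₀.feasible.gamma_nonneg, hv₀.feasible.gamma_le,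
      hv₀.feasible.muUp_nonneg, hv₀.feasible.muLo_nonneg, hv₀.feasible.budget,
      hv₀.feasible.gamma_sum, hv₀.feasible.beta_nonneg⟩
  let c : Fin d.dY → ℝ := -(D.toReal.L *ᵥ v₀.x) + D.toReal.f
  -- Here alone `x` enters, through an objective that does not affect the bound.
  let l : MVar d → ℝ := ∑ r, c r • coord (.beta r)
  have hl (z : MVar d → ℝ) : l ⬝ᵥ z = c ⬝ᵥ fun r => z (.beta r) := by
    simp only [l, sum_dotProduct, smul_dotProduct, coord_dotProduct, smul_eq_mul]
    rfl
  have hrow {r : MCon d} (hr : isDualCon r = true) (z : MVar d → ℝ) :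
      (A.map Rat.cast *ᵥ z) r = D.toReal.milpRow 0 r ⬝ᵥ z := by
    have : A.map Rat.cast r = D.toReal.milpRow 0 r := by
      funext i
      simpa [A, hr] using D.milpRow_cast 0 r i
    rw [← this]
    rfl
  have hrhs {r : MCon d} (hr : isDualCon r = true) : (b r : ℝ) = D.toReal.milpRhs 0 r := by
    simpa [b, hr] using D.milpRhs_cast 0 r
  have hfeas (z : MVar d → ℝ) (h0 : 0 ≤ z)
      (hz : A.map Rat.cast *ᵥ z ≤ fun r => (b r : ℝ)) :
      D.toReal.DualFeasible { toSL z with x := v₀.x } := by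
    have h := dualFeasible_of_rows (D := D.toReal) (M := 0) (fun i _ _ => h0 i)
      fun r hr => by simpa only [hrow hr, hrhs hr] using hz r
    exact ⟨h.y_col, h.nu_col, h.gamma_nonneg, h.gamma_le, h.muUp_nonneg, h.muLo_nonneg, h.budget,
      h.gamma_sum, h.beta_nonneg⟩
  obtain ⟨z, hz0, hz, hlz, hbound⟩ := exists_small_minimizer A b
    (N := (D.size + 2) ^ 9) (t := (D.size + 2) ^ 14) D.card_le_pow_size
    (fun r j => by
      refine HasBits.num_den ?_
      simp only [A, Matrix.of_apply]
      split_ifs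
      · exact hasBits_milpRow le_rfl hzero r j
      · exact HasBits.zero.mono hK (by decide))
    (fun r => by
      refine HasBits.num_den ?_
      simp only [b]
      split_ifs
      · exact (hasBits_milpRhs le_rfl hzero r).mono hK (by decide)
      · exact HasBits.zero.mono hK (by decide))
    l (D.toReal.ofSL w)
    (fun i => by
      cases i
      case muUp k i => exact hw.muUp_nonneg k i
      case muLo k i => exact hw.muLo_nonneg k i
      case tau k => exact D.toReal.p.norm_nonneg _
      case beta r => exact hw.beta_nonneg r
      case gamma k => exact hw.gamma_nonneg k
      all_goals simp [ofSL, w])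
    (fun r => by
      by_cases hr : isDualCon r = true
      · refine (hrow hr _).trans_le (le_trans ?_ (hrhs hr).ge)
        exact hw.rows_le 0 hr
      · simp [A, b, hr, Matrix.mulVec, dotProduct])
    (fun z h0 hz => by
      rw [hl, hl]
      exact hv₀.le _ (hfeas z h0 hz) rfl)
  refine ⟨{ toSL z with x := v₀.x }, rfl, ⟨hfeas z hz0 hz, fun v' hv' hx' => ?_⟩, fun r =>
    hbound _⟩
  rw [hl, hl] at hlz
  refine le_trans (le_of_eq ?_) (hv₀.le v' hv' hx')
  exact hlz

/-- A polynomial bound on the encoding length of the linearized problem. -/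
theorem milp_size_le {M : ℚ} {a : ℕ} (ha : 12 ≤ a) (hM : HasBits (D.size + 2) a M) :
    (D.milp M).size ≤ (D.size + 2) ^ (a + 30) := by
  set K := D.size + 2 with hKdef
  have hK : 2 ≤ K := by omega
  have hcard := D.card_le_pow_size
  rw [← hKdef] at hcard
  have hone : 1 ≤ K ^ (a + 2) := Nat.one_le_pow _ _ (by omega)
  have hsize {q : ℚ} {e : ℕ} (he : e ≤ a + 2) (h : HasBits K e q) : ratSize q ≤ K ^ (a + 5) := by
    have h1 := (h.mono hK he).ratSize_le
    have h2 : 2 ^ 3 * K ^ (a + 2) ≤ K ^ 3 * K ^ (a + 2) := by gcongr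
    rw [← pow_add, show 3 + (a + 2) = a + 5 by ring] at h2
    omega
  have hv : Fintype.card (MVar d) ≤ K ^ 9 := by omega
  have hc : Fintype.card (MCon d) ≤ K ^ 9 := by omega
  have hobj : ∑ i, ratSize ((D.milp M).obj i) ≤ K ^ 9 * K ^ (a + 5) :=
    (Finset.sum_le_card_nsmul _ _ _ fun i _ =>
      hsize (by omega) (hasBits_milp_obj M i)).trans (by simpa using Nat.mul_le_mul_right _ hv)
  have hA : ∑ r, ∑ i, ratSize ((D.milp M).A r i) ≤ K ^ 9 * (K ^ 9 * K ^ (a + 5)) :=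
    (Finset.sum_le_card_nsmul _ _ _ fun r _ => (Finset.sum_le_card_nsmul _ _ _ fun i _ =>
      hsize le_rfl (hasBits_milpRow ha hM r i)).trans
        (by simpa using Nat.mul_le_mul_right _ hv)).trans
          (by simpa using Nat.mul_le_mul_right _ hc)
  have hrhs : ∑ r, ratSize ((D.milp M).rhs r) ≤ K ^ 9 * K ^ (a + 5) :=
    (Finset.sum_le_card_nsmul _ _ _ fun r _ =>
      hsize (by omega) (hasBits_milpRhs ha hM r)).trans
        (by simpa using Nat.mul_le_mul_right _ hc)
  have e1 : K ^ 9 * K ^ (a + 5) ≤ K ^ (a + 23) := by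
    rw [← pow_add]
    exact Nat.pow_le_pow_right (by omega) (by omega)
  have e2 : K ^ 9 * (K ^ 9 * K ^ (a + 5)) = K ^ (a + 23) := by ring
  have e3 : K ^ 9 ≤ K ^ (a + 23) := Nat.pow_le_pow_right (by omega) (by omega)
  have e4 : 2 ^ 7 * K ^ (a + 23) ≤ K ^ 7 * K ^ (a + 23) := by gcongr
  rw [← pow_add, show 7 + (a + 23) = a + 30 by ring] at e4
  unfold MILP.size
  omega

/-- A Big-`M` constant of polynomial encoding length. -/
theorem exists_rational_bigM (hD : D.toReal.Standing) :
    ∃ M₀ : ℚ, (D.milp M₀).size ≤ (D.size + 2) ^ 78 ∧ ∀ M : ℚ, M₀ ≤ M →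
      IsReformulation D.toReal.bilevelFeasible (fun z => D.toReal.worstL z.2)
        (D.milp M).toReal.feasible (D.milp M).toReal.objective MVar.pair := by
  -- The exponent 48 is supplied by `basicExponent_lt`, and `milp_size_le` turns it into 78 = 48 +
  -- 30.
  refine ⟨2 ^ basicExponent ((D.size + 2) ^ 9) ((D.size + 2) ^ 14),
    milp_size_le (a := 48) (by decide) ?_, fun M hM => ?_⟩
  · have h := basicExponent_lt (K := D.size + 2) (by omega)
    generalize basicExponent ((D.size + 2) ^ 9) ((D.size + 2) ^ 14) = e at h ⊢
    have h1 : ratHeight ((2 : ℚ) ^ e) = 2 ^ e + 1 := by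
      have : ((2 : ℚ) ^ e) = ((2 ^ e : ℕ) : ℚ) := by push_cast; rfl
      rw [this]
      simp only [ratHeight, Rat.num_natCast, Rat.den_natCast, Int.natAbs_natCast]
    have h2 : 2 ^ (e + 1) ≤ 2 ^ (D.size + 2) ^ 48 := Nat.pow_le_pow_right (by decide) h
    have h3 : 1 ≤ 2 ^ e := Nat.one_le_two_pow
    rw [HasBits, h1]
    rw [pow_succ] at h2
    omega
  · rw [milp_toReal]
    refine hD.isReformulation_milp fun x hx => ?_
    obtain ⟨v, hvx, hv, hb⟩ := exists_isDualOptimal_beta_le hD hx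
    exact ⟨v, hvx, hv, fun r => (hb r).trans (by exact_mod_cast hM)⟩

end DRIData

theorem theorem1 :
    -- real data: the single-level problem, its linearization, and the number of its variables
    -- and constraints
    (∀ (d : Dims) (D : DRIData d ℝ), D.Standing →
      D.Attained ∧
      (∀ k, 0 ≤ D.deltaL k) ∧ (∀ k, 0 ≤ D.deltaF k) ∧
      IsReformulation D.bilevelFeasible (fun z => D.worstL z.2)
        D.slFeasible D.slObjective (fun v => (v.x, v.y)) ∧
      ∃ M₀ : ℝ, ∀ M : ℝ, M₀ ≤ M →
        IsReformulation D.bilevelFeasible (fun z => D.worstL z.2)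
          (D.milp M).feasible (D.milp M).objective MVar.pair) ∧
    (∃ P : Polynomial ℕ, ∀ d : Dims,
      Fintype.card (MVar d) + Fintype.card (MCon d) ≤ P.eval d.total) ∧
    -- rational data: the encoding length, that of the constant `M` included
    (∃ P : Polynomial ℕ, ∀ (d : Dims) (D : DRIData d ℚ), D.toReal.Standing →
      ∃ M₀ : ℚ, (D.milp M₀).size ≤ P.eval D.size ∧
        ∀ M : ℚ, M₀ ≤ M →
          IsReformulation D.toReal.bilevelFeasible (fun z => D.toReal.worstL z.2)
            (D.milp M).toReal.feasible (D.milp M).toReal.objective MVar.pair) := by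
  refine ⟨fun d D hD => ⟨hD.attained, hD.deltaL_nonneg, hD.deltaF_nonneg,
    hD.isReformulation_sl, hD.exists_bigM⟩, ⟨82 * (Polynomial.X + 1) ^ 2, fun d => ?_⟩,
    ⟨(Polynomial.X + 2) ^ 78, fun d D hD => ?_⟩⟩
  · simpa using card_MVar_add_card_MCon_le d
  · simpa using DRIData.exists_rational_bigM hD
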